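/- Let $k_e,k_x\ge 0$ and $n=2+k_e+k_x$. Let $L=\mathbb{R}^4\times\mathbb{R}^{2k_e}\times T^*\mathbb{T}^{k_x}$, $\mathbb{T}=\mathbb{R}/2\pi\mathbb{Z}$, with coordinates $(x_1,x_2,\xi_1,\xi_2,\mathbf{x}^e,\boldsymbol\xi^e,\boldsymbol\theta,\mathbf{I})$ and symplectic form $\omega=\sum dx_i\wedge d\xi_i+\sum dx^e_j\wedge d\xi^e_j+\sum d\theta_l\wedge dI_l$, and let $Q=(q_1,q_2,\mathbf{q}^e,\mathbf{I}):L\to\mathbb{R}^n$ be the linear model of Williamson type $\Bbbk=(k_e,k_f,k_h,k_x)$ with $k_f=1$, $k_h=0$: $$q_1=x_1\xi_1+x_2\xi_2,\qquad q_2=x_1\xi_2-x_2\xi_1,\qquad q^e_j=\tfrac12\big((x^e_j)^2+(\xi^e_j)^2\big).$$ The leaves of the foliation $\mathcal{Q}$ are the connected components of the fibres of $Q$. The flows of $q_2,\mathbf{q}^e,\mathbf{I}$ define an action of $\mathbb{T}^{n-1}$. For $\mathcal{U}\subseteq L$ let $P(\mathcal{U})$ be the set of points of type $\Bbbk$ in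 $\mathcal{U}$, i.e. those with $x_i=\xi_i=0$ and $\mathbf{x}^e=\boldsymbol\xi^e=0$, and let $V(\mathcal{U})=Q(P(\mathcal{U}))$. Let $\mathcal{U}\subseteq L$ be open, connected, $\mathbb{T}^{n-1}$-invariant and with $P(\mathcal{U})\neq\emptyset$ (for instance $\mathcal{U}=L$). Let $\psi:\mathcal{U}\to\mathcal{V}$ be a symplectomorphism onto an open set $\mathcal{V}\subseteq L$ that preserves the foliation: for every $p\in\mathcal{U}$, with $\Lambda$ the leaf through $p$ and $\Lambda'$ the leaf through $\psi(p)$, one has $\psi(\Lambda\cap\mathcal{U})=\Lambda'\cap\mathcal{V}$. Then there is a diffeomorphism $B:Q(\mathcal{V})\to Q(\mathcal{U})$ with $Q\circ\psi^{-1}=B\circ Q$ on $\mathcal{V}$ (these sets are relatively open in $\mathbb{R}^2\times[0,\infty)^{k_e}\times\mathbb{R}^{k_x}$, and smooth means smooth up to the boundary). Moreover, for every such $B$ there are signs $\epsilon^f_1,\epsilon^f_2,\epsilon^e_1,\dots,\epsilon^e_{k_e}\in\{\pm1\}$, a permutation $\sigma$ of $\{1,\dots,k_e\}$, integer matrices $X^f\in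 M_{k_x,1}(\mathbb{Z})$, $X^e\in M_{k_x,k_e}(\mathbb{Z})$, $X^x\in GL_{k_x}(\mathbb{Z})$, a vector $\kappa\in\mathbb{R}^{k_x}$ and a smooth function $u:Q(\mathcal{V})\to\mathbb{R}$ such that: 1. $u$ is flat on $V(\mathcal{V})$: its infinite jet, order zero included, vanishes in every direction at every point of $V(\mathcal{V})$; the same holds for all first partial derivatives of $u$. 2. On $Q(\mathcal{V})$, $B(q_1,q_2,\mathbf{q}^e,\mathbf{I})$ has first component $\epsilon^f_1q_1+u(q_1,q_2,\mathbf{q}^e,\mathbf{I})$, second component $\epsilon^f_2q_2$, elliptic components $\epsilon^e_i\,q^e_{\sigma(i)}$ $(1\le i\le k_e)$, and transverse components $X^fq_2+X^e\mathbf{q}^e+X^x\mathbf{I}+\kappa$. 3. Correspondingly, the first row of the Jacobian matrix of $B$ is $(\epsilon^f_1+\partial_{q_1}u,\ \partial_{q_2}u,\ \partial_{\mathbf{q}^e}u,\ \partial_{\mathbf{I}}u)$, and its other rows are constant: the $q_2$ row is $(0,\epsilon^f_2,0,0)$ (so $F^f=\epsilon^f_2$, $F^e=0$, $F^x=0$);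 the elliptic rows are $(0,0,E^e,0)$ with $E^e_{ij}=\epsilon^e_i\,\delta_{j,\sigma(i)}$ (so $E^f=0$, $E^x=0$); the transverse rows are $(0,X^f,X^e,X^x)$. 4. If $\psi$ does not relabel the elliptic blocks, i.e. for every $i$ it maps the points of $\mathcal{U}$ with $x^e_i=\xi^e_i=0$ to points with $x^e_i=\xi^e_i=0$, then $\sigma=\mathrm{id}$, so that $E^e=\mathrm{diag}(\epsilon^e_1,\dots,\epsilon^e_{k_e})$. 5. If $\psi$ maps some point of $\mathcal{U}$ on the zero torus $\{x_i=\xi_i=0,\ \mathbf{x}^e=\boldsymbol\xi^e=0,\ \mathbf{I}=0\}$ to a point of the zero torus, then $\kappa=0$. -/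

import Mathlib

open Set Topology
open scoped ContDiff

noncomputable section

namespace SemiToric

/-- Universal cover of the linear model with one focus-focus block, `ke` elliptic blocks and `kx`
transverse blocks: `((z₁, z₂), zᵉ, (θ, I))` with `z₁ = x₁ + i x₂`, `z₂ = ξ₁ + i ξ₂` and
`zᵉⱼ = xⱼ + i ξⱼ`. -/
abbrev Cover (ke kx : ℕ) : Type :=
  (ℂ × ℂ) × (Fin ke → ℂ) × ((Fin kx → ℝ) × (Fin kx → ℝ))

/-- The linear model `L = ℝ⁴ × ℝ^(2 ke) × T*(𝕋^kx)`, with `𝕋 = ℝ / 2πℤ`. -/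
abbrev Model (ke kx : ℕ) : Type :=
  (ℂ × ℂ) × (Fin ke → ℂ) × ((Fin kx → AddCircle (2 * Real.pi)) × (Fin kx → ℝ))

/-- The target `ℝⁿ`, `n = 2 + ke + kx`, of the momentum map, with coordinates
`(q₁, q₂, qᵉ, I)`. -/
abbrev Base (ke kx : ℕ) : Type := ℝ × ℝ × (Fin ke → ℝ) × (Fin kx → ℝ)

variable {ke kx : ℕ}

/-- The covering map, reducing the angles `θ` modulo `2π`. -/
def proj (x : Cover ke kx) : Model ke kx :=
  (x.1, x.2.1, (fun l => (x.2.2.1 l : AddCircle (2 * Real.pi))), x.2.2.2)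

/-- The symplectic form
`dx₁ ∧ dξ₁ + dx₂ ∧ dξ₂ + ∑ dxᵉⱼ ∧ dξᵉⱼ + ∑ dθₗ ∧ dIₗ`, which has constant coefficients in the
coordinates of the cover. -/
def omega (v w : Cover ke kx) : ℝ :=
  (v.1.1.re * w.1.2.re - v.1.2.re * w.1.1.re) + (v.1.1.im * w.1.2.im - v.1.2.im * w.1.1.im)
    + ∑ j, ((v.2.1 j).re * (w.2.1 j).im - (v.2.1 j).im * (w.2.1 j).re)
    + ∑ l, (v.2.2.1 l * w.2.2.2 l - v.2.2.2 l * w.2.2.1 l)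

/-- The linear momentum map `Q = (q₁, q₂, qᵉ, I)`: `q₁ = x₁ ξ₁ + x₂ ξ₂`, `q₂ = x₁ ξ₂ - x₂ ξ₁`,
`qᵉⱼ = (xⱼ² + ξⱼ²) / 2`. All components but `q₁` have a `2π`-periodic Hamiltonian flow. -/
def Q (p : Model ke kx) : Base ke kx :=
  (p.1.1.re * p.1.2.re + p.1.1.im * p.1.2.im,
    p.1.1.re * p.1.2.im - p.1.1.im * p.1.2.re,
    (fun j => ((p.2.1 j).re ^ 2 + (p.2.1 j).im ^ 2) / 2),
    p.2.2.2)

/-- The action of `𝕋^(n-1)` by the joint flow of `q₂`, `qᵉ` and `I`: `t` rotates `z₁` and `z₂`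
simultaneously, `s j` rotates `zᵉⱼ`, and `r` translates `θ`. -/
def torusAct (t : ℝ) (s : Fin ke → ℝ) (r : Fin kx → ℝ) (p : Model ke kx) : Model ke kx :=
  ((Complex.exp (t * Complex.I) * p.1.1, Complex.exp (t * Complex.I) * p.1.2),
    (fun j => Complex.exp (s j * Complex.I) * p.2.1 j),
    (fun l => p.2.2.1 l + (r l : AddCircle (2 * Real.pi))), p.2.2.2)

/-- A set is saturated when it is invariant under the `𝕋^(n-1)`-action. -/
def IsSaturated (U : Set (Model ke kx)) : Prop :=
  ∀ t s r, ∀ p ∈ U, torusAct t s r p ∈ U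

/-- The zero torus `z₁ = z₂ = 0`, `zᵉ = 0`, `I = 0`. -/
def zeroTorus : Set (Model ke kx) :=
  {p | p.1 = 0 ∧ p.2.1 = 0 ∧ p.2.2.2 = 0}

/-- `P_𝕜(U)`: the points of `U` of the Williamson type `𝕜 = (ke, 1, 0, kx)` of the model, i.e. those
at which the focus-focus block and all the elliptic blocks are singular. -/
def critPoints (U : Set (Model ke kx)) : Set (Model ke kx) :=
  {p ∈ U | p.1 = 0 ∧ p.2.1 = 0}

/-- `V_𝕜(U) = Q (P_𝕜(U))`. -/
def critValues (U : Set (Model ke kx)) : Set (Base ke kx) := Q '' critPoints U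

/-- The leaf through `p`: the connected component of `p` in its fibre of `Q`. -/
def leaf (p : Model ke kx) : Set (Model ke kx) := connectedComponentIn (Q ⁻¹' {Q p}) p

/-- `f` is, near `p`, a smooth map with `f^* ω = ω`. This is read in the coordinates given by the
covering map, i.e. on a local lift `F` of `f`. -/
def IsSymplecticAt (f : Model ke kx → Model ke kx) (p : Model ke kx) : Prop :=
  ∃ (x : Cover ke kx) (N : Set (Cover ke kx)) (F : Cover ke kx → Cover ke kx),
    proj x = p ∧ IsOpen N ∧ x ∈ N ∧ ContDiffOn ℝ ∞ F N ∧
    ∀ y ∈ N, proj (F y) = f (proj y) ∧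
      ∀ v w, omega (fderiv ℝ F y v) (fderiv ℝ F y w) = omega v w

/-- `ψ` is a symplectomorphism from the open set `ψ.source` onto the open set `ψ.target`. -/
def IsSymplectomorphism (ψ : OpenPartialHomeomorph (Model ke kx) (Model ke kx)) : Prop :=
  (∀ p ∈ ψ.source, IsSymplecticAt ψ p) ∧ ∀ p ∈ ψ.target, IsSymplecticAt ψ.symm p

/-- `ψ` sends the (traces on its source of the) leaves to (traces on its target of) leaves. -/
def PreservesFoliation (ψ : OpenPartialHomeomorph (Model ke kx) (Model ke kx)) : Prop :=
  ∀ p ∈ ψ.source, ψ '' (leaf p ∩ ψ.source) = leaf (ψ p) ∩ ψ.target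

/-- `B` is a diffeomorphism from `Q(ψ.target)` onto `Q(ψ.source)` with `Q ∘ ψ⁻¹ = B ∘ Q`. These
sets are relatively open in `ℝ² × [0, ∞)^ke × ℝ^kx`, and smoothness is smoothness up to the
boundary. -/
def IsAssociated (ψ : OpenPartialHomeomorph (Model ke kx) (Model ke kx))
    (B : Base ke kx → Base ke kx) : Prop :=
  (∀ p ∈ ψ.target, Q (ψ.symm p) = B (Q p)) ∧
  ContDiffOn ℝ ∞ B (Q '' ψ.target) ∧
  ∃ B' : Base ke kx → Base ke kx, ContDiffOn ℝ ∞ B' (Q '' ψ.source) ∧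
    MapsTo B (Q '' ψ.target) (Q '' ψ.source) ∧ MapsTo B' (Q '' ψ.source) (Q '' ψ.target) ∧
    InvOn B' B (Q '' ψ.target) (Q '' ψ.source)

/-- `♭_S(D)`: the smooth functions on `D` whose infinite jet (order zero included) at `c` in the
direction `v` vanishes, for all `(c, v) ∈ S`. -/
def Flat (S : Set (Base ke kx × Base ke kx)) (D : Set (Base ke kx)) : Set (Base ke kx → ℝ) :=
  {u | ContDiffOn ℝ ∞ u D ∧
    ∀ cv ∈ S, ∀ k : ℕ, iteratedFDerivWithin ℝ k u D cv.1 (fun _ => cv.2) = 0}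

/-- The linear map `(q₁, q₂, qᵉ, I) ↦ (ε₂ q₂, (εᵉᵢ qᵉ_{σ i})ᵢ, Xᶠ q₂ + Xᵉ qᵉ + Xˣ I)`: the last `n - 1`
rows of the Jacobian matrix of `B`. -/
def lowerRows (ε₂ : ℤˣ) (εe : Fin ke → ℤˣ) (σ : Equiv.Perm (Fin ke)) (Xf : Fin kx → ℤ)
    (Xe : Matrix (Fin kx) (Fin ke) ℤ) (Xx : Matrix.GeneralLinearGroup (Fin kx) ℤ)
    (c : Base ke kx) : ℝ × (Fin ke → ℝ) × (Fin kx → ℝ) :=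
  (((ε₂ : ℤ) : ℝ) * c.2.1,
    (fun i => ((εe i : ℤ) : ℝ) * c.2.2.1 (σ i)),
    (fun l => (Xf l : ℝ) * c.2.1 + ∑ j, (Xe l j : ℝ) * c.2.2.1 j
      + ∑ m, ((Xx : Matrix (Fin kx) (Fin kx) ℤ) l m : ℝ) * c.2.2.2 m))

end SemiToric

end

/-!
The fibres of `Q` are connected (`leaf_eq`), so a symplectomorphism `ψ` preserving the foliation
maps fibres of `Q` to fibres of `Q`, and descends to a bijection of the bases. `Q` has smooth
local sections in the focus-focus and transverse directions, and in the elliptic directions after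
the substitution `qᵉ = x² / 2`; Whitney's theorem on even functions (`contDiffOn_of_comp_fold`)
then makes the bijection and its inverse smooth up to the boundary (`exists_contDiffOn_comp_Q`).
This is `B`.

Being symplectic, `ψ` conjugates the Hamiltonian flow of `⟨a, Q⟩` to the one of `⟨b, Q⟩`, where
`b` is the image of `a` under the transposed Jacobian of `B` (`Conjugates.psi_flow`). The flows of
period `2π` at regular points form the lattice of integral vectors without `q₁`-component, so the
transposed Jacobian preserves this lattice, and so does its inverse. Therefore all rows of the
Jacobian but the first one are integral, have no `q₁`-entry, and are constant by connectedness
(`Conjugates.isInt_transp`, `Conjugates.transp_eq`). At a critical value, which `ψ` maps to a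
critical value by comparing stabilisers, `B` and its inverse preserve the quadrant `qᵉ ≥ 0`, which
forces the elliptic rows to be the rows of a permutation matrix (`Conjugates.exists_perm`); and
`B` preserves the focus-focus values `q₁ = q₂ = 0`, which forces the second row to be
`(0, ±1, 0, 0)` (`Conjugates.exists_e₂_row`). In particular all the signs of the elliptic rows are
`+1`.

It remains to compare the first component of `B` with `ε₁ q₁`, where `ε₁` is the sign of
`∂B₁ / ∂q₁`. Write `w = q₁ + i q₂ = conj z₁ * z₂`. The points `(δ, w / δ)` and `(conj w / δ, δ)`
of the fibre over `w` lie near the two sheets of the singular fibre, and are joined by the flow of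
`⟨a, Q⟩` with `a₁ + i a₂ = log (conj w / δ²)`. Their images are joined by the flow of the
transposed `b`, so that along a ray `w = r e` one obtains a relation
`exp (log r * (∂B₁/∂q₁ + i ∂B₁/∂q₂)) * (smooth, nonzero) = r ^ k * (smooth, nonzero)` with
`k ∈ {-1, 0, 1}`. As a smooth multiple of `log r` is smooth only if it is flat
(`exists_eq_pow_smul_of_log_smul`), the function `∂B₁/∂q₁ + i ∂B₁/∂q₂` differs from `k` by a
function which is flat at `r = 0`; since `∂B₁/∂q₁ ≠ 0` this gives `k = ε₁`
(`Conjugates.exists_ball_flat_ray`). Taylor's formula makes these estimates uniform in the ray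
(`exists_forall_ray_norm_le`), and integration in the `w`-plane bounds `u = B₁ - ε₁ q₁` by every
power of the distance to a critical value (`Conjugates.flatAt_fst_sub`). For smooth functions on
corner domains this growth condition passes to derivatives (`FlatAt.fderivWithin`), and hence
implies that all jets vanish.
-/

section

open Filter

noncomputable section

namespace SemiToric

/-! ### Hadamard's lemma and logarithmic relations -/

section Smooth

variable {E F : Type*} [NormedAddCommGroup E] [NormedSpace ℝ E] [NormedAddCommGroup F]
  [NormedSpace ℝ F]

/-- A smooth function on a neighbourhood of `x₀` can be cut off to a globally smooth function. -/
theorem exists_contDiff_eventuallyEq [FiniteDimensional ℝ E] {f : E → F} {O : Set E} {x₀ : E}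
    (hO : IsOpen O) (hx : x₀ ∈ O) (hf : ContDiffOn ℝ ∞ f O) :
    ∃ (χ : E → ℝ), ContDiff ℝ ∞ (fun x => χ x • f x) ∧ (∀ᶠ x in 𝓝 x₀, χ x = 1) ∧
      ∀ x ∉ O, χ x = 0 := by
  obtain ⟨r, hr, hrO⟩ := Metric.isOpen_iff.1 hO x₀ hx
  let χ : ContDiffBump x₀ := ⟨r / 4, r / 2, by positivity, by linarith⟩
  refine ⟨χ, ?_, χ.eventuallyEq_one, ?_⟩
  · rw [contDiff_iff_contDiffAt]
    intro x
    by_cases hxO : x ∈ O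
    · exact χ.contDiff.contDiffAt.smul (hf.contDiffAt (hO.mem_nhds hxO))
    · have : ∀ᶠ y in 𝓝 x, χ y • f y = 0 := by
        have h1 : x ∈ (Metric.closedBall x₀ (r / 2))ᶜ := by
          intro h
          exact hxO (hrO (Metric.closedBall_subset_ball (by linarith) h))
        filter_upwards [Metric.isClosed_closedBall.isOpen_compl.mem_nhds h1] with y hy
        have : r / 2 ≤ dist y x₀ := by
          simp at hy; exact hy.le
        rw [χ.zero_of_le_dist this, zero_smul]
      exact (contDiffAt_const (c := (0 : F))).congr_of_eventuallyEq this
  · intro x hxO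
    apply χ.zero_of_le_dist
    by_contra! h
    exact hxO (hrO (h.trans (show r / 2 < r by linarith)))

/-- Integrals of smooth functions over `[0, 1]` depend smoothly on parameters. This is read off from
the corresponding fact for convolutions, after cutting off the integrand outside `[0, 1]`. -/
theorem contDiff_integral_unitInterval {K : E × ℝ → F} (hK : ContDiff ℝ ∞ K) :
    ContDiff ℝ ∞ (fun x => ∫ t in (0 : ℝ)..1, K (x, t)) := by
  let χ : ContDiffBump (0 : ℝ) := ⟨2, 3, by norm_num, by norm_num⟩
  let g : E → ℝ → F := fun x t => χ t • K (x, -t)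
  let f : ℝ → ℝ := Set.indicator (Ioc 0 1) (fun _ => 1)
  have hg : ContDiff ℝ ∞ (↿g) := by
    have h1 : ContDiff ℝ ∞ (fun p : E × ℝ => χ p.2) := χ.contDiff.comp contDiff_snd
    exact h1.smul (hK.comp (contDiff_fst.prodMk contDiff_snd.neg))
  have hf : MeasureTheory.LocallyIntegrable f MeasureTheory.volume := by
    apply MeasureTheory.Integrable.locallyIntegrable
    exact (MeasureTheory.integrable_indicator_iff measurableSet_Ioc).2
      (MeasureTheory.integrableOn_const (by simp))
  have key := MeasureTheory.contDiffOn_convolution_right_with_param (𝕜 := ℝ)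
    (μ := MeasureTheory.volume) (n := ⊤)
    (ContinuousLinearMap.lsmul ℝ ℝ : ℝ →L[ℝ] F →L[ℝ] F) (f := f) (g := g) (s := (univ : Set E))
    (k := Metric.closedBall 0 3) isOpen_univ (isCompact_closedBall _ _) (by
      intro p x _ hx
      have : χ x = 0 := χ.zero_of_le_dist (by simp at hx; simpa using hx.le)
      simp [g, this]) hf hg.contDiffOn
  have key2 : ContDiff ℝ ∞ (fun q : E × ℝ =>
      MeasureTheory.convolution f (g q.1) (ContinuousLinearMap.lsmul ℝ ℝ : ℝ →L[ℝ] F →L[ℝ] F)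
        MeasureTheory.volume q.2) := by
    rw [univ_prod_univ] at key
    exact contDiffOn_univ.1 key
  have key3 := key2.comp (contDiff_prodMk_left (𝕜 := ℝ) (n := ∞) (F := ℝ) (E := E) 0)
  convert key3 using 1
  funext x
  simp only [Function.comp, MeasureTheory.convolution, f, g, zero_sub, neg_neg]
  rw [intervalIntegral.integral_of_le zero_le_one,
    ← MeasureTheory.integral_indicator measurableSet_Ioc]
  refine MeasureTheory.integral_congr_ae (Eventually.of_forall fun t => ?_)
  by_cases ht : t ∈ Ioc (0 : ℝ) 1
  · have : χ (-t) = 1 := χ.one_of_mem_closedBall (by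
      simp only [mem_closedBall_zero_iff, norm_neg, Real.norm_eq_abs, χ]
      rw [abs_of_pos ht.1]; linarith [ht.2])
    simp [ht, this]
  · simp [ht]

/-- Hadamard's lemma, global form: a smooth function vanishing on the hyperplane `l = 0` is
divisible by `l`. -/
theorem exists_contDiff_eq_smul_of_forall_eq_zero [CompleteSpace F] {f : E → F}
    (hf : ContDiff ℝ ∞ f) (l : E →L[ℝ] ℝ) (e : E) (he : l e = 1) (h0 : ∀ x, l x = 0 → f x = 0) :
    ∃ h : E → F, ContDiff ℝ ∞ h ∧ ∀ x, f x = l x • h x := by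
  -- the segment from the projection of `x` along `e` to the hyperplane, up to `x`
  let c : E × ℝ → E := fun p => p.1 - ((1 - p.2) * l p.1) • e
  have hc : ContDiff ℝ ∞ c := by fun_prop
  have hf' : ContDiff ℝ ∞ (fderiv ℝ f) := hf.fderiv_right (by simp)
  have hK : ContDiff ℝ ∞ (fun p => fderiv ℝ f (c p) e) :=
    (hf'.comp hc).clm_apply contDiff_const
  refine ⟨_, contDiff_integral_unitInterval hK, fun x => ?_⟩
  have hd : ∀ t : ℝ, HasDerivAt (fun t => f (c (x, t))) (l x • fderiv ℝ f (c (x, t)) e) t := by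
    intro t
    have h1 : HasDerivAt (fun t => c (x, t)) (l x • e) t := by
      have : HasDerivAt (fun t : ℝ => x - ((1 - t) * l x) • e) (-(((-1) * l x) • e)) t :=
        ((((hasDerivAt_id t).const_sub 1).mul_const (l x)).smul_const e).const_sub x
      convert this using 1
      simp
    have h2 := ((hf.differentiable (by simp)) (c (x, t))).hasFDerivAt.comp_hasDerivAt t h1
    rwa [map_smul] at h2
  have := intervalIntegral.integral_eq_sub_of_hasDerivAt (a := 0) (b := 1)
    (fun t _ => hd t) (by
      apply Continuous.intervalIntegrable
      have : Continuous (fun t : ℝ => fderiv ℝ f (c (x, t)) e) :=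
        hK.continuous.comp (by fun_prop)
      exact this.const_smul _)
  rw [intervalIntegral.integral_smul] at this
  rw [this]
  have e0 : f (c (x, 0)) = 0 := h0 _ (by simp [c, he])
  have e1 : c (x, 1) = x := by simp [c]
  rw [e0, e1, sub_zero]

/-- Hadamard's lemma, local form. -/
theorem exists_contDiff_eventuallyEq_smul [FiniteDimensional ℝ E] [CompleteSpace F] {f : E → F}
    {O : Set E} {x₀ : E} (hO : IsOpen O) (hx : x₀ ∈ O) (hf : ContDiffOn ℝ ∞ f O)
    (l : E →L[ℝ] ℝ) (e : E) (he : l e = 1) (h0 : ∀ x ∈ O, l x = 0 → f x = 0) :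
    ∃ h : E → F, ContDiff ℝ ∞ h ∧ ∀ᶠ x in 𝓝 x₀, f x = l x • h x := by
  obtain ⟨χ, hχ, h1, hχO⟩ := exists_contDiff_eventuallyEq hO hx hf
  obtain ⟨h, hh, heq⟩ := exists_contDiff_eq_smul_of_forall_eq_zero hχ l e he (by
    intro x hlx
    by_cases hxO : x ∈ O
    · simp [h0 x hxO hlx]
    · simp [hχO x hxO])
  refine ⟨h, hh, ?_⟩
  filter_upwards [h1] with x hx1
  rw [← heq, hx1, one_smul]

end Smooth

section OneVariable

variable {F : Type*} [NormedAddCommGroup F] [NormedSpace ℝ F]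

/-- If `h` and `log · h` both extend smoothly through `0`, then `h` is divisible by every power of
the variable: a nonzero Taylor coefficient of `h` would leave a logarithm. -/
theorem exists_eq_pow_smul_of_log_smul [CompleteSpace F] (N : ℕ) :
    ∀ {h S : ℝ → F}, ContDiff ℝ ∞ h → ContDiff ℝ ∞ S →
      (∀ᶠ r in 𝓝[>] (0 : ℝ), Real.log r • h r = S r) →
      ∃ k : ℝ → F, ContDiff ℝ ∞ k ∧ ∀ r, h r = r ^ N • k r := by
  induction N with
  | zero => intro h S hh _ _; exact ⟨h, hh, fun r => by simp⟩
  | succ N ih =>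
    intro h S hh hS heq
    have hlim : Tendsto (fun r : ℝ => (Real.log r)⁻¹ • S r) (𝓝[>] 0) (𝓝 0) := by
      have h1 : Tendsto (fun r : ℝ => (Real.log r)⁻¹) (𝓝[>] 0) (𝓝 0) :=
        tendsto_inv_atBot_zero.comp Real.tendsto_log_nhdsGT_zero
      have h2 : Tendsto S (𝓝[>] 0) (𝓝 (S 0)) := hS.continuous.continuousAt.mono_left inf_le_left
      simpa using h1.smul h2
    have hne : ∀ᶠ r in 𝓝[>] (0 : ℝ), Real.log r ≠ 0 :=
      (Real.tendsto_log_nhdsGT_zero.eventually (eventually_lt_atBot 0)).mono fun _ h => h.ne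
    have hh0 : h 0 = 0 := by
      have h2 : Tendsto h (𝓝[>] 0) (𝓝 (h 0)) := hh.continuous.continuousAt.mono_left inf_le_left
      refine tendsto_nhds_unique h2 (hlim.congr' ?_)
      filter_upwards [heq, hne] with r hr hr0
      rw [← hr, smul_smul, inv_mul_cancel₀ hr0, one_smul]
    obtain ⟨h₁, hh₁, e₁⟩ := exists_contDiff_eq_smul_of_forall_eq_zero hh
      (ContinuousLinearMap.id ℝ ℝ) 1 rfl (by rintro x (rfl : x = 0); exact hh0)
    have hS0 : S 0 = 0 := by
      have h2 : Tendsto S (𝓝[>] 0) (𝓝 (S 0)) := hS.continuous.continuousAt.mono_left inf_le_left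
      have h3 : Tendsto (fun r : ℝ => (Real.log r * r) • h₁ r) (𝓝[>] 0) (𝓝 ((0 : ℝ) • h₁ 0)) := by
        refine Tendsto.smul ?_ (hh₁.continuous.continuousAt.mono_left inf_le_left)
        have := (Real.continuous_mul_log.tendsto 0).mono_left (inf_le_left (b := 𝓟 (Ioi 0)))
        simp only [zero_mul] at this
        exact this.congr fun r => mul_comm _ _
      rw [zero_smul] at h3
      refine tendsto_nhds_unique h2 (h3.congr' ?_)
      filter_upwards [heq] with r hr
      rw [← hr, e₁ r, smul_smul]; rfl
    obtain ⟨S₁, hS₁, e₂⟩ := exists_contDiff_eq_smul_of_forall_eq_zero hS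
      (ContinuousLinearMap.id ℝ ℝ) 1 rfl (by rintro x (rfl : x = 0); exact hS0)
    obtain ⟨k, hk, e₃⟩ := ih hh₁ hS₁ (by
      filter_upwards [heq, self_mem_nhdsWithin] with r hr hr0
      rw [e₁, e₂, smul_comm] at hr
      exact smul_right_injective _ (ne_of_gt hr0) hr)
    refine ⟨k, hk, fun r => ?_⟩
    rw [e₁, e₃, smul_smul, pow_succ']; rfl

end OneVariable

/-- A continuous function whose distinct values keep a distance at least `1` is constant on
preconnected sets. -/
theorem _root_.IsPreconnected.eq_of_one_le_dist {α M : Type*} [TopologicalSpace α]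
    [PseudoMetricSpace M] {s : Set α} (hs : IsPreconnected s) {f : α → M} (hf : ContinuousOn f s)
    (hd : ∀ x ∈ s, ∀ y ∈ s, f x ≠ f y → 1 ≤ dist (f x) (f y)) {x y : α} (hx : x ∈ s) (hy : y ∈ s) :
    f x = f y := by
  refine hs.induction₂ (fun x y => f x = f y) ?_ ?_ ?_ hx hy
  · intro x hx
    have := (hf x hx).eventually (Metric.ball_mem_nhds (f x) one_pos)
    filter_upwards [this, self_mem_nhdsWithin] with y hy hys
    by_contra hne
    have := hd x hx y hys hne
    rw [dist_comm] at this
    exact absurd hy (by simpa using this)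
  · intro x y z _ _ _ h1 h2; exact h1.trans h2
  · intro x y _ _ h; exact h.symm

/-- If `exp (log r * g r)` extends smoothly and without zero through `r = 0`, then `g` is flat at
`0`. -/
theorem exists_eq_pow_mul_of_exp_log_mul {g m : ℝ → ℂ} (hg : ContDiff ℝ ∞ g) (hm : ContDiff ℝ ∞ m)
    (hm0 : m 0 ≠ 0)
    (heq : ∀ᶠ r in 𝓝[>] (0 : ℝ), Complex.exp (Real.log r * g r) = m r) (N : ℕ) :
    ∃ k : ℝ → ℂ, ContDiff ℝ ∞ k ∧ ∀ r, g r = (r : ℂ) ^ N * k r := by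
  let O : Set ℝ := {r | m r / m 0 ∈ Complex.slitPlane}
  have hO : IsOpen O := Complex.isOpen_slitPlane.preimage (hm.continuous.div_const _)
  have h0O : (0 : ℝ) ∈ O := by simp [O, hm0]
  let s : ℝ → ℂ := fun r => Complex.log (m r / m 0) + Complex.log (m 0)
  have hs : ContDiffOn ℝ ∞ s O := by
    intro r hr
    refine ContDiffAt.contDiffWithinAt (ContDiffAt.add ?_ contDiffAt_const)
    have h1 : ContDiffAt ℝ ∞ Complex.log (m r / m 0) :=
      (Complex.contDiffAt_log hr).restrict_scalars ℝ
    exact ContDiffAt.comp r h1 (hm.contDiffAt.div_const _)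
  have hexp : ∀ r ∈ O, Complex.exp (s r) = m r := by
    intro r hr
    have : m r / m 0 ≠ 0 := Complex.slitPlane_ne_zero hr
    rw [Complex.exp_add, Complex.exp_log this, Complex.exp_log hm0, div_mul_cancel₀ _ hm0]
  obtain ⟨ε, hε, hball⟩ := Metric.isOpen_iff.1 hO 0 h0O
  obtain ⟨ε', hε', hsub⟩ := mem_nhdsGT_iff_exists_Ioo_subset.1 heq
  let b := min ε ε'
  have hb : 0 < b := lt_min hε hε'
  have hbO : ∀ r ∈ Ioo 0 b, r ∈ O := fun r hr => hball (by
    rw [Metric.mem_ball, dist_zero_right, Real.norm_eq_abs, abs_of_pos hr.1]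
    exact hr.2.trans_le (min_le_left _ _))
  have hbe : ∀ r ∈ Ioo 0 b, Complex.exp (Real.log r * g r) = m r := fun r hr =>
    hsub ⟨hr.1, hr.2.trans_le (min_le_right _ _)⟩
  -- two logarithms of `m` differ by a multiple of `2πi`, which is constant by continuity
  let d : ℝ → ℂ := fun r => Real.log r * g r - s r
  have hd : ∀ r ∈ Ioo 0 b, ∃ n : ℤ, d r = n * (2 * Real.pi * Complex.I) := by
    intro r hr
    rw [← Complex.exp_eq_one_iff, Complex.exp_sub, hbe r hr, hexp r (hbO r hr), div_self]
    rw [← hbe r hr]; exact Complex.exp_ne_zero _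
  have hdc : ContinuousOn d (Ioo 0 b) := by
    refine ContinuousOn.sub (ContinuousOn.mul ?_ hg.continuous.continuousOn)
      (hs.continuousOn.mono hbO)
    exact Complex.continuous_ofReal.comp_continuousOn
      (Real.continuousOn_log.mono fun r hr => ne_of_gt hr.1)
  have hconst : ∀ r ∈ Ioo 0 b, d r = d (b / 2) := by
    intro r hr
    refine isPreconnected_Ioo.eq_of_one_le_dist hdc ?_ hr ⟨by linarith, by linarith⟩
    intro x hx y hy hne
    obtain ⟨n, hn⟩ := hd x hx
    obtain ⟨n', hn'⟩ := hd y hy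
    have hnn : n ≠ n' := by rintro rfl; exact hne (hn.trans hn'.symm)
    rw [dist_eq_norm, hn, hn', ← sub_mul, norm_mul]
    have h1 : (1 : ℝ) ≤ ‖(n : ℂ) - n'‖ := by
      rw [← Int.cast_sub, Complex.norm_intCast]
      exact_mod_cast Int.one_le_abs (sub_ne_zero.2 hnn)
    have h2 : (1 : ℝ) ≤ ‖2 * (Real.pi : ℂ) * Complex.I‖ := by
      simp only [norm_mul, Complex.norm_I, Complex.norm_real, Real.norm_eq_abs,
        abs_of_pos Real.pi_pos, Complex.norm_ofNat]
      linarith [Real.pi_gt_three]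
    nlinarith
  obtain ⟨χ, hχ, h1, -⟩ := exists_contDiff_eventuallyEq hO h0O
    (hs.add (contDiffOn_const (c := d (b / 2))))
  obtain ⟨k, hk, e⟩ := exists_eq_pow_smul_of_log_smul N hg hχ (by
    have h1' : ∀ᶠ r in 𝓝[>] (0 : ℝ), χ r = 1 := h1.filter_mono inf_le_left
    filter_upwards [h1', Ioo_mem_nhdsGT hb] with r hr hrb
    rw [hr, one_smul, ← hconst r hrb, Complex.real_smul]
    simp [d])
  exact ⟨k, hk, fun r => by rw [e, Complex.real_smul]; simp⟩

theorem _root_.ContDiffOn.complex_div {f g : ℝ → ℂ} {O : Set ℝ} (hf : ContDiffOn ℝ ∞ f O)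
    (hg : ContDiffOn ℝ ∞ g O) (h : ∀ r ∈ O, g r ≠ 0) : ContDiffOn ℝ ∞ (fun r => f r / g r) O := by
  simp only [div_eq_mul_inv]
  exact hf.mul (hg.inv h)

/-- Local form of `exists_eq_pow_mul_of_exp_log_mul`. -/
theorem flat_of_exp_log_mul {g m : ℝ → ℂ} {O : Set ℝ} (hO : IsOpen O) (h0 : (0 : ℝ) ∈ O)
    (hg : ContDiffOn ℝ ∞ g O) (hm : ContDiffOn ℝ ∞ m O) (hm0 : m 0 ≠ 0)
    (heq : ∀ᶠ r in 𝓝[>] (0 : ℝ), Complex.exp (Real.log r * g r) = m r) (N : ℕ) :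
    ∃ K : ℝ, ∀ᶠ r in 𝓝[>] (0 : ℝ), ‖g r‖ ≤ K * r ^ N := by
  obtain ⟨χ, hχ, h1, -⟩ := exists_contDiff_eventuallyEq hO h0 hg
  obtain ⟨η, hη, h2, -⟩ := exists_contDiff_eventuallyEq hO h0 hm
  have h1' := h1.filter_mono (nhdsWithin_le_nhds (s := Ioi 0))
  have h2' := h2.filter_mono (nhdsWithin_le_nhds (s := Ioi 0))
  obtain ⟨k, hk, hgk⟩ := exists_eq_pow_mul_of_exp_log_mul hχ hη
    (by rw [h2.self_of_nhds, one_smul]; exact hm0) (by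
      filter_upwards [heq, h1', h2'] with r h3 h4 h5
      rw [h4, h5, one_smul, one_smul, h3]) N
  have hb : ∀ᶠ r in 𝓝[>] (0 : ℝ), ‖k r‖ < ‖k 0‖ + 1 :=
    ((hk.continuous.norm.tendsto 0).eventually_lt_const (by linarith)).filter_mono
      nhdsWithin_le_nhds
  refine ⟨‖k 0‖ + 1, ?_⟩
  filter_upwards [hb, h1', self_mem_nhdsWithin] with r h3 h4 (h5 : 0 < r)
  have h6 := hgk r
  rw [h4, one_smul] at h6
  rw [h6, norm_mul, norm_pow, Complex.norm_real, Real.norm_of_nonneg h5.le, mul_comm]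
  gcongr

/-- If `conj a * a'` vanishes to first order at `0`, and `a`, `a'` do not both vanish there, then
`a` vanishes at most to first order. The power `r ^ s` is written `exp (log r * s)`, as in the
relations in which it is used. -/
theorem exists_eq_pow_mul_of_conj_mul {a a' F : ℝ → ℂ} {O : Set ℝ} (hO : IsOpen O)
    (h0 : (0 : ℝ) ∈ O) (ha : ContDiffOn ℝ ∞ a O) (ha' : ContDiffOn ℝ ∞ a' O)
    (hF : ContDiffOn ℝ ∞ F O) (h : ∀ r ∈ O, starRingEnd ℂ (a r) * a' r = F r)
    (hne : a 0 ≠ 0 ∨ a' 0 ≠ 0) (hF0 : F 0 = 0) {m : ℝ} (hm : m ≠ 0)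
    (hFm : ∀ r ∈ O, (F r).im = r * m) :
    ∃ (s : ℤ) (α : ℝ → ℂ) (O' : Set ℝ), (s = 0 ∨ s = 1) ∧ IsOpen O' ∧ (0 : ℝ) ∈ O' ∧
      ContDiffOn ℝ ∞ α O' ∧ α 0 ≠ 0 ∧
      ∀ᶠ r in 𝓝[>] (0 : ℝ), a r = Complex.exp (Real.log r * s) * α r := by
  by_cases h1 : a 0 = 0
  · have h2 : a' 0 ≠ 0 := hne.resolve_left (not_not.2 h1)
    obtain ⟨β, hβ, hFβ⟩ := exists_contDiff_eventuallyEq_smul hO h0 hF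
      (ContinuousLinearMap.id ℝ ℝ) 1 rfl (fun r _ hr => by
        have : r = 0 := hr
        rw [this, hF0])
    have hβ0 : (β 0).im = m := by
      refine tendsto_nhds_unique (((Complex.continuous_im.comp hβ.continuous).tendsto 0).mono_left
        (nhdsWithin_le_nhds (s := Ioi 0))) (tendsto_const_nhds.congr' ?_)
      filter_upwards [hFβ.filter_mono nhdsWithin_le_nhds,
        (hO.eventually_mem h0).filter_mono nhdsWithin_le_nhds, self_mem_nhdsWithin]
        with r h3 h4 (h5 : 0 < r)
      have h6 := hFm r h4
      rw [h3] at h6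
      simp only [ContinuousLinearMap.coe_id', id_eq, Complex.smul_im, smul_eq_mul] at h6
      exact (mul_left_cancel₀ h5.ne' h6).symm
    refine ⟨1, fun r => starRingEnd ℂ (β r / a' r), O ∩ a' ⁻¹' {0}ᶜ, Or.inr rfl,
      ha'.continuousOn.isOpen_inter_preimage hO isOpen_compl_singleton, ⟨h0, h2⟩, ?_, ?_, ?_⟩
    · exact Complex.conjCLE.contDiff.comp_contDiffOn
        (hβ.contDiffOn.complex_div (ha'.mono inter_subset_left) fun r hr => hr.2)
    · rw [map_ne_zero]
      refine div_ne_zero (fun h3 => hm ?_) h2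
      rw [← hβ0, h3, Complex.zero_im]
    · filter_upwards [hFβ.filter_mono nhdsWithin_le_nhds,
        (hO.eventually_mem h0).filter_mono nhdsWithin_le_nhds, self_mem_nhdsWithin,
        ((ha'.continuousOn.continuousAt (hO.mem_nhds h0)).eventually_ne h2).filter_mono
          nhdsWithin_le_nhds] with r h3 h4 (h5 : 0 < r) h6
      have h7 := h r h4
      rw [h3] at h7
      have h8 : starRingEnd ℂ (a r) = r * (β r / a' r) := by
        rw [← mul_div_assoc, eq_div_iff h6, h7]
        simp
      rw [Int.cast_one, mul_one, ← Complex.ofReal_exp, Real.exp_log h5]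
      have h9 := congrArg (starRingEnd ℂ) h8
      rwa [Complex.conj_conj, map_mul, Complex.conj_ofReal] at h9
  · exact ⟨0, a, O, Or.inl rfl, hO, h0, ha, h1, by simp⟩

/-- The exponent of a power relation between two functions vanishing at most to first order is, up
to a flat function, `0`, `1` or `-1`. -/
theorem exists_unit_flat_sub {a a' b b' F g E : ℝ → ℂ} {O : Set ℝ} (hO : IsOpen O)
    (h0 : (0 : ℝ) ∈ O) (ha : ContDiffOn ℝ ∞ a O) (ha' : ContDiffOn ℝ ∞ a' O)
    (hb : ContDiffOn ℝ ∞ b O) (hb' : ContDiffOn ℝ ∞ b' O)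
    (hF : ContDiffOn ℝ ∞ F O) (hg : ContDiffOn ℝ ∞ g O) (hE : ContDiffOn ℝ ∞ E O)
    (haF : ∀ r ∈ O, starRingEnd ℂ (a r) * a' r = F r)
    (hbF : ∀ r ∈ O, starRingEnd ℂ (b r) * b' r = F r)
    (hane : a 0 ≠ 0 ∨ a' 0 ≠ 0) (hbne : b 0 ≠ 0 ∨ b' 0 ≠ 0) (hF0 : F 0 = 0) {m : ℝ} (hm : m ≠ 0)
    (hFm : ∀ r ∈ O, (F r).im = r * m) (hE0 : E 0 ≠ 0) (hg0 : g 0 ≠ 0)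
    (heq : ∀ᶠ r in 𝓝[>] (0 : ℝ), Complex.exp (Real.log r * g r) * E r * a r = b r) :
    ∃ ε : ℤˣ, g 0 = ((ε : ℤ) : ℂ) ∧
      ∀ N : ℕ, ∃ K : ℝ, ∀ᶠ r in 𝓝[>] (0 : ℝ), ‖g r - ((ε : ℤ) : ℂ)‖ ≤ K * r ^ N := by
  obtain ⟨s, α, O₁, hs, hO₁, h01, hα, hα0, haα⟩ :=
    exists_eq_pow_mul_of_conj_mul hO h0 ha ha' hF haF hane hF0 hm hFm
  obtain ⟨t, β, O₂, ht, hO₂, h02, hβ, hβ0, hbβ⟩ :=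
    exists_eq_pow_mul_of_conj_mul hO h0 hb hb' hF hbF hbne hF0 hm hFm
  have hEα : ContDiffOn ℝ ∞ (fun r => E r * α r) (O ∩ O₁) :=
    (hE.mono inter_subset_left).mul (hα.mono inter_subset_right)
  have hne0 : E 0 * α 0 ≠ 0 := mul_ne_zero hE0 hα0
  have hO₃ : IsOpen (((O ∩ O₁) ∩ (fun r => E r * α r) ⁻¹' {0}ᶜ) ∩ O₂) :=
    (hEα.continuousOn.isOpen_inter_preimage (hO.inter hO₁) isOpen_compl_singleton).inter hO₂
  have hm' : ContDiffOn ℝ ∞ (fun r => β r / (E r * α r))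
      (((O ∩ O₁) ∩ (fun r => E r * α r) ⁻¹' {0}ᶜ) ∩ O₂) :=
    (hβ.mono inter_subset_right).complex_div (hEα.mono fun r hr => hr.1.1) fun r hr => hr.1.2
  have hflat := flat_of_exp_log_mul (g := fun r => g r - ((t - s : ℤ) : ℂ)) hO₃
    ⟨⟨⟨h0, h01⟩, hne0⟩, h02⟩
    ((hg.mono fun r hr => hr.1.1.1).sub contDiffOn_const) hm' (div_ne_zero hβ0 hne0) (by
      have hne : ∀ᶠ r in 𝓝[>] (0 : ℝ), E r * α r ≠ 0 :=
        ((hEα.continuousOn.continuousAt ((hO.inter hO₁).mem_nhds ⟨h0, h01⟩)).eventually_ne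
          hne0).filter_mono nhdsWithin_le_nhds
      filter_upwards [heq, haα, hbβ, hne] with r h1 h2 h3 h4
      rw [eq_div_iff h4]
      rw [h2, h3] at h1
      refine mul_left_cancel₀ (Complex.exp_ne_zero (Real.log r * t)) ?_
      rw [← h1]
      have h5 : Complex.exp (Real.log r * t) * Complex.exp (Real.log r * (g r - ((t - s : ℤ) : ℂ)))
          = Complex.exp (Real.log r * g r) * Complex.exp (Real.log r * s) := by
        rw [← Complex.exp_add, ← Complex.exp_add]
        push_cast
        ring_nf
      rw [← mul_assoc, h5]
      ring)
  have hg0' : g 0 = ((t - s : ℤ) : ℂ) := by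
    obtain ⟨K, hK⟩ := hflat 1
    have hc : ContinuousAt g 0 := hg.continuousOn.continuousAt (hO.mem_nhds h0)
    have h1 : Tendsto (fun r => ‖g r - ((t - s : ℤ) : ℂ)‖) (𝓝[>] 0)
        (𝓝 ‖g 0 - ((t - s : ℤ) : ℂ)‖) :=
      (hc.sub continuousAt_const).norm.tendsto.mono_left nhdsWithin_le_nhds
    have h2 : Tendsto (fun r : ℝ => K * r ^ 1) (𝓝[>] 0) (𝓝 (K * 0 ^ 1)) :=
      ((continuous_const.mul (continuous_id.pow 1)).tendsto 0).mono_left nhdsWithin_le_nhds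
    have h3 := le_of_tendsto_of_tendsto h1 h2 hK
    rw [zero_pow one_ne_zero, mul_zero, norm_le_zero_iff, sub_eq_zero] at h3
    exact h3
  obtain ⟨ε, hε⟩ : ∃ ε : ℤˣ, (ε : ℤ) = t - s := by
    refine Int.isUnit_iff.2 ?_
    have : t - s ≠ 0 := fun h => hg0 (by rw [hg0', h, Int.cast_zero])
    omega
  exact ⟨ε, by rw [hε, hg0'], fun N => by rw [hε]; exact hflat N⟩

/-! ### Flatness as a growth condition -/

/-- `f` is flat at `c₀` along `T`: it is `O(‖c - c₀‖ ^ N)` for every `N`. The bound is stated on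
balls of radius `s`, so that it also controls `f c₀`. -/
def FlatAt {E F : Type*} [NormedAddCommGroup E] [NormedAddCommGroup F] (f : E → F) (T : Set E)
    (c₀ : E) : Prop :=
  ∀ N : ℕ, ∃ K ρ : ℝ, 0 < ρ ∧ ∀ s ∈ Ioo 0 ρ, ∀ c ∈ T, ‖c - c₀‖ ≤ s → ‖f c‖ ≤ K * s ^ N

theorem FlatAt.eq_zero {E F : Type*} [NormedAddCommGroup E] [NormedAddCommGroup F] {f : E → F}
    {T : Set E} {c₀ : E} (h : FlatAt f T c₀) (hc : c₀ ∈ T) : f c₀ = 0 := by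
  obtain ⟨K, ρ, hρ, hK⟩ := h 1
  have h1 : Tendsto (fun s : ℝ => K * s ^ 1) (𝓝[>] 0) (𝓝 (K * 0 ^ 1)) :=
    ((continuous_const.mul (continuous_id.pow 1)).tendsto 0).mono_left inf_le_left
  have h2 : ‖f c₀‖ ≤ K * 0 ^ 1 := ge_of_tendsto h1 (by
    filter_upwards [Ioo_mem_nhdsGT hρ] with s hs
    exact hK s hs c₀ hc (by simpa using hs.1.le))
  simpa using h2

section FlatAt

variable {E F : Type*} [NormedAddCommGroup E] [NormedSpace ℝ E] [NormedAddCommGroup F]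
  [NormedSpace ℝ F]

/-- Near `c₀` the set `T` is convex, and stable under small translations in the directions of some
ball touching the origin. Relatively open subsets of a quadrant have this property. -/
def IsCornerAt (T : Set E) (c₀ : E) : Prop :=
  ∃ ρ > 0, ∃ e : E, ‖e‖ ≤ 1 ∧ Convex ℝ (T ∩ Metric.ball c₀ ρ) ∧
    ∀ c ∈ T ∩ Metric.ball c₀ ρ, ∀ v : E, ‖v‖ ≤ 1 → ∀ h ∈ Icc 0 ρ, c + h • (v + e) ∈ T

/-- The derivative of a flat function is flat. At distance `s` from `c₀`, compare `f` with its first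
order expansion over a step of length `s ^ (N + 1)`: the remainder is `O(s ^ (2 * (N + 1)))` as the
second derivative is bounded, and so is `f` itself by flatness. -/
theorem FlatAt.fderivWithin {f : E → F} {T : Set E} {c₀ : E} (h : FlatAt f T c₀)
    (hT : UniqueDiffOn ℝ T) (hcor : IsCornerAt T c₀) (hc₀ : c₀ ∈ T) (hf : ContDiffOn ℝ ∞ f T) :
    FlatAt (fderivWithin ℝ f T) T c₀ := by
  obtain ⟨ρ, hρ, e, he, hconv, hin⟩ := hcor
  have hf' : ContDiffOn ℝ ∞ (_root_.fderivWithin ℝ f T) T := hf.fderivWithin hT (by simp)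
  obtain ⟨L, t, ht, hL⟩ := (((hf' c₀ hc₀).of_le (by simp : (1 : ℕ∞ω) ≤ ∞)).mono
    inter_subset_left).exists_lipschitzOnWith hconv
  obtain ⟨ρ', hρ', hsub⟩ := Metric.mem_nhdsWithin_iff.1 ht
  intro N
  obtain ⟨K, ρ₁, hρ₁, hK⟩ := h (2 * (N + 1))
  let C : ℝ := 2 * |K| * 9 ^ (N + 1) + 4 * L
  have hC : 0 ≤ C := by positivity
  let ρ₂ : ℝ := min (min (ρ / 3) (ρ' / 3)) (min (ρ₁ / 3) 1)
  have hρ₂ : 0 < ρ₂ := by positivity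
  refine ⟨2 * C, ρ₂, hρ₂, fun s hs c hc hcs => ?_⟩
  have a1 : s < ρ / 3 := hs.2.trans_le ((min_le_left _ _).trans (min_le_left _ _))
  have a2 : s < ρ' / 3 := hs.2.trans_le ((min_le_left _ _).trans (min_le_right _ _))
  have a3 : s < ρ₁ / 3 := hs.2.trans_le ((min_le_right _ _).trans (min_le_left _ _))
  have a4 : s < 1 := hs.2.trans_le ((min_le_right _ _).trans (min_le_right _ _))
  have a0 : 0 < s := hs.1
  let δ : ℝ := s ^ (N + 1)
  have hδ : 0 < δ := by positivity
  have hδs : δ ≤ s := by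
    calc δ = s ^ N * s := pow_succ _ _
      _ ≤ 1 * s := by gcongr; exact pow_le_one₀ a0.le a4.le
      _ = s := one_mul _
  have hball : ∀ x, ‖x - c₀‖ ≤ 3 * s → x ∈ Metric.ball c₀ ρ ∧ x ∈ Metric.ball c₀ ρ' := by
    intro x hx
    simp only [mem_ball_iff_norm]
    constructor <;> linarith
  have step : ∀ v : E, ‖v‖ ≤ 1 → ‖_root_.fderivWithin ℝ f T c (v + e)‖ ≤ C * δ := by
    intro v hv
    have hw : ‖v + e‖ ≤ 2 := (norm_add_le _ _).trans (by linarith)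
    have hcB : c ∈ T ∩ Metric.ball c₀ ρ := ⟨hc, (hball c (by linarith)).1⟩
    let c' := c + δ • (v + e)
    have hcc' : ‖c' - c‖ ≤ 2 * δ := by
      simp only [c', add_sub_cancel_left, norm_smul, Real.norm_eq_abs, abs_of_pos hδ]
      nlinarith
    have hc's : ‖c' - c₀‖ ≤ 3 * s := by
      calc ‖c' - c₀‖ = ‖(c' - c) + (c - c₀)‖ := by congr 1; abel
        _ ≤ _ := norm_add_le _ _
        _ ≤ 3 * s := by linarith
    have hc'T : c' ∈ T := hin c hcB v hv δ ⟨hδ.le, by linarith⟩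
    have hseg : segment ℝ c c' ⊆ T ∩ Metric.ball c₀ ρ :=
      hconv.segment_subset hcB ⟨hc'T, (hball c' hc's).1⟩
    have hsegd : ∀ x ∈ segment ℝ c c', ‖x - c‖ ≤ 2 * δ := by
      intro x hx
      have : x ∈ Metric.closedBall c (2 * δ) :=
        (convex_closedBall c (2 * δ)).segment_subset (Metric.mem_closedBall_self (by positivity))
          (mem_closedBall_iff_norm.2 hcc') hx
      exact mem_closedBall_iff_norm.1 this
    have hmem : ∀ x ∈ segment ℝ c c', x ∈ t := by
      intro x hx
      refine hsub ⟨(hball x ?_).2, hseg hx⟩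
      calc ‖x - c₀‖ = ‖(x - c) + (c - c₀)‖ := by congr 1; abel
        _ ≤ _ := norm_add_le _ _
        _ ≤ 3 * s := by linarith [hsegd x hx]
    have hmv := (convex_segment c c').norm_image_sub_le_of_norm_hasFDerivWithin_le'
      (f := f) (f' := _root_.fderivWithin ℝ f T) (φ := _root_.fderivWithin ℝ f T c)
      (C := L * (2 * δ))
      (fun x hx => ((hf.differentiableOn (by simp) x (hseg hx).1).hasFDerivWithinAt).mono
        (hseg.trans inter_subset_left))
      (fun x hx => by
        have := hL.dist_le_mul x (hmem x hx) c (hmem c (left_mem_segment ℝ c c'))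
        rw [dist_eq_norm, dist_eq_norm] at this
        exact this.trans (by gcongr; exact hsegd x hx))
      (left_mem_segment ℝ c c') (right_mem_segment ℝ c c')
    have b1 : ‖f c‖ ≤ |K| * (3 * s) ^ (2 * (N + 1)) :=
      (hK (3 * s) ⟨by linarith, by linarith⟩ c hc (by linarith)).trans
        (by gcongr; exact le_abs_self K)
    have b2 : ‖f c'‖ ≤ |K| * (3 * s) ^ (2 * (N + 1)) :=
      (hK (3 * s) ⟨by linarith, by linarith⟩ c' hc'T hc's).trans
        (by gcongr; exact le_abs_self K)
    have e1 : (3 * s) ^ (2 * (N + 1)) = 9 ^ (N + 1) * δ * δ := by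
      simp only [δ]; rw [mul_pow, pow_mul]; ring
    have e2 : _root_.fderivWithin ℝ f T c (c' - c) = δ • _root_.fderivWithin ℝ f T c (v + e) := by
      simp [c']
    have b3 : ‖δ • _root_.fderivWithin ℝ f T c (v + e)‖ ≤ C * δ * δ := by
      rw [← e2]
      calc ‖_root_.fderivWithin ℝ f T c (c' - c)‖
          = ‖f c' - f c - (f c' - f c - _root_.fderivWithin ℝ f T c (c' - c))‖ := by congr 1; abel
        _ ≤ ‖f c'‖ + ‖f c‖ + L * (2 * δ) * ‖c' - c‖ :=
          (norm_sub_le _ _).trans (add_le_add (norm_sub_le _ _) hmv)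
        _ ≤ |K| * (3 * s) ^ (2 * (N + 1)) + |K| * (3 * s) ^ (2 * (N + 1))
            + L * (2 * δ) * (2 * δ) := by gcongr
        _ = C * δ * δ := by rw [e1]; ring
    rw [norm_smul, Real.norm_eq_abs, abs_of_pos hδ, mul_comm] at b3
    exact le_of_mul_le_mul_right b3 hδ
  -- every unit vector is a difference of two admissible directions
  have hfin : ‖_root_.fderivWithin ℝ f T c‖ ≤ 2 * C * δ := by
    refine ContinuousLinearMap.opNorm_le_of_unit_norm (by positivity) fun v hv => ?_
    have h1 := step v hv.le
    have h2 := step 0 (by simp)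
    calc ‖_root_.fderivWithin ℝ f T c v‖
        = ‖_root_.fderivWithin ℝ f T c (v + e) - _root_.fderivWithin ℝ f T c (0 + e)‖ := by
          rw [← map_sub]; congr 2; abel
      _ ≤ _ := norm_sub_le _ _
      _ ≤ 2 * C * δ := by linarith
  refine hfin.trans ?_
  gcongr
  exact pow_le_pow_of_le_one a0.le a4.le (Nat.le_succ N)

end FlatAt

section Jets

universe w
variable {E : Type w} [NormedAddCommGroup E] [NormedSpace ℝ E]

/-- All derivatives of a flat smooth function vanish. -/
theorem FlatAt.iteratedFDerivWithin_eq_zero {T : Set E} {c₀ : E}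
    (hT : UniqueDiffOn ℝ T) (hcor : IsCornerAt T c₀) (hc₀ : c₀ ∈ T) (k : ℕ) :
    ∀ {F : Type w} [NormedAddCommGroup F] [NormedSpace ℝ F] {f : E → F}, FlatAt f T c₀ →
      ContDiffOn ℝ ∞ f T → iteratedFDerivWithin ℝ k f T c₀ = 0 := by
  induction k with
  | zero =>
    intro F _ _ f h _
    ext m
    simp [h.eq_zero hc₀]
  | succ k ih =>
    intro F _ _ f h hf
    rw [← norm_eq_zero, ← norm_iteratedFDerivWithin_fderivWithin hT hc₀,
      ih (h.fderivWithin hT hcor hc₀ hf) (hf.fderivWithin hT (by simp)), norm_zero]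

end Jets

section Ray

variable {E : Type*} {F : Type} [NormedAddCommGroup E] [NormedSpace ℝ E] [NormedAddCommGroup F]
  [NormedSpace ℝ F]

theorem isCornerAt_Icc {b : ℝ} (hb : 0 < b) : IsCornerAt (Icc 0 b) 0 := by
  refine ⟨b / 4, by positivity, 1, by simp, ?_, ?_⟩
  · exact (convex_Icc 0 b).inter (convex_ball _ _)
  · rintro c ⟨hc, hcb⟩ v hv h hh
    rw [Real.norm_eq_abs, abs_le] at hv
    simp only [Metric.mem_ball, dist_zero_right, Real.norm_eq_abs, abs_lt] at hcb
    simp only [smul_eq_mul, mem_Icc] at hh ⊢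
    obtain ⟨h1, h2⟩ := hh
    constructor
    · have := hc.1
      have : 0 ≤ h * (v + 1) := mul_nonneg h1 (by linarith)
      linarith
    · have : h * (v + 1) ≤ b / 4 * 2 := mul_le_mul h2 (by linarith) (by linarith) (by positivity)
      linarith

/-- One-variable Taylor bound for a function which is flat at the left endpoint. -/
theorem norm_le_mul_pow_of_flat {g : ℝ → F} {b : ℝ} (hb : 0 < b) (hg : ContDiffOn ℝ ∞ g (Icc 0 b))
    (hflat : ∀ M : ℕ, ∃ C : ℝ, ∀ᶠ r in 𝓝[>] (0 : ℝ), ‖g r‖ ≤ C * r ^ M) {n : ℕ} {C : ℝ}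
    (hC : ∀ r ∈ Icc 0 b, ‖iteratedDerivWithin (n + 1) g (Icc 0 b) r‖ ≤ C) :
    ‖g b‖ ≤ C * b ^ (n + 1) := by
  have h0 : (0 : ℝ) ∈ Icc 0 b := ⟨le_rfl, hb.le⟩
  have hg0 : g 0 = 0 := by
    obtain ⟨C, hC⟩ := hflat 1
    have h1 : Tendsto (fun s : ℝ => C * s ^ 1) (𝓝[>] 0) (𝓝 (C * 0 ^ 1)) :=
      ((continuous_const.mul (continuous_id.pow 1)).tendsto 0).mono_left inf_le_left
    have h2 : Tendsto g (𝓝[>] 0) (𝓝 (g 0)) := by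
      have := (hg.continuousOn 0 h0)
      refine this.mono_left ?_
      rw [← nhdsWithin_Ioo_eq_nhdsGT hb]
      exact nhdsWithin_mono _ Ioo_subset_Icc_self
    simpa using le_of_tendsto_of_tendsto h2.norm h1 hC
  have hfl : FlatAt g (Icc 0 b) 0 := by
    intro M
    obtain ⟨C, hC⟩ := hflat M
    obtain ⟨ε, hε, hsub⟩ := mem_nhdsGT_iff_exists_Ioo_subset.1 hC
    refine ⟨|C|, ε, hε, fun s hs c hc hcs => ?_⟩
    rw [sub_zero, Real.norm_eq_abs, abs_of_nonneg hc.1] at hcs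
    rcases hc.1.eq_or_lt with rfl | hc0
    · rw [hg0, norm_zero]
      have := hs.1
      positivity
    · have h3 : ‖g c‖ ≤ C * c ^ M := hsub ⟨hc0, hcs.trans_lt hs.2⟩
      calc ‖g c‖ ≤ C * c ^ M := h3
        _ ≤ |C| * c ^ M := by gcongr; exact le_abs_self C
        _ ≤ |C| * s ^ M := by gcongr
  have hT : taylorWithinEval g n (Icc 0 b) 0 b = 0 := by
    rw [taylor_within_apply]
    refine Finset.sum_eq_zero fun k _ => ?_
    rw [iteratedDerivWithin_eq_iteratedFDerivWithin,
      hfl.iteratedFDerivWithin_eq_zero (uniqueDiffOn_Icc hb) (isCornerAt_Icc hb) h0 k hg]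
    simp
  have := taylor_mean_remainder_bound hb.le (hg.of_le (by
    exact_mod_cast le_top)) (right_mem_Icc.2 hb.le) hC
  rw [hT, sub_zero, sub_zero] at this
  have hC0 : 0 ≤ C := (norm_nonneg _).trans (hC 0 h0)
  refine this.trans (div_le_self (by positivity) ?_)
  exact_mod_cast Nat.one_le_iff_ne_zero.2 (Nat.factorial_ne_zero n)

/-- A smooth function near `y₀` which is flat at the origin of a ray is, on this ray, bounded by a
power of the distance to the origin, with a constant which does not depend on the ray. -/
theorem exists_forall_ray_norm_le {T : Set E} {f : E → F} (hT : UniqueDiffOn ℝ T)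
    (hf : ContDiffOn ℝ ∞ f T) {y₀ : E} (hy₀ : y₀ ∈ T) (n : ℕ) :
    ∃ K ρ : ℝ, 0 < ρ ∧ ∀ (y v : E) (b : ℝ), ‖v‖ ≤ 1 → 0 < b →
      (∀ r ∈ Icc 0 b, y + r • v ∈ T ∩ Metric.ball y₀ ρ) →
      (∀ M : ℕ, ∃ C : ℝ, ∀ᶠ r in 𝓝[>] (0 : ℝ), ‖f (y + r • v)‖ ≤ C * r ^ M) →
      ‖f (y + b • v)‖ ≤ K * b ^ (n + 1) := by
  have h1 : ∀ᶠ y in 𝓝[T] y₀, ∀ i ∈ Finset.range (n + 2),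
      ‖iteratedFDerivWithin ℝ i f T y‖ ≤ ‖iteratedFDerivWithin ℝ i f T y₀‖ + 1 := by
    rw [Filter.eventually_all_finset]
    intro i _
    have := (hf.continuousOn_iteratedFDerivWithin (m := i) (by exact_mod_cast le_top) hT y₀
      hy₀).norm
    exact (this.eventually (gt_mem_nhds (lt_add_one _))).mono fun _ h => h.le
  obtain ⟨ρ, hρ, hsub⟩ := Metric.mem_nhdsWithin_iff.1 h1
  let C : ℝ := ∑ i ∈ Finset.range (n + 2), (‖iteratedFDerivWithin ℝ i f T y₀‖ + 1)
  refine ⟨(n + 1).factorial * C * 1 ^ (n + 1), ρ, hρ, fun y v b hv hb hray hflat => ?_⟩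
  let l : ℝ → E := fun r => y + r • v
  have hl : ContDiff ℝ ∞ l := by fun_prop
  have hmaps : MapsTo l (Icc 0 b) T := fun r hr => (hray r hr).1
  refine norm_le_mul_pow_of_flat (g := f ∘ l) hb (hf.comp hl.contDiffOn hmaps) hflat fun r hr => ?_
  rw [← norm_iteratedFDerivWithin_eq_norm_iteratedDerivWithin]
  refine norm_iteratedFDerivWithin_comp_le hf hl.contDiffOn (by exact_mod_cast le_top) hT
    (uniqueDiffOn_Icc hb) hmaps hr (fun i hi => ?_) (fun i hi _ => ?_)
  · have hmem : i ∈ Finset.range (n + 2) := Finset.mem_range.2 (by omega)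
    refine (hsub ⟨(hray r hr).2, (hray r hr).1⟩ i hmem).trans ?_
    exact Finset.single_le_sum
      (f := fun i => ‖iteratedFDerivWithin ℝ i f T y₀‖ + 1) (fun _ _ => by positivity) hmem
  · obtain ⟨j, rfl⟩ : ∃ j, i = j + 1 := ⟨i - 1, by omega⟩
    have hU := uniqueDiffOn_Icc hb
    have hd : ∀ x ∈ Icc 0 b, fderivWithin ℝ l (Icc 0 b) x
        = ContinuousLinearMap.toSpanSingleton ℝ v := by
      intro x hx
      have h3 : HasFDerivAt l (ContinuousLinearMap.toSpanSingleton ℝ v) x :=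
        ((ContinuousLinearMap.toSpanSingleton ℝ v).hasFDerivAt).const_add y
      exact h3.hasFDerivWithinAt.fderivWithin (hU x hx)
    rw [← norm_iteratedFDerivWithin_fderivWithin hU hr, iteratedFDerivWithin_congr hd hr, one_pow]
    rcases j with _ | j
    · rw [norm_iteratedFDerivWithin_zero, ContinuousLinearMap.norm_toSpanSingleton]
      exact hv
    · rw [iteratedFDerivWithin_const_of_ne (by omega)]
      simp

end Ray

variable {ke kx : ℕ}

/-! ### Quadrants and Whitney's theorem on even functions -/

theorem tendsto_add_smul {E : Type*} [NormedAddCommGroup E] [NormedSpace ℝ E] (c v : E) :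
    Tendsto (fun t : ℝ => c + t • v) (𝓝[>] 0) (𝓝 c) := by
  have : Continuous (fun t : ℝ => c + t • v) := by fun_prop
  have h := this.tendsto 0
  rw [zero_smul, add_zero] at h
  exact h.mono_left nhdsWithin_le_nhds

/-- The set `ℝ² × [0, ∞)^ke × ℝ^kx`, which is the image of `Q`. -/
def quadrant (ke kx : ℕ) : Set (Base ke kx) := {c | ∀ j, 0 ≤ c.2.2.1 j}

/-- The interior `ℝ² × (0, ∞)^ke × ℝ^kx` of the quadrant. -/
def openQuadrant (ke kx : ℕ) : Set (Base ke kx) := {c | ∀ j, 0 < c.2.2.1 j}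

/-- Relatively open subsets of the quadrant. -/
def IsRelOpen (T : Set (Base ke kx)) : Prop := ∃ O, IsOpen O ∧ T = quadrant ke kx ∩ O

/-- The vector pointing diagonally into the elliptic directions. -/
def diag (ke kx : ℕ) : Base ke kx := (0, 0, fun _ => 1, 0)

theorem norm_diag_le : ‖diag ke kx‖ ≤ 1 := by
  simp only [diag, Prod.norm_def, norm_zero]
  refine max_le zero_le_one (max_le zero_le_one (max_le ?_ zero_le_one))
  exact (pi_norm_le_iff_of_nonneg zero_le_one).2 fun _ => by simp

theorem abs_coord_le (v : Base ke kx) (j : Fin ke) : |v.2.2.1 j| ≤ ‖v‖ :=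
  (norm_le_pi_norm v.2.2.1 j).trans
    ((norm_fst_le v.2.2).trans ((norm_snd_le v.2).trans (norm_snd_le v)))

theorem isOpen_openQuadrant : IsOpen (openQuadrant ke kx) := by
  simp only [openQuadrant, ofPred_forall]
  exact isOpen_iInter_of_finite fun j => isOpen_lt continuous_const (by fun_prop)

theorem isClosed_quadrant : IsClosed (quadrant ke kx) := by
  simp only [quadrant, ofPred_forall]
  exact isClosed_iInter fun j => isClosed_le continuous_const (by fun_prop)

theorem openQuadrant_subset : openQuadrant ke kx ⊆ quadrant ke kx := fun _ h j => (h j).le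

theorem convex_quadrant : Convex ℝ (quadrant ke kx) := by
  intro x hx y hy a b ha hb _ j
  have h1 := hx j
  have h2 := hy j
  simp only [Prod.snd_add, Prod.fst_add, Prod.smul_snd, Prod.smul_fst, Pi.add_apply, Pi.smul_apply,
    smul_eq_mul]
  positivity

theorem convex_openQuadrant : Convex ℝ (openQuadrant ke kx) := by
  intro x hx y hy a b ha hb hab j
  have h1 := hx j
  have h2 := hy j
  simp only [Prod.snd_add, Prod.fst_add, Prod.smul_snd, Prod.smul_fst, Pi.add_apply, Pi.smul_apply,
    smul_eq_mul]
  rcases ha.eq_or_lt with rfl | ha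
  · rw [zero_add] at hab; subst hab; linarith
  · positivity

theorem add_smul_diag_mem {c : Base ke kx} (hc : c ∈ quadrant ke kx) {t : ℝ} (ht : 0 < t) :
    c + t • diag ke kx ∈ openQuadrant ke kx := by
  intro j
  have := hc j
  simp only [diag, Prod.snd_add, Prod.fst_add, Prod.smul_snd, Prod.smul_fst, Pi.add_apply,
    Pi.smul_apply, smul_eq_mul]
  linarith

theorem mem_closure_openQuadrant_inter {c : Base ke kx} {O : Set (Base ke kx)} (hO : IsOpen O)
    (hc : c ∈ quadrant ke kx) (hcO : c ∈ O) : c ∈ closure (openQuadrant ke kx ∩ O) := by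
  have h1 := tendsto_add_smul c (diag ke kx)
  refine mem_closure_of_tendsto h1 ?_
  filter_upwards [h1 (hO.mem_nhds hcO), self_mem_nhdsWithin] with t h2 h3
  exact ⟨add_smul_diag_mem hc h3, h2⟩

namespace IsRelOpen

variable {T : Set (Base ke kx)}

theorem subset (hT : IsRelOpen T) : T ⊆ quadrant ke kx := by
  obtain ⟨O, _, rfl⟩ := hT; exact inter_subset_left

theorem uniqueDiffOn (hT : IsRelOpen T) : UniqueDiffOn ℝ T := by
  obtain ⟨O, hO, rfl⟩ := hT
  refine (uniqueDiffOn_convex convex_quadrant ?_).inter hO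
  refine ⟨diag ke kx, mem_interior.2 ⟨_, openQuadrant_subset, isOpen_openQuadrant, ?_⟩⟩
  intro j
  simp [diag]

theorem exists_ball (hT : IsRelOpen T) {c : Base ke kx} (hc : c ∈ T) :
    ∃ ρ > 0, quadrant ke kx ∩ Metric.ball c ρ ⊆ T := by
  obtain ⟨O, hO, rfl⟩ := hT
  obtain ⟨ρ, hρ, h⟩ := Metric.isOpen_iff.1 hO c hc.2
  exact ⟨ρ, hρ, fun x hx => ⟨hx.1, h hx.2⟩⟩

theorem convex_inter_ball (hT : IsRelOpen T) {c : Base ke kx} {ρ : ℝ}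
    (h : quadrant ke kx ∩ Metric.ball c ρ ⊆ T) : Convex ℝ (T ∩ Metric.ball c ρ) := by
  have : T ∩ Metric.ball c ρ = quadrant ke kx ∩ Metric.ball c ρ :=
    Subset.antisymm (inter_subset_inter_left _ hT.subset) fun x hx => ⟨h hx, hx.2⟩
  rw [this]
  exact convex_quadrant.inter (convex_ball _ _)

theorem isCornerAt (hT : IsRelOpen T) {c : Base ke kx} (hc : c ∈ T) : IsCornerAt T c := by
  obtain ⟨ρ, hρ, h⟩ := hT.exists_ball hc
  refine ⟨ρ / 4, by positivity, diag ke kx, norm_diag_le, hT.convex_inter_ball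
    ((inter_subset_inter_right _ (Metric.ball_subset_ball (by linarith))).trans h), ?_⟩
  rintro x ⟨hx, hxb⟩ v hv t ⟨ht0, ht⟩
  refine h ⟨fun j => ?_, ?_⟩
  · have h1 := hT.subset hx j
    have h2 := neg_le_of_abs_le ((abs_coord_le v j).trans hv)
    simp only [diag, Prod.snd_add, Prod.fst_add, Prod.smul_snd, Prod.smul_fst, Pi.add_apply,
      Pi.smul_apply, smul_eq_mul]
    have : 0 ≤ t * (v.2.2.1 j + 1) := mul_nonneg ht0 (by linarith)
    linarith
  · rw [mem_ball_iff_norm] at hxb ⊢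
    have h3 : ‖t • (v + diag ke kx)‖ ≤ ρ / 4 * 2 := by
      rw [norm_smul, Real.norm_eq_abs, abs_of_nonneg ht0]
      have : ‖v + diag ke kx‖ ≤ 2 := (norm_add_le _ _).trans (by
        linarith [norm_diag_le (ke := ke) (kx := kx)])
      gcongr
    calc ‖x + t • (v + diag ke kx) - c‖ = ‖(x - c) + t • (v + diag ke kx)‖ := by congr 1; abel
      _ ≤ _ := norm_add_le _ _
      _ < ρ := by linarith

theorem mem_closure (hT : IsRelOpen T) {c : Base ke kx} (hc : c ∈ T) :
    c ∈ closure (openQuadrant ke kx ∩ T) := by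
  obtain ⟨O, hO, rfl⟩ := hT
  have := mem_closure_openQuadrant_inter hO hc.1 hc.2
  refine closure_mono ?_ this
  exact fun x hx => ⟨hx.1, openQuadrant_subset hx.1, hx.2⟩

end IsRelOpen

/-- The folding map `(w, x, I) ↦ (w, x² / 2, I)` onto the quadrant. -/
def fold (c : Base ke kx) : Base ke kx := (c.1, c.2.1, fun j => c.2.2.1 j ^ 2 / 2, c.2.2.2)

/-- A section of the folding map, `ε` giving the signs of the square roots. -/
def unfold (ε : Fin ke → ℝ) (c : Base ke kx) : Base ke kx :=
  (c.1, c.2.1, fun j => ε j * √(2 * c.2.2.1 j), c.2.2.2)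

theorem contDiff_fold : ContDiff ℝ ∞ (fold (ke := ke) (kx := kx)) := by
  unfold fold; fun_prop

theorem continuous_unfold (ε : Fin ke → ℝ) : Continuous (unfold (kx := kx) ε) := by
  unfold SemiToric.unfold; fun_prop

theorem fold_unfold {ε : Fin ke → ℝ} (hε : ∀ j, ε j ^ 2 = 1) {c : Base ke kx}
    (hc : c ∈ quadrant ke kx) : fold (unfold ε c) = c := by
  refine Prod.ext rfl (Prod.ext rfl (Prod.ext (funext fun j => ?_) rfl))
  have := hc j
  simp only [fold, unfold]
  rw [mul_pow, hε, Real.sq_sqrt (by linarith)]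
  ring

theorem fold_mem (x : Base ke kx) : fold x ∈ quadrant ke kx := fun j => by
  simp only [fold]; positivity

theorem exists_unfold_fold (x : Base ke kx) :
    ∃ ε : Fin ke → ℝ, (∀ j, ε j ^ 2 = 1) ∧ unfold ε (fold x) = x := by
  refine ⟨fun j => if x.2.2.1 j < 0 then -1 else 1,
    fun j => by dsimp only; split_ifs <;> norm_num, ?_⟩
  refine Prod.ext rfl (Prod.ext rfl (Prod.ext (funext fun j => ?_) rfl))
  simp only [fold, unfold]
  rw [mul_div_cancel₀ _ (two_ne_zero), Real.sqrt_sq_eq_abs]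
  split_ifs with h
  · rw [abs_of_neg h]; ring
  · rw [abs_of_nonneg (not_lt.1 h)]; ring

/-- The `j`-th elliptic basis vector of the base. -/
def ellVec (kx : ℕ) (j : Fin ke) : Base ke kx := (0, 0, Pi.single j 1, 0)

/-- The `j`-th elliptic coordinate on the base. -/
def ellCoord (kx : ℕ) (j : Fin ke) : Base ke kx →L[ℝ] ℝ :=
  (ContinuousLinearMap.proj j).comp ((ContinuousLinearMap.fst ℝ _ _).comp
    ((ContinuousLinearMap.snd ℝ _ _).comp (ContinuousLinearMap.snd ℝ _ _)))

@[simp] theorem ellCoord_apply (j : Fin ke) (c : Base ke kx) : ellCoord kx j c = c.2.2.1 j := rfl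

/-- The projection killing the elliptic coordinates. -/
def killEll (ke kx : ℕ) : Base ke kx →L[ℝ] Base ke kx :=
  ContinuousLinearMap.id ℝ _ - ∑ j, (ellCoord kx j).smulRight (ellVec kx j)

section Whitney

variable {E : Type} [NormedAddCommGroup E] [NormedSpace ℝ E]
  {T : Set (Base ke kx)} {g : Base ke kx → E}

theorem isOpen_fold_preimage (hT : IsRelOpen T) : IsOpen (fold ⁻¹' T) := by
  obtain ⟨O, hO, rfl⟩ := hT
  have : fold ⁻¹' (quadrant ke kx ∩ O) = fold ⁻¹' O := by
    ext x; exact ⟨fun h => h.2, fun h => ⟨fold_mem x, h⟩⟩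
  rw [this]
  exact hO.preimage contDiff_fold.continuous

theorem continuousOn_of_comp_fold {E : Type*} [TopologicalSpace E] {g : Base ke kx → E}
    (hT : IsRelOpen T) (hg : ContinuousOn (g ∘ fold) (fold ⁻¹' T)) :
    ContinuousOn g T := by
  have h1 : ∀ c ∈ T, fold (unfold (fun _ => 1) c) = c := fun c hc =>
    fold_unfold (by simp) (hT.subset hc)
  have : ContinuousOn ((g ∘ fold) ∘ unfold (fun _ => 1)) T :=
    hg.comp (continuous_unfold _).continuousOn fun c hc => by
      rw [mem_preimage, h1 c hc]; exact hc
  refine this.congr fun c hc => ?_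
  simp only [Function.comp, h1 c hc]

/-- As `g ∘ fold` is even in each elliptic variable, its partial derivatives vanish where these
variables do. -/
theorem fderiv_comp_fold_ellVec {x : Base ke kx} (hd : DifferentiableAt ℝ (g ∘ fold) x) {j : Fin ke}
    (hx : x.2.2.1 j = 0) : fderiv ℝ (g ∘ fold) x (ellVec kx j) = 0 := by
  have h2 : HasDerivAt (fun s : ℝ => (g ∘ fold) (x + s • ellVec kx j))
      (fderiv ℝ (g ∘ fold) x (ellVec kx j)) 0 := hd.hasFDerivAt.hasLineDerivAt _
  have h3 := HasDerivAt.scomp (0 : ℝ) (g₁ := fun s : ℝ => (g ∘ fold) (x + s • ellVec kx j))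
    (by simpa using h2) (hasDerivAt_neg (0 : ℝ))
  have h4 : (fun s : ℝ => (g ∘ fold) (x + s • ellVec kx j)) ∘ Neg.neg
      = fun s : ℝ => (g ∘ fold) (x + s • ellVec kx j) := by
    funext s
    simp only [Function.comp]
    congr 1
    refine Prod.ext (by simp [fold, ellVec]) (Prod.ext (by simp [fold, ellVec])
      (Prod.ext (funext fun i => ?_) (by simp [fold, ellVec])))
    rcases eq_or_ne i j with rfl | hij
    · simp [fold, ellVec, hx]
    · simp [fold, ellVec, hij]
  rw [h4] at h3
  have h5 := h2.unique h3
  rw [neg_one_smul] at h5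
  rw [eq_neg_iff_add_eq_zero, ← two_smul ℝ, smul_eq_zero] at h5
  exact h5.resolve_left two_ne_zero

/-- The quotient of the `j`-th elliptic derivative of `g ∘ fold` by the `j`-th elliptic variable,
extended by its limit to the hyperplane where this variable vanishes. -/
def ellQuot (g : Base ke kx → E) (j : Fin ke) (x : Base ke kx) : E :=
  if x.2.2.1 j = 0 then
    fderiv ℝ (fun y => fderiv ℝ (g ∘ fold) y (ellVec kx j)) x (ellVec kx j)
  else (x.2.2.1 j)⁻¹ • fderiv ℝ (g ∘ fold) x (ellVec kx j)

theorem contDiffOn_ellQuot [CompleteSpace E] (hT : IsRelOpen T)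
    (hg : ContDiffOn ℝ ∞ (g ∘ fold) (fold ⁻¹' T)) (j : Fin ke) :
    ContDiffOn ℝ ∞ (ellQuot g j) (fold ⁻¹' T) := by
  have hO := isOpen_fold_preimage hT
  have hf : ContDiffOn ℝ ∞ (fun y => fderiv ℝ (g ∘ fold) y (ellVec kx j)) (fold ⁻¹' T) :=
    (hg.fderiv_of_isOpen hO (by simp)).clm_apply contDiffOn_const
  intro x hx
  apply ContDiffAt.contDiffWithinAt
  by_cases hxj : x.2.2.1 j = 0
  · obtain ⟨h, hh, heq⟩ := exists_contDiff_eventuallyEq_smul hO hx hf (ellCoord kx j) (ellVec kx j)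
      (by simp [ellVec]) (fun y hy hyj => fderiv_comp_fold_ellVec
        ((hg.contDiffAt (hO.mem_nhds hy)).differentiableAt (by simp)) hyj)
    refine hh.contDiffAt.congr_of_eventuallyEq ?_
    filter_upwards [heq.eventually_nhds] with y hy
    simp only [ellQuot]
    split_ifs with hyj
    · have h1 : (fun y => fderiv ℝ (g ∘ fold) y (ellVec kx j)) =ᶠ[𝓝 y]
          fun y => ellCoord kx j y • h y := hy
      rw [h1.fderiv_eq]
      have h2 := ((ellCoord kx j).hasFDerivAt (x := y)).fun_smul
        ((hh.differentiable (by simp)) y).hasFDerivAt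
      rw [h2.fderiv]
      simp [hyj, ellVec]
    · rw [hy.self_of_nhds, smul_smul, ellCoord_apply, inv_mul_cancel₀ hyj, one_smul]
  · have hc : ContDiffAt ℝ ∞ (fun y : Base ke kx => (y.2.2.1 j)⁻¹ •
        fderiv ℝ (g ∘ fold) y (ellVec kx j)) x := by
      refine ContDiffAt.smul ?_ (hf.contDiffAt (hO.mem_nhds hx))
      exact ((ellCoord kx j).contDiff.contDiffAt).inv hxj
    refine hc.congr_of_eventuallyEq ?_
    have hne : ∀ᶠ y : Base ke kx in 𝓝 x, y.2.2.1 j ≠ 0 :=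
      (ellCoord kx j).continuous.continuousAt.eventually_ne hxj
    filter_upwards [hne] with y hy
    simp [ellQuot, hy]

/-- The derivative of `g` at `fold x`, in terms of the derivative of `g ∘ fold` at `x`: the chain
rule for `g ∘ fold` is solved for the derivative of `g`. -/
def foldDeriv (g : Base ke kx → E) (x : Base ke kx) : Base ke kx →L[ℝ] E :=
  (fderiv ℝ (g ∘ fold) x).comp (killEll ke kx)
    + ∑ j, ContinuousLinearMap.smulRightL ℝ (Base ke kx) E (ellCoord kx j) (ellQuot g j x)

theorem contDiffOn_foldDeriv [CompleteSpace E] (hT : IsRelOpen T)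
    (hg : ContDiffOn ℝ ∞ (g ∘ fold) (fold ⁻¹' T)) :
    ContDiffOn ℝ ∞ (foldDeriv g) (fold ⁻¹' T) := by
  refine ContDiffOn.add ?_ (ContDiffOn.sum fun j _ => ?_)
  · exact (hg.fderiv_of_isOpen (isOpen_fold_preimage hT) (by simp)).clm_comp contDiffOn_const
  · exact (ContinuousLinearMap.contDiff _).comp_contDiffOn (contDiffOn_ellQuot hT hg j)

theorem sum_ellCoord_smul (v : Base ke kx) :
    ∑ j, v.2.2.1 j • ellVec kx j = (0, 0, v.2.2.1, 0) := by
  refine Prod.ext (by simp [Prod.fst_sum, ellVec]) (Prod.ext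
    (by simp [Prod.fst_sum, Prod.snd_sum, ellVec])
    (Prod.ext (funext fun i => ?_) (by simp [Prod.snd_sum, ellVec])))
  simp [Prod.fst_sum, Prod.snd_sum, ellVec, Finset.sum_apply, Pi.single_apply]

theorem killEll_apply (v : Base ke kx) : killEll ke kx v = (v.1, v.2.1, 0, v.2.2.2) := by
  have : killEll ke kx v = v - ∑ j, v.2.2.1 j • ellVec kx j := by
    simp [killEll]
  rw [this, sum_ellCoord_smul]
  refine Prod.ext ?_ (Prod.ext ?_ (Prod.ext ?_ ?_)) <;> simp

theorem hasFDerivAt_fold (x : Base ke kx) : ∃ L : Base ke kx →L[ℝ] Base ke kx,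
    HasFDerivAt fold L x ∧ ∀ v, L v = (v.1, v.2.1, fun j => x.2.2.1 j * v.2.2.1 j, v.2.2.2) := by
  have h : HasFDerivAt fold (fderiv ℝ fold x) x :=
    (contDiff_fold.differentiable (by simp) x).hasFDerivAt
  refine ⟨_, h, fun v => ?_⟩
  have h2 : HasDerivAt (fun s : ℝ => fold (x + s • v)) (fderiv ℝ fold x v) 0 :=
    h.hasLineDerivAt v
  refine h2.unique ?_
  have l1 : ∀ a b : ℝ, HasDerivAt (fun s : ℝ => a + s * b) b 0 := fun a b => by
    simpa using ((hasDerivAt_id (0 : ℝ)).mul_const b).const_add a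
  refine (l1 _ _).prodMk ((l1 _ _).prodMk (HasDerivAt.prodMk ?_ ?_))
  · refine hasDerivAt_pi.2 fun j => ?_
    have := ((l1 (x.2.2.1 j) (v.2.2.1 j)).pow 2).div_const 2
    refine HasDerivAt.congr_deriv (f := fun s : ℝ => (x.2.2.1 j + s * v.2.2.1 j) ^ 2 / 2) this ?_
    norm_num
    ring
  · exact hasDerivAt_pi.2 fun j => l1 _ _

theorem foldDeriv_apply {x : Base ke kx} (hd : DifferentiableAt ℝ (g ∘ fold) x) (v : Base ke kx) :
    foldDeriv g x (v.1, v.2.1, fun j => x.2.2.1 j * v.2.2.1 j, v.2.2.2)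
      = fderiv ℝ (g ∘ fold) x v := by
  have h1 : ∀ j, (x.2.2.1 j * v.2.2.1 j) • ellQuot g j x
      = v.2.2.1 j • fderiv ℝ (g ∘ fold) x (ellVec kx j) := by
    intro j
    by_cases hxj : x.2.2.1 j = 0
    · simp [hxj, fderiv_comp_fold_ellVec hd hxj]
    · simp only [ellQuot, hxj, if_false]
      rw [smul_smul, mul_right_comm, mul_inv_cancel₀ hxj, one_mul]
  simp only [foldDeriv, add_apply, ContinuousLinearMap.comp_apply,
    killEll_apply, sum_apply, ContinuousLinearMap.smulRightL_apply_apply,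
    ContinuousLinearMap.smulRight_apply, ellCoord_apply, h1]
  simp only [← map_smul]
  rw [← map_sum, sum_ellCoord_smul, ← map_add]
  congr 1
  refine Prod.ext ?_ (Prod.ext ?_ (Prod.ext ?_ ?_)) <;> simp

theorem eventually_fold_unfold {ε : Fin ke → ℝ} (hε : ∀ j, ε j ^ 2 = 1) {c : Base ke kx}
    (hc : c ∈ openQuadrant ke kx) : ∀ᶠ y in 𝓝 c, fold (unfold ε y) = y := by
  filter_upwards [isOpen_openQuadrant.mem_nhds hc] with y hy
  exact fold_unfold hε (openQuadrant_subset hy)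

theorem differentiableAt_unfold (ε : Fin ke → ℝ) {c : Base ke kx} (hc : c ∈ openQuadrant ke kx) :
    DifferentiableAt ℝ (unfold ε) c := by
  have h1 : ∀ j, DifferentiableAt ℝ (fun y : Base ke kx => ε j * √(2 * y.2.2.1 j)) c := by
    intro j
    have h2 : DifferentiableAt ℝ (fun y : Base ke kx => 2 * y.2.2.1 j) c :=
      ((ellCoord kx j).differentiableAt).const_mul 2
    exact (h2.sqrt (by have := hc j; positivity)).const_mul _
  exact differentiableAt_fst.prodMk (differentiableAt_snd.fst.prodMk
    ((differentiableAt_pi.2 h1).prodMk differentiableAt_snd.snd.snd))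

/-- In the interior, `g` is differentiable, as `fold` has local sections there. -/
theorem hasFDerivAt_of_comp_fold (hT : IsRelOpen T) (hg : ContDiffOn ℝ ∞ (g ∘ fold) (fold ⁻¹' T))
    {ε : Fin ke → ℝ} (hε : ∀ j, ε j ^ 2 = 1) {c : Base ke kx} (hc : c ∈ T)
    (hc' : c ∈ openQuadrant ke kx) : HasFDerivAt g (foldDeriv g (unfold ε c)) c := by
  set y := unfold ε c with hy
  have hfy : fold y = c := fold_unfold hε (openQuadrant_subset hc')
  have hyT : y ∈ fold ⁻¹' T := by rw [mem_preimage, hfy]; exact hc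
  have hd : DifferentiableAt ℝ (g ∘ fold) y :=
    (hg.contDiffAt ((isOpen_fold_preimage hT).mem_nhds hyT)).differentiableAt (by simp)
  have hS := (differentiableAt_unfold ε hc').hasFDerivAt
  have h1 : HasFDerivAt g ((fderiv ℝ (g ∘ fold) y).comp (fderiv ℝ (unfold ε) c)) c := by
    refine (hd.hasFDerivAt.comp c hS).congr_of_eventuallyEq ?_
    filter_upwards [eventually_fold_unfold hε hc'] with z hz
    simp only [Function.comp, hz]
  obtain ⟨L, hL, hLv⟩ := hasFDerivAt_fold y
  have h2 : L.comp (fderiv ℝ (unfold ε) c) = ContinuousLinearMap.id ℝ _ := by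
    refine (hL.comp c hS).unique ((hasFDerivAt_id c).congr_of_eventuallyEq ?_)
    filter_upwards [eventually_fold_unfold hε hc'] with z hz
    simp only [Function.comp, hz, id]
  convert h1 using 1
  refine ContinuousLinearMap.ext fun v => ?_
  have h3 : L (fderiv ℝ (unfold ε) c v) = v := by
    have := congrArg (fun A => A v) h2
    simpa using this
  conv_lhs => rw [← h3, hLv, foldDeriv_apply hd]
  rfl

/-- Up to the boundary, `g` is differentiable because its derivative in the interior has a limit. -/
theorem hasFDerivWithinAt_of_comp_fold [CompleteSpace E] (hT : IsRelOpen T)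
    (hg : ContDiffOn ℝ ∞ (g ∘ fold) (fold ⁻¹' T)) {x : Base ke kx} (hx : fold x ∈ T) :
    HasFDerivWithinAt g (foldDeriv g x) T (fold x) := by
  obtain ⟨ε, hε, hεx⟩ := exists_unfold_fold x
  obtain ⟨ρ, hρ, hsub⟩ := hT.exists_ball hx
  let s := openQuadrant ke kx ∩ Metric.ball (fold x) (ρ / 2)
  have hcl : closure s ⊆ T := by
    intro c hc
    refine hsub ⟨?_, ?_⟩
    · exact closure_minimal (inter_subset_left.trans openQuadrant_subset) isClosed_quadrant hc
    · have := closure_minimal (inter_subset_right.trans Metric.ball_subset_closedBall)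
        Metric.isClosed_closedBall hc
      exact Metric.closedBall_subset_ball (by linarith) this
  have hd : ∀ c ∈ s, HasFDerivAt g (foldDeriv g (unfold ε c)) c := fun c hc =>
    hasFDerivAt_of_comp_fold hT hg hε (hcl (subset_closure hc)) hc.1
  have key : HasFDerivWithinAt g (foldDeriv g x) (closure s) (fold x) := by
    refine hasFDerivWithinAt_closure_of_tendsto_fderiv
      (fun c hc => (hd c hc).differentiableAt.differentiableWithinAt)
      (convex_openQuadrant.inter (convex_ball _ _))
      (isOpen_openQuadrant.inter Metric.isOpen_ball)
      (fun c hc => (continuousOn_of_comp_fold hT hg.continuousOn c (hcl hc)).mono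
        (subset_closure.trans hcl)) ?_
    have h1 : Tendsto (fun c => foldDeriv g (unfold ε c)) (𝓝 (fold x)) (𝓝 (foldDeriv g x)) := by
      have h2 : ContinuousAt (foldDeriv g) (unfold ε (fold x)) := by
        rw [hεx]
        exact ((contDiffOn_foldDeriv hT hg).continuousOn).continuousAt
          ((isOpen_fold_preimage hT).mem_nhds hx)
      have h3 := h2.tendsto.comp ((continuous_unfold ε).tendsto (fold x))
      rwa [hεx] at h3
    refine (h1.mono_left nhdsWithin_le_nhds).congr' ?_
    filter_upwards [self_mem_nhdsWithin] with c hc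
    exact (hd c hc).fderiv.symm
  refine key.mono_of_mem_nhdsWithin ?_
  refine mem_nhdsWithin.2 ⟨Metric.ball (fold x) (ρ / 2), Metric.isOpen_ball,
    Metric.mem_ball_self (by positivity), fun c hc => ?_⟩
  exact mem_closure_openQuadrant_inter Metric.isOpen_ball (hT.subset hc.2) hc.1

/-- **Whitney's theorem on even functions**, in several variables and with parameters: a function
`g` on a relatively open subset of the quadrant is smooth up to the boundary as soon as
`g (w, x² / 2, I)` is smooth. By induction on the order of differentiability: the derivative of `g`
satisfies the same hypothesis. -/
theorem contDiffOn_of_comp_fold [CompleteSpace E] (hT : IsRelOpen T)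
    (hg : ContDiffOn ℝ ∞ (g ∘ fold) (fold ⁻¹' T)) : ContDiffOn ℝ ∞ g T := by
  rw [contDiffOn_infty]
  intro n
  induction n generalizing E with
  | zero => exact contDiffOn_zero.2 (continuousOn_of_comp_fold hT hg.continuousOn)
  | succ n ih =>
    have hd : ∀ x ∈ fold ⁻¹' T, fderivWithin ℝ g T (fold x) = foldDeriv g x := fun x hx =>
      (hasFDerivWithinAt_of_comp_fold hT hg hx).fderivWithin (hT.uniqueDiffOn _ hx)
    have hdiff : DifferentiableOn ℝ g T := by
      intro c hc
      have h1 : fold (unfold (fun _ => 1) c) = c := fold_unfold (by simp) (hT.subset hc)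
      have := hasFDerivWithinAt_of_comp_fold hT hg (x := unfold (fun _ => 1) c) (by rwa [h1])
      rw [h1] at this
      exact this.differentiableWithinAt
    have := ih (g := fderivWithin ℝ g T) ((contDiffOn_foldDeriv hT hg).congr hd)
    exact_mod_cast contDiffOn_succ_of_fderivWithin hdiff (by simp) this

end Whitney

/-! ### The fibres of the momentum map and its local sections -/

theorem re_sq_add_im_sq (z : ℂ) : z.re ^ 2 + z.im ^ 2 = ‖z‖ ^ 2 := by
  rw [Complex.sq_norm, Complex.normSq_apply]
  ring

/-- The focus-focus component `q₁ + i q₂` of a point of the base. -/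
def focus (c : Base ke kx) : ℂ := ⟨c.1, c.2.1⟩

theorem focus_Q (p : Model ke kx) : focus (Q p) = starRingEnd ℂ p.1.1 * p.1.2 := by
  apply Complex.ext <;> simp [focus, Q]
  ring

theorem contDiff_focus : ContDiff ℝ ∞ (focus (ke := ke) (kx := kx)) := by
  have : (focus : Base ke kx → ℂ) = fun c => (c.1 : ℂ) + (c.2.1 : ℂ) * Complex.I := by
    funext c
    apply Complex.ext <;> simp [focus]
  rw [this]
  have h := Complex.ofRealCLM.contDiff (n := ∞)
  exact (h.comp contDiff_fst).add ((h.comp (contDiff_fst.comp contDiff_snd)).mul contDiff_const)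

theorem Q_eq_iff {p : Model ke kx} {c : Base ke kx} : Q p = c ↔
    starRingEnd ℂ p.1.1 * p.1.2 = focus c ∧
      (∀ j, ((p.2.1 j).re ^ 2 + (p.2.1 j).im ^ 2) / 2 = c.2.2.1 j) ∧ p.2.2.2 = c.2.2.2 := by
  rw [← focus_Q]
  constructor
  · rintro rfl; exact ⟨rfl, fun _ => rfl, rfl⟩
  · rintro ⟨h1, h2, h3⟩
    exact Prod.ext (congrArg Complex.re h1) (Prod.ext (congrArg Complex.im h1)
      (Prod.ext (funext h2) h3))

/-- The fibres of the focus-focus block are connected: the singular one is a union of two planes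
meeting at the origin, the other ones are graphs over a punctured plane. -/
theorem isPreconnected_focus_fibre (w : ℂ) :
    IsPreconnected {z : ℂ × ℂ | starRingEnd ℂ z.1 * z.2 = w} := by
  rcases eq_or_ne w 0 with rfl | hw
  · have : {z : ℂ × ℂ | starRingEnd ℂ z.1 * z.2 = 0}
        = (range fun z : ℂ => (z, (0 : ℂ))) ∪ range fun z : ℂ => ((0 : ℂ), z) := by
      ext ⟨a, b⟩
      simp only [mem_ofPred_eq, mul_eq_zero, map_eq_zero, mem_union, mem_range, Prod.mk.injEq]
      constructor
      · rintro (rfl | rfl)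
        · exact Or.inr ⟨b, rfl, rfl⟩
        · exact Or.inl ⟨a, rfl, rfl⟩
      · rintro (⟨z, rfl, rfl⟩ | ⟨z, rfl, rfl⟩) <;> simp
    rw [this]
    refine IsPreconnected.union (0, 0) ⟨0, rfl⟩ ⟨0, rfl⟩ ?_ ?_
    · exact isPreconnected_range (by fun_prop)
    · exact isPreconnected_range (by fun_prop)
  · have hconn : IsConnected ({0}ᶜ : Set ℂ) :=
      isConnected_compl_singleton_of_one_lt_rank (by rw [Complex.rank_real_complex]; norm_num) 0
    have : {z : ℂ × ℂ | starRingEnd ℂ z.1 * z.2 = w}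
        = (fun z : ℂ => (z, w / starRingEnd ℂ z)) '' {0}ᶜ := by
      ext ⟨a, b⟩
      simp only [mem_ofPred_eq, mem_image, mem_compl_iff, mem_singleton_iff, Prod.mk.injEq]
      constructor
      · intro h
        have ha : a ≠ 0 := by rintro rfl; simp at h; exact hw h.symm
        refine ⟨a, ha, rfl, ?_⟩
        rw [← h, mul_div_cancel_left₀]
        simpa using ha
      · rintro ⟨z, hz, rfl, rfl⟩
        rw [mul_div_cancel₀]
        simpa using hz
    rw [this]
    refine hconn.isPreconnected.image _ (continuousOn_id.prodMk ?_)
    exact continuousOn_const.div Complex.continuous_conj.continuousOn (by simp)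

theorem isPreconnected_circle (q : ℝ) : IsPreconnected {z : ℂ | (z.re ^ 2 + z.im ^ 2) / 2 = q} := by
  have : {z : ℂ | (z.re ^ 2 + z.im ^ 2) / 2 = q} ⊆
      range (fun t : ℝ => (√(2 * q) : ℂ) * Complex.exp (t * Complex.I)) := by
    intro z hz
    refine ⟨z.arg, ?_⟩
    have h1 : √(2 * q) = ‖z‖ := by
      rw [← (hz : _ = q), mul_div_cancel₀ _ two_ne_zero, Complex.norm_eq_sqrt_sq_add_sq]
    rw [h1]
    exact Complex.norm_mul_exp_arg_mul_I z
  by_cases hq : 0 ≤ q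
  · have h2 : {z : ℂ | (z.re ^ 2 + z.im ^ 2) / 2 = q} =
        range (fun t : ℝ => (√(2 * q) : ℂ) * Complex.exp (t * Complex.I)) := by
      refine this.antisymm ?_
      rintro _ ⟨t, rfl⟩
      simp only [mem_ofPred_eq]
      rw [re_sq_add_im_sq, norm_mul, Complex.norm_exp_ofReal_mul_I, mul_one, Complex.norm_real,
        Real.norm_eq_abs, sq_abs, Real.sq_sqrt (by positivity)]
      ring
    rw [h2]
    exact isPreconnected_range (by fun_prop)
  · have h2 : {z : ℂ | (z.re ^ 2 + z.im ^ 2) / 2 = q} = ∅ := by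
      ext z
      simp only [mem_ofPred_eq, mem_empty_iff_false, iff_false]
      rintro rfl
      exact hq (by positivity)
    rw [h2]
    exact isPreconnected_empty

theorem isPreconnected_fibre (c : Base ke kx) :
    IsPreconnected (Q ⁻¹' {c} : Set (Model ke kx)) := by
  have : (Q ⁻¹' {c} : Set (Model ke kx)) = {z : ℂ × ℂ | starRingEnd ℂ z.1 * z.2 = focus c} ×ˢ
      ((univ.pi fun j => {z : ℂ | (z.re ^ 2 + z.im ^ 2) / 2 = c.2.2.1 j}) ×ˢ
        ((univ.pi fun _ : Fin kx => (univ : Set (AddCircle (2 * Real.pi)))) ×ˢ {c.2.2.2})) := by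
    ext p
    rw [mem_preimage, mem_singleton_iff, Q_eq_iff]
    simp [mem_prod]
  rw [this]
  exact (isPreconnected_focus_fibre _).prod ((isPreconnected_univ_pi fun _ =>
    isPreconnected_circle _).prod ((isPreconnected_univ_pi fun _ => isPreconnected_univ).prod
      isPreconnected_singleton))

/-- The fibres of `Q` being connected, they are the leaves of the foliation. -/
theorem leaf_eq (p : Model ke kx) : leaf p = Q ⁻¹' {Q p} :=
  (isPreconnected_fibre (Q p)).connectedComponentIn rfl

theorem continuous_proj : Continuous (proj : Cover ke kx → Model ke kx) := by
  have : ∀ l, Continuous fun x : Cover ke kx => (x.2.2.1 l : AddCircle (2 * Real.pi)) := fun l =>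
    (AddCircle.continuous_mk' _).comp (by fun_prop)
  unfold proj
  fun_prop

theorem proj_surjective : Function.Surjective (proj : Cover ke kx → Model ke kx) := by
  intro p
  choose θ hθ using fun l => QuotientAddGroup.mk_surjective (p.2.2.1 l)
  exact ⟨(p.1, p.2.1, θ, p.2.2.2), Prod.ext rfl (Prod.ext rfl (Prod.ext (funext hθ) rfl))⟩

theorem contDiff_Q_proj : ContDiff ℝ ∞ (fun x : Cover ke kx => Q (proj x)) := by
  have hre : ContDiff ℝ ∞ Complex.re := Complex.reCLM.contDiff
  have him : ContDiff ℝ ∞ Complex.im := Complex.imCLM.contDiff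
  have h1 : ContDiff ℝ ∞ fun x : Cover ke kx => x.1.1 := by fun_prop
  have h2 : ContDiff ℝ ∞ fun x : Cover ke kx => x.1.2 := by fun_prop
  have h3 : ∀ j, ContDiff ℝ ∞ fun x : Cover ke kx => x.2.1 j := fun j => by fun_prop
  simp only [Q, proj]
  refine ContDiff.prodMk ?_ (ContDiff.prodMk ?_ (ContDiff.prodMk ?_ (by fun_prop)))
  · exact ((hre.comp h1).mul (hre.comp h2)).add ((him.comp h1).mul (him.comp h2))
  · exact ((hre.comp h1).mul (him.comp h2)).sub ((him.comp h1).mul (hre.comp h2))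
  · exact contDiff_pi.2 fun j =>
      (((hre.comp (h3 j)).pow 2).add ((him.comp (h3 j)).pow 2)).div_const 2

theorem Q_mem (p : Model ke kx) : Q p ∈ quadrant ke kx := fun j => by
  simp only [Q]; positivity

/-- Through every fibre meeting an open set passes a local section of the focus-focus block. At the
focus-focus point itself one first moves to a nearby regular point of its fibre. -/
theorem exists_focus_section {V : Set (Model ke kx)} (hV : IsOpen V) {P : Model ke kx}
    (hP : P ∈ V) : ∃ A : ℂ → ℂ × ℂ, ContDiff ℝ ∞ A ∧
      (∀ w, starRingEnd ℂ (A w).1 * (A w).2 = w) ∧ (A (focus (Q P)), P.2) ∈ V ∧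
      ∀ w, A w ≠ 0 := by
  have hconj : ContDiff ℝ ∞ (starRingEnd ℂ) := Complex.conjCLE.contDiff
  have hleft : ∀ ζ : ℂ, ζ ≠ 0 → ∃ A : ℂ → ℂ × ℂ, ContDiff ℝ ∞ A ∧
      (∀ w, starRingEnd ℂ (A w).1 * (A w).2 = w) ∧ (∀ w, A w = (ζ, w / starRingEnd ℂ ζ)) := by
    intro ζ hζ
    have hζ' : starRingEnd ℂ ζ ≠ 0 := by simpa using hζ
    exact ⟨fun w => (ζ, w / starRingEnd ℂ ζ), contDiff_const.prodMk (contDiff_id.div_const _),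
      fun w => mul_div_cancel₀ _ hζ', fun w => rfl⟩
  rw [focus_Q]
  by_cases h1 : P.1.1 = 0
  · by_cases h2 : P.1.2 = 0
    · have hc : Continuous fun δ : ℝ => (((δ : ℂ), (0 : ℂ)), P.2) := by fun_prop
      have h0 : (((0 : ℝ) : ℂ), (0 : ℂ)) = P.1 := Prod.ext (by simp [h1]) (by simp [h2])
      have hmem : ∀ᶠ δ : ℝ in 𝓝 0, (((δ : ℂ), (0 : ℂ)), P.2) ∈ V := by
        refine hc.continuousAt.eventually_mem (hV.mem_nhds ?_)
        rw [h0]; exact hP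
      have hpos : ∀ᶠ δ : ℝ in 𝓝[>] 0, (((δ : ℂ), (0 : ℂ)), P.2) ∈ V ∧ 0 < δ :=
        (hmem.filter_mono nhdsWithin_le_nhds).and self_mem_nhdsWithin
      obtain ⟨δ, hδ, hδ0⟩ := hpos.exists
      have hδ' : (δ : ℂ) ≠ 0 := by exact_mod_cast hδ0.ne'
      obtain ⟨A, hA, hA1, hA2⟩ := hleft δ hδ'
      refine ⟨A, hA, hA1, ?_, fun w => ?_⟩
      · rw [hA2, h1, map_zero, zero_mul, zero_div]; exact hδ
      · rw [hA2]; exact fun h => hδ' (congrArg Prod.fst h)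
    · refine ⟨fun w => (starRingEnd ℂ (w / P.1.2), P.1.2),
        (hconj.comp (contDiff_id.div_const _)).prodMk contDiff_const, fun w => ?_, ?_, fun w h =>
          h2 (congrArg Prod.snd h)⟩
      · simp only [Complex.conj_conj]
        exact div_mul_cancel₀ _ h2
      · rw [h1]
        simp only [map_zero, zero_mul, zero_div]
        rw [← h1]
        exact hP
  · obtain ⟨A, hA, hA1, hA2⟩ := hleft P.1.1 h1
    refine ⟨A, hA, hA1, ?_, fun w => ?_⟩
    · rw [hA2, mul_div_cancel_left₀ _ (by simpa using h1)]
      exact hP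
    · rw [hA2]; exact fun h => h1 (congrArg Prod.fst h)

/-- Through every fibre meeting an open set passes a smooth local section of `Q` over the folding
map; over the quadrant itself there is none at the boundary. -/
theorem exists_section {V : Set (Model ke kx)} (hV : IsOpen V) {x : Base ke kx}
    (hx : fold x ∈ Q '' V) : ∃ S : Base ke kx → Cover ke kx, ContDiff ℝ ∞ S ∧
      (∀ y, Q (proj (S y)) = fold y) ∧ proj (S x) ∈ V ∧ (S x).1 ≠ 0 := by
  obtain ⟨P, hP, hPx⟩ := hx
  obtain ⟨A, hA, hA1, hA2, hA3⟩ := exists_focus_section hV hP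
  obtain ⟨X, rfl⟩ := proj_surjective P
  obtain ⟨hP1, hP2, hP3⟩ := Q_eq_iff.1 hPx
  have hfocus : focus (fold x) = focus x := rfl
  have he : ∀ j, ∃ e : ℂ, ‖e‖ = 1 ∧ (x.2.2.1 j : ℂ) * e = X.2.1 j := by
    intro j
    have h1 : ‖X.2.1 j‖ ^ 2 = x.2.2.1 j ^ 2 := by
      have h2 : ((X.2.1 j).re ^ 2 + (X.2.1 j).im ^ 2) / 2 = x.2.2.1 j ^ 2 / 2 := hP2 j
      rw [re_sq_add_im_sq] at h2
      linarith
    have h3 : ‖X.2.1 j‖ = |x.2.2.1 j| := by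
      rw [← abs_norm]; exact sq_eq_sq_iff_abs_eq_abs _ _ |>.1 h1
    by_cases h0 : x.2.2.1 j = 0
    · refine ⟨1, by simp, ?_⟩
      rw [h0, abs_zero, norm_eq_zero] at h3
      rw [h3, h0]; simp
    · refine ⟨X.2.1 j / (x.2.2.1 j : ℂ), ?_, mul_div_cancel₀ _ (by exact_mod_cast h0)⟩
      rw [norm_div, h3, Complex.norm_real, Real.norm_eq_abs, div_self (abs_ne_zero.2 h0)]
  choose e he1 he2 using he
  refine ⟨fun y => (A (focus y), fun j => (y.2.2.1 j : ℂ) * e j, X.2.2.1, y.2.2.2), ?_, ?_, ?_,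
    hA3 _⟩
  · refine (hA.comp contDiff_focus).prodMk (ContDiff.prodMk (contDiff_pi.2 fun j => ?_)
      (contDiff_const.prodMk (by fun_prop)))
    exact (Complex.ofRealCLM.contDiff.comp (ellCoord kx j).contDiff).mul contDiff_const
  · intro y
    refine Q_eq_iff.2 ⟨hA1 _, fun j => ?_, rfl⟩
    simp only [proj]
    rw [re_sq_add_im_sq, norm_mul, he1, mul_one, Complex.norm_real, Real.norm_eq_abs, sq_abs]
    rfl
  · convert hA2 using 1
    refine Prod.ext ?_ (Prod.ext (funext fun j => ?_) (Prod.ext rfl ?_))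
    · change A (focus x) = A (focus (Q (proj X)))
      rw [hPx, hfocus]
    · exact he2 j
    · exact hP3.symm

theorem isRelOpen_image_Q {V : Set (Model ke kx)} (hV : IsOpen V) : IsRelOpen (Q '' V) := by
  refine ⟨⋃₀ {N | IsOpen N ∧ quadrant ke kx ∩ N ⊆ Q '' V}, isOpen_sUnion fun N hN => hN.1, ?_⟩
  refine Subset.antisymm ?_ ?_
  · rintro c hc
    have hcq : c ∈ quadrant ke kx := by obtain ⟨P, -, rfl⟩ := hc; exact Q_mem P
    have h1 : fold (unfold (fun _ => 1) c) = c := fold_unfold (by simp) hcq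
    obtain ⟨S, hS, hS1, hS2, -⟩ := exists_section hV (x := unfold (fun _ => 1) c) (by rwa [h1])
    refine ⟨hcq, _, ⟨hV.preimage ((continuous_proj.comp hS.continuous).comp
      (continuous_unfold (fun _ => 1))), ?_⟩, hS2⟩
    rintro y ⟨hyq, hy⟩
    refine ⟨_, hy, ?_⟩
    simp only [Function.comp]
    rw [hS1, fold_unfold (by simp) hyq]
  · rintro c ⟨hcq, N, ⟨_, hN⟩, hcN⟩
    exact hN ⟨hcq, hcN⟩

/-- A smooth function on an open set of the model which is constant on the fibres of `Q` is a smooth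
function of `Q`: composed with a section it is smooth over the folding map, and Whitney's theorem
applies. -/
theorem exists_contDiffOn_comp_Q {E : Type} [NormedAddCommGroup E] [NormedSpace ℝ E]
    [CompleteSpace E] {V : Set (Model ke kx)} (hV : IsOpen V)
    {f : Model ke kx → E} (hf : ContDiffOn ℝ ∞ (fun x => f (proj x)) (proj ⁻¹' V))
    (hfib : ∀ p ∈ V, ∀ p' ∈ V, Q p = Q p' → f p = f p') :
    ∃ g : Base ke kx → E, ContDiffOn ℝ ∞ g (Q '' V) ∧ ∀ p ∈ V, f p = g (Q p) := by
  let s : Base ke kx → Model ke kx := Function.invFunOn Q V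
  have hs : ∀ p ∈ V, f p = f (s (Q p)) := by
    intro p hp
    have h1 : Q p ∈ Q '' V := ⟨p, hp, rfl⟩
    exact hfib p hp _ (Function.invFunOn_mem h1) (Function.invFunOn_eq h1).symm
  refine ⟨fun c => f (s c), contDiffOn_of_comp_fold (isRelOpen_image_Q hV) ?_, hs⟩
  intro x hx
  obtain ⟨S, hS, hS1, hS2, -⟩ := exists_section hV hx
  apply ContDiffAt.contDiffWithinAt
  have hO : IsOpen (proj ⁻¹' V : Set (Cover ke kx)) := hV.preimage continuous_proj
  have h1 : ContDiffAt ℝ ∞ (fun y => f (proj (S y))) x :=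
    ContDiffAt.comp (g := fun x => f (proj x)) x (hf.contDiffAt (hO.mem_nhds hS2)) hS.contDiffAt
  refine h1.congr_of_eventuallyEq ?_
  have h2 : ∀ᶠ y in 𝓝 x, S y ∈ proj ⁻¹' V := hS.continuous.continuousAt.eventually_mem
    (hO.mem_nhds hS2)
  filter_upwards [h2] with y hy
  simp only [Function.comp]
  rw [hs _ hy, hS1]

/-! ### Lifts to the cover -/

/-- A symplectic map can be lifted near every point of the cover, the lifts differing by deck
translations. -/
theorem IsSymplecticAt.exists_lift {f : Model ke kx → Model ke kx} {x : Cover ke kx}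
    (h : IsSymplecticAt f (proj x)) : ∃ (N : Set (Cover ke kx)) (F : Cover ke kx → Cover ke kx),
      IsOpen N ∧ x ∈ N ∧ ContDiffOn ℝ ∞ F N ∧ ∀ y ∈ N, proj (F y) = f (proj y) ∧
        ∀ v w, omega (fderiv ℝ F y v) (fderiv ℝ F y w) = omega v w := by
  obtain ⟨x', N, F, hx', hN, hxN, hF, hFN⟩ := h
  have hproj : ∀ y, proj (y + (x' - x)) = proj y := by
    intro y
    have e1 : x'.1 = x.1 := congrArg (fun p : Model ke kx => p.1) hx'
    have e2 : x'.2.1 = x.2.1 := congrArg (fun p : Model ke kx => p.2.1) hx'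
    have e3 : x'.2.2.2 = x.2.2.2 := congrArg (fun p : Model ke kx => p.2.2.2) hx'
    have e4 : ∀ l, (x'.2.2.1 l : AddCircle (2 * Real.pi)) = x.2.2.1 l := fun l =>
      congrFun (congrArg (fun p : Model ke kx => p.2.2.1) hx') l
    refine Prod.ext ?_ (Prod.ext ?_ (Prod.ext (funext fun l => ?_) ?_))
    · simp [proj, e1]
    · simp [proj, e2]
    · simp [proj, e4]
    · simp [proj, e3]
  refine ⟨(fun y => y + (x' - x)) ⁻¹' N, fun y => F (y + (x' - x)), hN.preimage (by fun_prop), ?_,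
    hF.comp (by fun_prop) (fun y hy => hy), fun y hy => ?_⟩
  · rw [mem_preimage, add_sub_cancel]; exact hxN
  · rw [fderiv_comp_add_right]
    refine ⟨?_, (hFN _ hy).2⟩
    rw [(hFN _ hy).1, hproj]

/-- Read on the cover, the components of a symplectic map which are not angles are smooth. -/
theorem contDiffOn_comp_proj {f : Model ke kx → Model ke kx} {U : Set (Model ke kx)}
    (h : ∀ p ∈ U, IsSymplecticAt f p) {E : Type*} [NormedAddCommGroup E] [NormedSpace ℝ E]
    {g : Model ke kx → E} (hg : ContDiff ℝ ∞ fun x : Cover ke kx => g (proj x)) :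
    ContDiffOn ℝ ∞ (fun x => g (f (proj x))) (proj ⁻¹' U) := by
  intro x hx
  obtain ⟨N, F, hN, hxN, hF, hFN⟩ := (h _ hx).exists_lift
  apply ContDiffAt.contDiffWithinAt
  have h1 : ContDiffAt ℝ ∞ (fun y => g (proj (F y))) x :=
    ContDiffAt.comp (g := fun x => g (proj x)) x hg.contDiffAt (hF.contDiffAt (hN.mem_nhds hxN))
  refine h1.congr_of_eventuallyEq ?_
  filter_upwards [hN.mem_nhds hxN] with y hy
  rw [(hFN y hy).1]

/-! ### Hamiltonian vector fields and flows -/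

/-- The pairing of two vectors of the base, in the standard coordinates. -/
def dot (a : Base ke kx) : Base ke kx →ₗ[ℝ] ℝ where
  toFun b := a.1 * b.1 + a.2.1 * b.2.1 + ∑ j, a.2.2.1 j * b.2.2.1 j + ∑ l, a.2.2.2 l * b.2.2.2 l
  map_add' b c := by
    simp only [Prod.fst_add, Prod.snd_add, Pi.add_apply, mul_add, Finset.sum_add_distrib]
    ring
  map_smul' r b := by
    simp only [Prod.smul_fst, Prod.smul_snd, Pi.smul_apply, smul_eq_mul, RingHom.id_apply,
      mul_add, Finset.mul_sum, mul_left_comm]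

theorem dot_apply (a b : Base ke kx) : dot a b =
    a.1 * b.1 + a.2.1 * b.2.1 + ∑ j, a.2.2.1 j * b.2.2.1 j + ∑ l, a.2.2.2 l * b.2.2.2 l := rfl

/-- The `l`-th transverse basis vector of the base. -/
def trVec (ke : ℕ) (l : Fin kx) : Base ke kx := (0, 0, 0, Pi.single l 1)

theorem sum_trVec_smul (v : Base ke kx) : ∑ l, v.2.2.2 l • trVec ke l = (0, 0, 0, v.2.2.2) := by
  refine Prod.ext (by simp [Prod.fst_sum, trVec]) (Prod.ext
    (by simp [Prod.fst_sum, Prod.snd_sum, trVec])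
    (Prod.ext (by simp [Prod.fst_sum, Prod.snd_sum, trVec]) (funext fun i => ?_)))
  simp [Prod.snd_sum, trVec, Finset.sum_apply, Pi.single_apply]

theorem eq_sum_basis (v : Base ke kx) : v = v.1 • (1, 0, 0, 0) + v.2.1 • (0, 1, 0, 0)
    + ∑ j, v.2.2.1 j • ellVec kx j + ∑ l, v.2.2.2 l • trVec ke l := by
  rw [sum_ellCoord_smul, sum_trVec_smul]
  refine Prod.ext ?_ (Prod.ext ?_ (Prod.ext ?_ ?_)) <;> simp

/-- The transpose of an endomorphism of the base, with respect to `dot`. -/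
def transp (T : Base ke kx →L[ℝ] Base ke kx) (a : Base ke kx) : Base ke kx :=
  (dot a (T (1, 0, 0, 0)), dot a (T (0, 1, 0, 0)), fun j => dot a (T (ellVec kx j)),
    fun l => dot a (T (trVec ke l)))

theorem dot_transp (T : Base ke kx →L[ℝ] Base ke kx) (a v : Base ke kx) :
    dot (transp T a) v = dot a (T v) := by
  conv_rhs => rw [eq_sum_basis v]
  simp only [map_add, map_sum, map_smul, smul_eq_mul]
  rw [dot_apply]
  simp only [transp, mul_comm]

theorem dot_comm (a b : Base ke kx) : dot a b = dot b a := by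
  simp only [dot_apply, mul_comm]

theorem dot_ext {a b : Base ke kx} (h : ∀ v, dot a v = dot b v) : a = b := by
  refine Prod.ext ?_ (Prod.ext ?_ (Prod.ext (funext fun j => ?_) (funext fun l => ?_)))
  · simpa [dot_apply] using h (1, 0, 0, 0)
  · simpa [dot_apply] using h (0, 1, 0, 0)
  · simpa [dot_apply, ellVec, Pi.single_apply] using h (ellVec kx j)
  · simpa [dot_apply, trVec, Pi.single_apply] using h (trVec ke l)

/-- The Hamiltonian vector field of `dot a ∘ Q` on the cover, with the sign convention of
`omega_hamField`. -/
def hamField (a : Base ke kx) (x : Cover ke kx) : Cover ke kx :=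
  ((focus a * x.1.1, -starRingEnd ℂ (focus a) * x.1.2),
    (fun j => -(a.2.2.1 j * Complex.I) * x.2.1 j), (a.2.2.2, 0))

/-- The derivative of `Q` on the cover. -/
theorem fderiv_Q_proj (x v : Cover ke kx) : fderiv ℝ (fun x => Q (proj x)) x v =
    (x.1.1.re * v.1.2.re + v.1.1.re * x.1.2.re + (x.1.1.im * v.1.2.im + v.1.1.im * x.1.2.im),
      x.1.1.re * v.1.2.im + v.1.1.re * x.1.2.im - (x.1.1.im * v.1.2.re + v.1.1.im * x.1.2.re),
      (fun j => (x.2.1 j).re * (v.2.1 j).re + (x.2.1 j).im * (v.2.1 j).im), v.2.2.2) := by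
  have h : HasDerivAt (fun s : ℝ => Q (proj (x + s • v))) (fderiv ℝ (fun x => Q (proj x)) x v) 0 :=
    ((contDiff_Q_proj.differentiable (by simp) x).hasFDerivAt).hasLineDerivAt v
  refine h.unique ?_
  have l1 : ∀ a b : ℝ, HasDerivAt (fun s : ℝ => a + s * b) b 0 := fun a b => by
    simpa using ((hasDerivAt_id (0 : ℝ)).mul_const b).const_add a
  have l2 : ∀ a b c d : ℝ, HasDerivAt (fun s : ℝ => (a + s * b) * (c + s * d)) (a * d + b * c) 0 :=
    fun a b c d => ((l1 a b).mul (l1 c d)).congr_deriv (by ring)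
  have e : (fun s : ℝ => Q (proj (x + s • v))) = fun s : ℝ =>
      ((x.1.1.re + s * v.1.1.re) * (x.1.2.re + s * v.1.2.re)
          + (x.1.1.im + s * v.1.1.im) * (x.1.2.im + s * v.1.2.im),
        (x.1.1.re + s * v.1.1.re) * (x.1.2.im + s * v.1.2.im)
          - (x.1.1.im + s * v.1.1.im) * (x.1.2.re + s * v.1.2.re),
        (fun j => (((x.2.1 j).re + s * (v.2.1 j).re) * ((x.2.1 j).re + s * (v.2.1 j).re)
          + ((x.2.1 j).im + s * (v.2.1 j).im) * ((x.2.1 j).im + s * (v.2.1 j).im)) / 2),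
        fun l => x.2.2.2 l + s * v.2.2.2 l) := by
    funext s
    refine Prod.ext ?_ (Prod.ext ?_ (Prod.ext (funext fun j => ?_) (funext fun l => ?_))) <;>
      simp [Q, proj, sq]
  rw [e]
  refine ((l2 _ _ _ _).add (l2 _ _ _ _)).prodMk (((l2 _ _ _ _).sub (l2 _ _ _ _)).prodMk
    (HasDerivAt.prodMk (hasDerivAt_pi.2 fun j => ?_) (hasDerivAt_pi.2 fun l => l1 _ _)))
  refine (((l2 _ _ _ _).add (l2 _ _ _ _)).div_const 2).congr_deriv ?_
  ring

theorem omega_hamField (a : Base ke kx) (x v : Cover ke kx) :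
    omega (hamField a x) v = dot a (fderiv ℝ (fun x => Q (proj x)) x v) := by
  rw [fderiv_Q_proj, dot_apply]
  simp only [omega, hamField, focus]
  congr 1
  · congr 1
    · simp
      ring
    · refine Finset.sum_congr rfl fun j _ => ?_
      simp
      ring
  · refine Finset.sum_congr rfl fun l _ => ?_
    simp

theorem omega_sub_left (u u' v : Cover ke kx) : omega (u - u') v = omega u v - omega u' v := by
  simp only [omega, Prod.fst_sub, Prod.snd_sub, Complex.sub_re, Complex.sub_im, Pi.sub_apply,
    sub_mul, Finset.sum_sub_distrib]
  ring

theorem eq_zero_of_omega_eq_zero {u : Cover ke kx} (h : ∀ v, omega u v = 0) : u = 0 := by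
  -- test against the image of `u` under a compatible complex structure
  have h1 := h ((⟨-u.1.2.re, -u.1.2.im⟩, u.1.1),
    (fun j => ⟨-(u.2.1 j).im, (u.2.1 j).re⟩), (-u.2.2.2, u.2.2.1))
  have h2 : (u.1.1.re ^ 2 + u.1.2.re ^ 2 + (u.1.1.im ^ 2 + u.1.2.im ^ 2))
      + ∑ j, ((u.2.1 j).re ^ 2 + (u.2.1 j).im ^ 2) + ∑ l, (u.2.2.1 l ^ 2 + u.2.2.2 l ^ 2) = 0 := by
    rw [← h1]
    simp only [omega, Pi.neg_apply]
    refine congrArg₂ _ (congrArg₂ _ (by ring) (Finset.sum_congr rfl fun j _ => by ring))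
      (Finset.sum_congr rfl fun l _ => by ring)
  have p1 : 0 ≤ ∑ j, ((u.2.1 j).re ^ 2 + (u.2.1 j).im ^ 2) :=
    Finset.sum_nonneg fun j _ => by positivity
  have p2 : 0 ≤ ∑ l, (u.2.2.1 l ^ 2 + u.2.2.2 l ^ 2) := Finset.sum_nonneg fun j _ => by positivity
  have q1 : ∑ j, ((u.2.1 j).re ^ 2 + (u.2.1 j).im ^ 2) = 0 := by
    nlinarith [sq_nonneg u.1.1.re, sq_nonneg u.1.2.re, sq_nonneg u.1.1.im, sq_nonneg u.1.2.im]
  have q2 : ∑ l, (u.2.2.1 l ^ 2 + u.2.2.2 l ^ 2) = 0 := by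
    nlinarith [sq_nonneg u.1.1.re, sq_nonneg u.1.2.re, sq_nonneg u.1.1.im, sq_nonneg u.1.2.im]
  have r1 := fun j => (Finset.sum_eq_zero_iff_of_nonneg
    (fun j _ => by positivity)).1 q1 j (Finset.mem_univ j)
  have r2 := fun l => (Finset.sum_eq_zero_iff_of_nonneg
    (fun j _ => by positivity)).1 q2 l (Finset.mem_univ l)
  rw [q1, q2] at h2
  have z : ∀ {s : ℝ}, s ^ 2 ≤ 0 → s = 0 := fun {s} h =>
    (pow_eq_zero_iff two_ne_zero).1 (le_antisymm h (sq_nonneg s))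
  refine Prod.ext (Prod.ext (Complex.ext ?_ ?_) (Complex.ext ?_ ?_))
    (Prod.ext (funext fun j => Complex.ext ?_ ?_) (Prod.ext (funext fun l => ?_)
      (funext fun l => ?_)))
  · exact z (by
      nlinarith [sq_nonneg u.1.1.re, sq_nonneg u.1.2.re, sq_nonneg u.1.1.im, sq_nonneg u.1.2.im])
  · exact z (by
      nlinarith [sq_nonneg u.1.1.re, sq_nonneg u.1.2.re, sq_nonneg u.1.1.im, sq_nonneg u.1.2.im])
  · exact z (by
      nlinarith [sq_nonneg u.1.1.re, sq_nonneg u.1.2.re, sq_nonneg u.1.1.im, sq_nonneg u.1.2.im])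
  · exact z (by
      nlinarith [sq_nonneg u.1.1.re, sq_nonneg u.1.2.re, sq_nonneg u.1.1.im, sq_nonneg u.1.2.im])
  · exact z (by nlinarith [r1 j, sq_nonneg (u.2.1 j).im])
  · exact z (by nlinarith [r1 j, sq_nonneg (u.2.1 j).re])
  · exact z (by nlinarith [r2 l, sq_nonneg (u.2.2.2 l)])
  · exact z (by nlinarith [r2 l, sq_nonneg (u.2.2.1 l)])

theorem injective_of_symplectic {L : Cover ke kx →L[ℝ] Cover ke kx}
    (hL : ∀ v w, omega (L v) (L w) = omega v w) : Function.Injective L := by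
  rw [injective_iff_map_eq_zero]
  intro u hu
  refine eq_zero_of_omega_eq_zero fun v => ?_
  rw [← hL, hu]
  simp [omega]

theorem surjective_of_symplectic {L : Cover ke kx →L[ℝ] Cover ke kx}
    (hL : ∀ v w, omega (L v) (L w) = omega v w) : Function.Surjective L :=
  LinearMap.injective_iff_surjective (f := (L : Cover ke kx →ₗ[ℝ] Cover ke kx)).1
    (injective_of_symplectic hL)

/-- The joint Hamiltonian flow, on the cover. -/
def flowCover (a : Base ke kx) (t : ℝ) (x : Cover ke kx) : Cover ke kx :=
  ((Complex.exp (t * focus a) * x.1.1, Complex.exp (t * -starRingEnd ℂ (focus a)) * x.1.2),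
    (fun j => Complex.exp (t * -(a.2.2.1 j * Complex.I)) * x.2.1 j),
    (fun l => x.2.2.1 l + t * a.2.2.2 l, x.2.2.2))

/-- The Hamiltonian flow of `dot a ∘ Q`. -/
def flow (a : Base ke kx) (t : ℝ) (p : Model ke kx) : Model ke kx :=
  ((Complex.exp (t * focus a) * p.1.1, Complex.exp (t * -starRingEnd ℂ (focus a)) * p.1.2),
    (fun j => Complex.exp (t * -(a.2.2.1 j * Complex.I)) * p.2.1 j),
    (fun l => p.2.2.1 l + ((t * a.2.2.2 l : ℝ) : AddCircle (2 * Real.pi)), p.2.2.2))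

theorem proj_flowCover (a : Base ke kx) (t : ℝ) (x : Cover ke kx) :
    proj (flowCover a t x) = flow a t (proj x) := rfl

theorem flow_add (a : Base ke kx) (s t : ℝ) (p : Model ke kx) :
    flow a (s + t) p = flow a s (flow a t p) := by
  refine Prod.ext (Prod.ext ?_ ?_) (Prod.ext (funext fun j => ?_)
    (Prod.ext (funext fun l => ?_) rfl))
  · simp only [flow]; rw [← mul_assoc, ← Complex.exp_add]; push_cast; ring_nf
  · simp only [flow]; rw [← mul_assoc, ← Complex.exp_add]; push_cast; ring_nf
  · simp only [flow]; rw [← mul_assoc, ← Complex.exp_add]; push_cast; ring_nf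
  · simp only [flow]; rw [add_assoc, ← AddCircle.coe_add]; ring_nf

theorem flow_zero (a : Base ke kx) (p : Model ke kx) : flow a 0 p = p := by
  refine Prod.ext (Prod.ext ?_ ?_) (Prod.ext (funext fun j => ?_)
    (Prod.ext (funext fun l => ?_) rfl)) <;>
    simp [flow]

theorem Q_flow (a : Base ke kx) (t : ℝ) (p : Model ke kx) : Q (flow a t p) = Q p := by
  refine Q_eq_iff.2 ⟨?_, fun j => ?_, rfl⟩
  · rw [focus_Q]
    simp only [flow, map_mul, ← Complex.exp_conj, Complex.conj_ofReal]
    rw [mul_mul_mul_comm, ← Complex.exp_add, mul_neg, add_neg_cancel, Complex.exp_zero, one_mul]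
  · simp only [flow, Q]
    rw [re_sq_add_im_sq, re_sq_add_im_sq, norm_mul]
    have : (t : ℂ) * -(a.2.2.1 j * Complex.I) = ((-(t * a.2.2.1 j) : ℝ) : ℂ) * Complex.I := by
      push_cast; ring
    rw [this, Complex.norm_exp_ofReal_mul_I, one_mul]

theorem hasDerivAt_flowCover (a : Base ke kx) (x : Cover ke kx) (t : ℝ) :
    HasDerivAt (fun t => flowCover a t x) (hamField a (flowCover a t x)) t := by
  have h1 : ∀ b z : ℂ, HasDerivAt (fun t : ℝ => Complex.exp (t * b) * z)
      (b * (Complex.exp (t * b) * z)) t := by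
    intro b z
    have h2 : HasDerivAt (fun t : ℝ => (t : ℂ) * b) b t := by
      simpa using (Complex.ofRealCLM.hasDerivAt (x := t)).mul_const b
    refine (h2.cexp.mul_const z).congr_deriv ?_
    ring
  refine HasDerivAt.prodMk ((h1 _ _).prodMk (h1 _ _)) (HasDerivAt.prodMk
    (hasDerivAt_pi.2 fun j => h1 _ _) (HasDerivAt.prodMk (hasDerivAt_pi.2 fun l => ?_)
      (hasDerivAt_const _ _)))
  simpa using ((hasDerivAt_id t).mul_const (a.2.2.2 l)).const_add (x.2.2.1 l)

/-- Undoing the flow of `b` along an integral curve of `hamField b` gives a stationary curve. -/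
theorem hasDerivAt_flowCover_neg {b : Base ke kx} {G : ℝ → Cover ke kx} {t : ℝ}
    (h : HasDerivAt G (hamField b (G t)) t) : HasDerivAt (fun t => flowCover b (-t) (G t)) 0 t := by
  have h1 : ∀ (c : ℂ) (z : ℝ → ℂ), HasDerivAt z (c * z t) t →
      HasDerivAt (fun t : ℝ => Complex.exp ((-t : ℝ) * c) * z t) 0 t := by
    intro c z hz
    have h2 : HasDerivAt (fun t : ℝ => ((-t : ℝ) : ℂ) * c) (-c) t := by
      simpa using ((Complex.ofRealCLM.hasDerivAt (x := t)).neg).mul_const c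
    refine (h2.cexp.mul hz).congr_deriv ?_
    ring
  have e1 := (ContinuousLinearMap.fst ℝ _ _).hasFDerivAt.comp_hasDerivAt t h
  have e2 := (ContinuousLinearMap.snd ℝ _ _).hasFDerivAt.comp_hasDerivAt t h
  have e11 := (ContinuousLinearMap.fst ℝ _ _).hasFDerivAt.comp_hasDerivAt t e1
  have e12 := (ContinuousLinearMap.snd ℝ _ _).hasFDerivAt.comp_hasDerivAt t e1
  have e21 := (ContinuousLinearMap.fst ℝ _ _).hasFDerivAt.comp_hasDerivAt t e2
  have e22 := (ContinuousLinearMap.snd ℝ _ _).hasFDerivAt.comp_hasDerivAt t e2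
  have e221 := (ContinuousLinearMap.fst ℝ _ _).hasFDerivAt.comp_hasDerivAt t e22
  have e222 := (ContinuousLinearMap.snd ℝ _ _).hasFDerivAt.comp_hasDerivAt t e22
  refine HasDerivAt.prodMk (f₁' := (0 : ℂ × ℂ)) ((h1 _ _ e11).prodMk (h1 _ _ e12))
    (HasDerivAt.prodMk (f₁' := (0 : Fin ke → ℂ))
      (hasDerivAt_pi.2 fun j => h1 _ _ (hasDerivAt_pi.1 e21 j))
      (HasDerivAt.prodMk (f₁' := (0 : Fin kx → ℝ)) (hasDerivAt_pi.2 fun l => ?_) e222))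
  have e3 := (hasDerivAt_pi.1 e221 l).add ((hasDerivAt_id t).neg.mul_const (b.2.2.2 l))
  refine e3.congr_deriv ?_
  simp [hamField]

/-! ### Transport of Hamiltonian flows -/

/-- A symplectomorphism `ψ` with saturated connected source, together with mutually inverse smooth
maps of the base such that `Q = B ∘ Q ∘ ψ` and `Q ∘ ψ = C ∘ Q`. -/
structure Conjugates (ψ : OpenPartialHomeomorph (Model ke kx) (Model ke kx))
    (B C : Base ke kx → Base ke kx) : Prop where
  conn : IsConnected ψ.source
  sat : IsSaturated ψ.source
  symp : IsSymplectomorphism ψ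
  eqB : ∀ p ∈ ψ.source, B (Q (ψ p)) = Q p
  eqC : ∀ p ∈ ψ.source, C (Q p) = Q (ψ p)
  smoothB : ContDiffOn ℝ ∞ B (Q '' ψ.target)
  smoothC : ContDiffOn ℝ ∞ C (Q '' ψ.source)

namespace Conjugates

variable {ψ : OpenPartialHomeomorph (Model ke kx) (Model ke kx)} {B C : Base ke kx → Base ke kx}

theorem image_target (_h : Conjugates ψ B C) : Q '' ψ.target = (fun p => Q (ψ p)) '' ψ.source := by
  rw [← ψ.image_source_eq_target, image_image]

theorem relOpen_target (_h : Conjugates ψ B C) : IsRelOpen (Q '' ψ.target) :=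
  isRelOpen_image_Q ψ.open_target

theorem relOpen_source (_h : Conjugates ψ B C) : IsRelOpen (Q '' ψ.source) :=
  isRelOpen_image_Q ψ.open_source

theorem mapsTo_B (h : Conjugates ψ B C) : MapsTo B (Q '' ψ.target) (Q '' ψ.source) := by
  rw [h.image_target]
  rintro _ ⟨p, hp, rfl⟩
  exact ⟨p, hp, (h.eqB p hp).symm⟩

theorem mapsTo_C (h : Conjugates ψ B C) : MapsTo C (Q '' ψ.source) (Q '' ψ.target) := by
  rintro _ ⟨p, hp, rfl⟩
  exact ⟨ψ p, ψ.map_source hp, (h.eqC p hp).symm⟩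

theorem C_B (h : Conjugates ψ B C) : ∀ c ∈ Q '' ψ.target, C (B c) = c := by
  rw [h.image_target]
  rintro _ ⟨p, hp, rfl⟩
  simp only [h.eqB p hp, h.eqC p hp]

theorem B_C (h : Conjugates ψ B C) : ∀ c ∈ Q '' ψ.source, B (C c) = c := by
  rintro _ ⟨p, hp, rfl⟩
  simp only [h.eqB p hp, h.eqC p hp]

/-- The Jacobian of `B`, up to the boundary. -/
def jac (ψ : OpenPartialHomeomorph (Model ke kx) (Model ke kx)) (B : Base ke kx → Base ke kx)
    (c : Base ke kx) : Base ke kx →L[ℝ] Base ke kx := fderivWithin ℝ B (Q '' ψ.target) c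

theorem hasFDerivWithinAt_B (h : Conjugates ψ B C) {c : Base ke kx} (hc : c ∈ Q '' ψ.target) :
    HasFDerivWithinAt B (jac ψ B c) (Q '' ψ.target) c :=
  (h.smoothB.differentiableOn (by simp) c hc).hasFDerivWithinAt

theorem hasFDerivWithinAt_C (h : Conjugates ψ B C) {c : Base ke kx} (hc : c ∈ Q '' ψ.source) :
    HasFDerivWithinAt C (fderivWithin ℝ C (Q '' ψ.source) c) (Q '' ψ.source) c :=
  (h.smoothC.differentiableOn (by simp) c hc).hasFDerivWithinAt

theorem jac_C_jac (h : Conjugates ψ B C) {c : Base ke kx} (hc : c ∈ Q '' ψ.target)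
    (v : Base ke kx) : fderivWithin ℝ C (Q '' ψ.source) (B c) (jac ψ B c v) = v := by
  have h1 := (h.hasFDerivWithinAt_C (h.mapsTo_B hc)).comp c (h.hasFDerivWithinAt_B hc) h.mapsTo_B
  have h2 : HasFDerivWithinAt (C ∘ B) (ContinuousLinearMap.id ℝ _) (Q '' ψ.target) c :=
    (hasFDerivWithinAt_id c _).congr h.C_B (h.C_B c hc)
  have := congrArg (fun A => A v) ((h.relOpen_target.uniqueDiffOn c hc).eq h1 h2)
  simpa using this

theorem jac_jac_C (h : Conjugates ψ B C) {c : Base ke kx} (hc : c ∈ Q '' ψ.target)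
    (v : Base ke kx) : jac ψ B c (fderivWithin ℝ C (Q '' ψ.source) (B c) v) = v := by
  have h0 := h.mapsTo_B hc
  have h3 : HasFDerivWithinAt B (jac ψ B c) (Q '' ψ.target) (C (B c)) := by
    rw [h.C_B c hc]; exact h.hasFDerivWithinAt_B hc
  have h1 := h3.comp (B c) (h.hasFDerivWithinAt_C h0) h.mapsTo_C
  have h2 : HasFDerivWithinAt (B ∘ C) (ContinuousLinearMap.id ℝ _) (Q '' ψ.source) (B c) :=
    (hasFDerivWithinAt_id (B c) _).congr h.B_C (h.B_C _ h0)
  have := congrArg (fun A => A v) ((h.relOpen_source.uniqueDiffOn _ h0).eq h1 h2)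
  simpa using this

theorem mem_target (_h : Conjugates ψ B C) {p : Model ke kx} (hp : p ∈ ψ.source) :
    Q (ψ p) ∈ Q '' ψ.target := ⟨ψ p, ψ.map_source hp, rfl⟩

/-- A lift of `ψ` maps the Hamiltonian field of `dot a ∘ Q` to the Hamiltonian field of
`dot b ∘ Q`, where `b` is the image of `a` under the transposed Jacobian of `B`. -/
theorem fderiv_lift_hamField (h : Conjugates ψ B C) {N : Set (Cover ke kx)}
    {F : Cover ke kx → Cover ke kx} (hN : IsOpen N) (hF : ContDiffOn ℝ ∞ F N)
    (hFN : ∀ y ∈ N, proj (F y) = ψ (proj y) ∧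
      ∀ v w, omega (fderiv ℝ F y v) (fderiv ℝ F y w) = omega v w)
    {x : Cover ke kx} (hxN : x ∈ N) (hx : proj x ∈ ψ.source) (a : Base ke kx) :
    fderiv ℝ F x (hamField a x) = hamField (transp (jac ψ B (Q (ψ (proj x)))) a) (F x) := by
  have hFd : HasFDerivAt F (fderiv ℝ F x) x :=
    ((hF.contDiffAt (hN.mem_nhds hxN)).differentiableAt (by simp)).hasFDerivAt
  have hnhds : ∀ᶠ y in 𝓝 x, y ∈ N ∧ proj y ∈ ψ.source :=
    (hN.eventually_mem hxN).and
      (continuous_proj.continuousAt.eventually_mem (ψ.open_source.mem_nhds hx))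
  have hQ : ∀ z : Cover ke kx, HasFDerivAt (fun x : Cover ke kx => Q (proj x))
      (fderiv ℝ (fun x => Q (proj x)) z) z := fun z =>
    (contDiff_Q_proj.differentiable (by simp) z).hasFDerivAt
  have hchain : fderiv ℝ (fun x => Q (proj x)) x =
      (jac ψ B (Q (ψ (proj x)))).comp ((fderiv ℝ (fun x => Q (proj x)) (F x)).comp
        (fderiv ℝ F x)) := by
    have h1 : HasFDerivAt (fun y => Q (proj (F y))) _ x := (hQ (F x)).comp x hFd
    have h2 := (h.hasFDerivWithinAt_B (h.mem_target hx)).comp_hasFDerivAt_of_eq (x := x) h1 (by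
      filter_upwards [hnhds] with y hy
      rw [(hFN y hy.1).1]
      exact h.mem_target hy.2) (by rw [(hFN x hxN).1])
    refine (hQ x).unique (h2.congr_of_eventuallyEq ?_)
    filter_upwards [hnhds] with y hy
    simp only [Function.comp]
    rw [(hFN y hy.1).1, h.eqB _ hy.2]
  refine sub_eq_zero.1 (eq_zero_of_omega_eq_zero fun v => ?_)
  obtain ⟨v', rfl⟩ := surjective_of_symplectic (hFN x hxN).2 v
  rw [omega_sub_left, (hFN x hxN).2, omega_hamField, omega_hamField, dot_transp, hchain]
  simp

theorem Q_psi_eq (h : Conjugates ψ B C) {p p' : Model ke kx} (hp : p ∈ ψ.source)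
    (hp' : p' ∈ ψ.source) (hQ : Q p = Q p') : Q (ψ p) = Q (ψ p') := by
  rw [← h.eqC p hp, ← h.eqC p' hp', hQ]

/-- As long as the flow of `a` stays in the source, `ψ` maps it to the flow of the image of `a`
under the transposed Jacobian of `B`. This Jacobian is constant along the flow, since `Q` is. -/
theorem psi_flow (h : Conjugates ψ B C) (a : Base ke kx) {p : Model ke kx} {J : Set ℝ}
    (hJ : IsPreconnected J) (h0 : (0 : ℝ) ∈ J) (hJU : ∀ t ∈ J, flow a t p ∈ ψ.source) {t : ℝ}
    (ht : t ∈ J) : ψ (flow a t p) = flow (transp (jac ψ B (Q (ψ p))) a) t (ψ p) := by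
  have hp : p ∈ ψ.source := by simpa [flow_zero] using hJU 0 h0
  set b := transp (jac ψ B (Q (ψ p))) a with hb
  -- undoing the expected flow gives a locally constant curve
  have key : ∀ t₀ ∈ J, ∀ᶠ t in 𝓝 t₀,
      flow b (-t) (ψ (flow a t p)) = flow b (-t₀) (ψ (flow a t₀ p)) := by
    intro t₀ ht₀
    obtain ⟨x, hx⟩ := proj_surjective (flow a t₀ p)
    have hxU : proj x ∈ ψ.source := by rw [hx]; exact hJU t₀ ht₀
    obtain ⟨N, F, hN, hxN, hF, hFN⟩ := (h.symp.1 _ hxU).exists_lift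
    let y : ℝ → Cover ke kx := fun t => flowCover a (t - t₀) x
    have hy : ∀ t, HasDerivAt y (hamField a (y t)) t := fun t => by
      simpa using (hasDerivAt_flowCover a x (t - t₀)).comp_sub_const t t₀
    have hpy : ∀ t, proj (y t) = flow a t p := fun t => by
      simp only [y]
      rw [proj_flowCover, hx, ← flow_add, sub_add_cancel]
    have hy0 : y t₀ = x := by
      simp only [y, sub_self]
      refine Prod.ext (Prod.ext ?_ ?_) (Prod.ext (funext fun j => ?_)
        (Prod.ext (funext fun l => ?_) rfl)) <;> simp [flowCover]
    have hopen : IsOpen {t | y t ∈ N ∧ proj (y t) ∈ ψ.source} := by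
      have hyc : Continuous y := continuous_iff_continuousAt.2 fun t => (hy t).continuousAt
      exact (hN.preimage hyc).inter (ψ.open_source.preimage (continuous_proj.comp hyc))
    obtain ⟨ε, hε, hball⟩ := Metric.isOpen_iff.1 hopen t₀ (by
      simp only [mem_ofPred_eq, hy0]; exact ⟨hxN, hxU⟩)
    have hd : ∀ t ∈ Metric.ball t₀ ε, HasDerivAt (fun t => flowCover b (-t) (F (y t))) 0 t := by
      intro t ht
      obtain ⟨h1, h2⟩ := hball ht
      have h3 : HasFDerivAt F (fderiv ℝ F (y t)) (y t) :=
        ((hF.contDiffAt (hN.mem_nhds h1)).differentiableAt (by simp)).hasFDerivAt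
      have h4 := h3.comp_hasDerivAt t (hy t)
      rw [h.fderiv_lift_hamField hN hF hFN h1 h2] at h4
      have h5 : Q (ψ (proj (y t))) = Q (ψ p) :=
        h.Q_psi_eq h2 hp (by rw [hpy, Q_flow])
      rw [h5] at h4
      exact hasDerivAt_flowCover_neg h4
    filter_upwards [Metric.ball_mem_nhds t₀ hε] with t ht
    have h6 := Metric.isOpen_ball.is_const_of_deriv_eq_zero (convex_ball t₀ ε).isPreconnected
      (fun t ht => (hd t ht).differentiableAt.differentiableWithinAt) (fun t ht => (hd t ht).deriv)
      ht (Metric.mem_ball_self hε)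
    have h7 := congrArg proj h6
    rw [proj_flowCover, proj_flowCover, (hFN _ (hball ht).1).1,
      (hFN _ (hball (Metric.mem_ball_self hε)).1).1, hpy, hpy] at h7
    exact h7
  have hconst := hJ.induction₂
    (fun s t => flow b (-s) (ψ (flow a s p)) = flow b (-t) (ψ (flow a t p)))
    (fun t₀ ht₀ => ((key t₀ ht₀).filter_mono nhdsWithin_le_nhds).mono fun _ h => h.symm)
    (fun _ _ _ _ _ _ h1 h2 => h1.trans h2) (fun _ _ _ _ h => h.symm) ht h0
  simp only [neg_zero, flow_zero] at hconst
  rw [← hconst, ← flow_add, add_neg_cancel, flow_zero]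

theorem flow_mem (h : Conjugates ψ B C) {a : Base ke kx} (ha : a.1 = 0) (t : ℝ) {p : Model ke kx}
    (hp : p ∈ ψ.source) : flow a t p ∈ ψ.source := by
  have := h.sat (t * a.2.1) (fun j => -(t * a.2.2.1 j)) (fun l => t * a.2.2.2 l) p hp
  convert this using 1
  have e1 : focus a = a.2.1 * Complex.I := by
    apply Complex.ext <;> simp [focus, ha]
  refine Prod.ext (Prod.ext ?_ ?_) (Prod.ext (funext fun j => ?_) rfl)
  · simp only [flow, torusAct, e1]; push_cast; ring_nf
  · simp only [flow, torusAct, e1, map_mul, Complex.conj_ofReal, Complex.conj_I]; push_cast; ring_nf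
  · simp only [flow, torusAct]; push_cast; ring_nf

/-- For `a` without `q₁`-component the flow is part of the torus action, under which the source is
invariant; so `psi_flow` applies for all times. -/
theorem psi_flow_of_fst_eq_zero (h : Conjugates ψ B C) {a : Base ke kx} (ha : a.1 = 0)
    {p : Model ke kx} (hp : p ∈ ψ.source) (t : ℝ) :
    ψ (flow a t p) = flow (transp (jac ψ B (Q (ψ p))) a) t (ψ p) :=
  h.psi_flow a (J := univ) isPreconnected_univ (mem_univ _) (fun t _ => h.flow_mem ha t hp)
    (mem_univ t)

end Conjugates

/-- The vectors `a` whose Hamiltonian field vanishes at `p`. -/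
def IsStab (a : Base ke kx) (p : Model ke kx) : Prop :=
  focus a * p.1.1 = 0 ∧ focus a * p.1.2 = 0 ∧ (∀ j, a.2.2.1 j = 0 ∨ p.2.1 j = 0) ∧ a.2.2.2 = 0

theorem hamField_eq_zero_iff {a : Base ke kx} {x : Cover ke kx} :
    hamField a x = 0 ↔ IsStab a (proj x) := by
  simp only [hamField, Prod.ext_iff, funext_iff, IsStab, proj]
  simp [and_assoc]

/-- The differential of `ψ` being injective, `ψ` maps zeros of Hamiltonian fields to zeros. -/
theorem Conjugates.isStab_iff {ψ : OpenPartialHomeomorph (Model ke kx) (Model ke kx)}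
    {B C : Base ke kx → Base ke kx} (h : Conjugates ψ B C) {p : Model ke kx} (hp : p ∈ ψ.source)
    (a : Base ke kx) : IsStab a p ↔ IsStab (transp (jac ψ B (Q (ψ p))) a) (ψ p) := by
  obtain ⟨x, rfl⟩ := proj_surjective p
  obtain ⟨N, F, hN, hxN, hF, hFN⟩ := (h.symp.1 _ hp).exists_lift
  rw [← (hFN x hxN).1, ← hamField_eq_zero_iff, ← hamField_eq_zero_iff, (hFN x hxN).1,
    ← h.fderiv_lift_hamField hN hF hFN hxN hp]
  exact (map_eq_zero_iff _ (injective_of_symplectic (hFN x hxN).2)).symm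

theorem transp_transp (S T : Base ke kx →L[ℝ] Base ke kx) (a : Base ke kx) :
    transp S (transp T a) = transp (T.comp S) a :=
  dot_ext fun v => by simp only [dot_transp, ContinuousLinearMap.comp_apply]

theorem transp_id (a : Base ke kx) : transp (ContinuousLinearMap.id ℝ _) a = a :=
  dot_ext fun v => by simp only [dot_transp, ContinuousLinearMap.id_apply]

/-! ### The period lattice -/

/-- Vectors of the period lattice: no component along `q₁`, the other ones being integers. -/
def IsInt (a : Base ke kx) : Prop :=
  a.1 = 0 ∧ a.2.1 ∈ range ((↑) : ℤ → ℝ) ∧ (∀ j, a.2.2.1 j ∈ range ((↑) : ℤ → ℝ)) ∧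
    ∀ l, a.2.2.2 l ∈ range ((↑) : ℤ → ℝ)

theorem isInt_e₂ : IsInt ((0, 1, 0, 0) : Base ke kx) :=
  ⟨rfl, ⟨1, by simp⟩, fun _ => ⟨0, by simp⟩, fun _ => ⟨0, by simp⟩⟩

theorem isInt_ellVec (i : Fin ke) : IsInt (ellVec kx i) :=
  ⟨rfl, ⟨0, by simp [ellVec]⟩, fun j => ⟨if j = i then 1 else 0, by simp [ellVec, Pi.single_apply]⟩,
    fun _ => ⟨0, by simp [ellVec]⟩⟩

theorem isInt_trVec (i : Fin kx) : IsInt (trVec ke i) :=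
  ⟨rfl, ⟨0, by simp [trVec]⟩, fun _ => ⟨0, by simp [trVec]⟩,
    fun j => ⟨if j = i then 1 else 0, by simp [trVec, Pi.single_apply]⟩⟩

theorem isClosed_isInt : IsClosed {a : Base ke kx | IsInt a} := by
  have hr : IsClosed (range ((↑) : ℤ → ℝ)) := Int.isClosedEmbedding_coe_real.isClosed_range
  have : {a : Base ke kx | IsInt a} = {a | a.1 = 0} ∩ ((fun a => a.2.1) ⁻¹' range ((↑) : ℤ → ℝ) ∩
      ((⋂ j, (fun a => a.2.2.1 j) ⁻¹' range ((↑) : ℤ → ℝ)) ∩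
        ⋂ l, (fun a => a.2.2.2 l) ⁻¹' range ((↑) : ℤ → ℝ))) := by
    ext a
    simp only [IsInt, mem_inter_iff, mem_ofPred_eq, mem_preimage, mem_iInter]
  rw [this]
  refine (isClosed_eq (by fun_prop) (by fun_prop)).inter ((hr.preimage (by fun_prop)).inter
    ((isClosed_iInter fun j => hr.preimage (by fun_prop)).inter
      (isClosed_iInter fun l => hr.preimage (by fun_prop))))

theorem one_le_dist_of_mem_range {x y : ℝ} (hx : x ∈ range ((↑) : ℤ → ℝ))
    (hy : y ∈ range ((↑) : ℤ → ℝ)) (hne : x ≠ y) : 1 ≤ dist x y := by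
  obtain ⟨m, rfl⟩ := hx
  obtain ⟨n, rfl⟩ := hy
  have : m ≠ n := fun h => hne (by rw [h])
  rw [Real.dist_eq, ← Int.cast_sub, ← Int.cast_abs]
  exact_mod_cast Int.one_le_abs (sub_ne_zero.2 this)

theorem IsInt.one_le_dist {a b : Base ke kx} (ha : IsInt a) (hb : IsInt b) (hne : a ≠ b) :
    1 ≤ dist a b := by
  obtain ⟨a1, a2, a3, a4⟩ := ha
  obtain ⟨b1, b2, b3, b4⟩ := hb
  have h2 : dist a.2 b.2 ≤ dist a b := le_max_right _ _
  have h22 : dist a.2.2 b.2.2 ≤ dist a.2 b.2 := le_max_right _ _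
  by_contra! hlt
  apply hne
  refine Prod.ext (a1.trans b1.symm) (Prod.ext ?_ (Prod.ext (funext fun j => ?_)
    (funext fun l => ?_)))
  · by_contra h
    have : dist a.2.1 b.2.1 ≤ dist a.2 b.2 := le_max_left _ _
    linarith [one_le_dist_of_mem_range a2 b2 h]
  · by_contra h
    have : dist (a.2.2.1 j) (b.2.2.1 j) ≤ dist a.2.2 b.2.2 :=
      (dist_le_pi_dist _ _ j).trans (le_max_left _ _)
    linarith [one_le_dist_of_mem_range (a3 j) (b3 j) h]
  · by_contra h
    have : dist (a.2.2.2 l) (b.2.2.2 l) ≤ dist a.2.2 b.2.2 :=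
      (dist_le_pi_dist _ _ l).trans (le_max_right _ _)
    linarith [one_le_dist_of_mem_range (a4 l) (b4 l) h]

/-- The points at which no focus-focus or elliptic block is singular, i.e. at which `Q` is a
submersion. -/
def IsRegular (p : Model ke kx) : Prop := p.1 ≠ 0 ∧ ∀ j, p.2.1 j ≠ 0

theorem flow_two_pi_of_isInt {a : Base ke kx} (ha : IsInt a) (p : Model ke kx) :
    flow a (2 * Real.pi) p = p := by
  obtain ⟨a1, ⟨n, a2⟩, a3, a4⟩ := ha
  have e1 : focus a = n * Complex.I := by apply Complex.ext <;> simp [focus, a1, a2]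
  have e2 : Complex.exp ((2 * Real.pi : ℝ) * focus a) = 1 := by
    rw [e1, Complex.exp_eq_one_iff]; exact ⟨n, by push_cast; ring⟩
  have e3 : Complex.exp ((2 * Real.pi : ℝ) * -starRingEnd ℂ (focus a)) = 1 := by
    rw [e1, Complex.exp_eq_one_iff]; exact ⟨n, by simp; ring⟩
  refine Prod.ext (Prod.ext ?_ ?_) (Prod.ext (funext fun j => ?_)
    (Prod.ext (funext fun l => ?_) rfl))
  · simp only [flow, e2, one_mul]
  · simp only [flow, e3, one_mul]
  · obtain ⟨m, hm⟩ := a3 j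
    have e4 : Complex.exp ((2 * Real.pi : ℝ) * -(a.2.2.1 j * Complex.I)) = 1 := by
      rw [← hm, Complex.exp_eq_one_iff]; exact ⟨-m, by push_cast; ring⟩
    simp only [flow, e4, one_mul]
  · obtain ⟨m, hm⟩ := a4 l
    simp only [flow]
    rw [← hm, add_eq_left, AddCircle.coe_eq_zero_iff]
    exact ⟨m, by simp [mul_comm]⟩

/-- At a regular point, the flows of period `2π` are those of the period lattice. -/
theorem isInt_of_flow_two_pi {a : Base ke kx} {p : Model ke kx} (hp : IsRegular p)
    (h : flow a (2 * Real.pi) p = p) : IsInt a := by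
  have hpi := Real.pi_ne_zero
  have h1 : Complex.exp ((2 * Real.pi : ℝ) * focus a) * p.1.1 = p.1.1 := congrArg (fun q => q.1.1) h
  have h2 : Complex.exp ((2 * Real.pi : ℝ) * -starRingEnd ℂ (focus a)) * p.1.2 = p.1.2 :=
    congrArg (fun q => q.1.2) h
  have h3 : ∀ j, Complex.exp ((2 * Real.pi : ℝ) * -(a.2.2.1 j * Complex.I)) * p.2.1 j = p.2.1 j :=
    fun j => congrArg (fun q => q.2.1 j) h
  have h4 : ∀ l, p.2.2.1 l + ((2 * Real.pi * a.2.2.2 l : ℝ) : AddCircle (2 * Real.pi))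
      = p.2.2.1 l := fun l => congrArg (fun q => q.2.2.1 l) h
  have h12 : a.1 = 0 ∧ a.2.1 ∈ range ((↑) : ℤ → ℝ) := by
    have hcase : p.1.1 ≠ 0 ∨ p.1.2 ≠ 0 := by
      by_contra! hc
      exact hp.1 (Prod.ext hc.1 hc.2)
    rcases hcase with hc | hc
    · obtain ⟨n, hn⟩ := Complex.exp_eq_one_iff.1 (mul_eq_right₀ hc |>.1 h1)
      have hre := congrArg Complex.re hn
      have him := congrArg Complex.im hn
      simp [focus] at hre him
      refine ⟨hre, n, ?_⟩
      have : (2 * Real.pi) * (n - a.2.1) = 0 := by linarith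
      rcases mul_eq_zero.1 this with h0 | h0
      · exact absurd h0 (by positivity)
      · linarith
    · obtain ⟨n, hn⟩ := Complex.exp_eq_one_iff.1 (mul_eq_right₀ hc |>.1 h2)
      have hre := congrArg Complex.re hn
      have him := congrArg Complex.im hn
      simp [focus] at hre him
      refine ⟨hre, n, ?_⟩
      have : (2 * Real.pi) * (n - a.2.1) = 0 := by linarith
      rcases mul_eq_zero.1 this with h0 | h0
      · exact absurd h0 (by positivity)
      · linarith
  refine ⟨h12.1, h12.2, fun j => ?_, fun l => ?_⟩
  · obtain ⟨n, hn⟩ := Complex.exp_eq_one_iff.1 (mul_eq_right₀ (hp.2 j) |>.1 (h3 j))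
    have him := congrArg Complex.im hn
    simp at him
    refine ⟨-n, ?_⟩
    have : (2 * Real.pi) * (n + a.2.2.1 j) = 0 := by linarith
    rcases mul_eq_zero.1 this with h0 | h0
    · exact absurd h0 (by positivity)
    · push_cast; linarith
  · obtain ⟨n, hn⟩ := (AddCircle.coe_eq_zero_iff _).1 (add_eq_left.1 (h4 l))
    refine ⟨n, ?_⟩
    rw [zsmul_eq_mul] at hn
    have : (2 * Real.pi) * (n - a.2.2.2 l) = 0 := by linarith
    rcases mul_eq_zero.1 this with h0 | h0
    · exact absurd h0 (by positivity)
    · linarith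

theorem ne_zero_of_Q_pos {p : Model ke kx} {j : Fin ke} (h : 0 < (Q p).2.2.1 j) : p.2.1 j ≠ 0 := by
  intro h0
  simp [Q, h0] at h

theorem Q_pos_of_ne_zero {p : Model ke kx} {j : Fin ke} (h : p.2.1 j ≠ 0) :
    0 < (Q p).2.2.1 j := by
  have h1 : 0 < Complex.normSq (p.2.1 j) := Complex.normSq_pos.2 h
  rw [Complex.normSq_apply] at h1
  simp only [Q]
  nlinarith

theorem Q_eq_zero_of_eq_zero {p : Model ke kx} {j : Fin ke} (h : p.2.1 j = 0) :
    (Q p).2.2.1 j = 0 := by simp [Q, h]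

/-- Fibres over interior values of the quadrant contain regular points, even if they are
focus-focus. -/
theorem exists_isRegular {V : Set (Model ke kx)} (hV : IsOpen V) {c : Base ke kx}
    (hc : c ∈ openQuadrant ke kx) (hcV : c ∈ Q '' V) : ∃ P ∈ V, Q P = c ∧ IsRegular P := by
  have h1 : fold (unfold (fun _ => 1) c) = c := fold_unfold (by simp) (openQuadrant_subset hc)
  obtain ⟨S, -, hS1, hS2, hS3⟩ := exists_section hV (x := unfold (fun _ => 1) c) (by rwa [h1])
  have h2 : Q (proj (S (unfold (fun _ => 1) c))) = c := by rw [hS1, h1]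
  exact ⟨_, hS2, h2, hS3, fun j => ne_zero_of_Q_pos (by rw [h2]; exact hc j)⟩

theorem IsRelOpen.eq_of_fderivWithin_eq_zero {T : Set (Base ke kx)} (hT : IsRelOpen T)
    (hconn : IsPreconnected T) {f : Base ke kx → ℝ} (hf : DifferentiableOn ℝ f T)
    (hf' : ∀ c ∈ T, fderivWithin ℝ f T c = 0) {c c' : Base ke kx} (hc : c ∈ T) (hc' : c' ∈ T) :
    f c = f c' := by
  refine hconn.induction₂ (fun x y => f x = f y) (fun x hx => ?_)
    (fun _ _ _ _ _ _ h1 h2 => h1.trans h2) (fun _ _ _ _ h => h.symm) hc hc'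
  obtain ⟨ρ, hρ, hsub⟩ := hT.exists_ball hx
  have hconv := hT.convex_inter_ball hsub
  have hmem := inter_mem_nhdsWithin T (Metric.ball_mem_nhds x hρ)
  filter_upwards [hmem] with y hy
  refine hconv.is_const_of_fderivWithin_eq_zero (𝕜 := ℝ) (hf.mono inter_subset_left)
    (fun z hz => ?_) ⟨hx, Metric.mem_ball_self hρ⟩ hy
  rw [fderivWithin_inter (Metric.isOpen_ball.mem_nhds hz.2)]
  exact hf' z hz.1

namespace Conjugates

variable {ψ : OpenPartialHomeomorph (Model ke kx) (Model ke kx)} {B C : Base ke kx → Base ke kx}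

theorem isPreconnected_target (h : Conjugates ψ B C) : IsPreconnected (Q '' ψ.target) := by
  have hQ : Continuous (Q : Model ke kx → Base ke kx) := by
    unfold Q
    fun_prop
  rw [← ψ.image_source_eq_target]
  exact (h.conn.isPreconnected.image _ ψ.continuousOn).image _ hQ.continuousOn

theorem continuousOn_transp (h : Conjugates ψ B C) (a : Base ke kx) :
    ContinuousOn (fun c => transp (jac ψ B c) a) (Q '' ψ.target) := by
  have h1 : ContinuousOn (jac ψ B) (Q '' ψ.target) :=
    h.smoothB.continuousOn_fderivWithin h.relOpen_target.uniqueDiffOn (by simp)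
  have h2 : ∀ v : Base ke kx, ContinuousOn (fun c => dot a (jac ψ B c v)) (Q '' ψ.target) :=
    fun v => (dot a).toContinuousLinearMap.continuous.comp_continuousOn
      (h1.clm_apply continuousOn_const)
  exact (h2 _).prodMk ((h2 _).prodMk ((continuousOn_pi.2 fun j => h2 (ellVec kx j)).prodMk
    (continuousOn_pi.2 fun l => h2 (trVec ke l))))

/-- Periodic flows go to periodic flows: the transposed Jacobian preserves the period lattice. This
is read at regular points, and extends to the boundary by continuity. -/
theorem isInt_transp (h : Conjugates ψ B C) {c : Base ke kx} (hc : c ∈ Q '' ψ.target)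
    {a : Base ke kx} (ha : IsInt a) : IsInt (transp (jac ψ B c) a) := by
  have hcont := h.continuousOn_transp a
  have hreg : ∀ c ∈ openQuadrant ke kx ∩ Q '' ψ.target, IsInt (transp (jac ψ B c) a) := by
    rintro c ⟨hcq, hcV⟩
    obtain ⟨P, hP, rfl, hPreg⟩ := exists_isRegular ψ.open_target hcq hcV
    have h1 := h.psi_flow_of_fst_eq_zero ha.1 (ψ.map_target hP) (2 * Real.pi)
    rw [flow_two_pi_of_isInt ha, ψ.right_inv hP] at h1
    exact isInt_of_flow_two_pi hPreg h1.symm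
  have h3 := ((hcont c hc).mono inter_subset_right).mem_closure_image
    (h.relOpen_target.mem_closure hc)
  refine closure_minimal ?_ isClosed_isInt h3
  rintro _ ⟨c', hc', rfl⟩
  exact hreg c' hc'

/-- As the period lattice is discrete, the rows of the Jacobian other than the first one are
constant. -/
theorem transp_eq (h : Conjugates ψ B C) {c c' : Base ke kx} (hc : c ∈ Q '' ψ.target)
    (hc' : c' ∈ Q '' ψ.target) {a : Base ke kx} (ha : IsInt a) :
    transp (jac ψ B c) a = transp (jac ψ B c') a := by
  have hcont := h.continuousOn_transp a
  exact h.isPreconnected_target.eq_of_one_le_dist hcont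
    (fun x hx y hy hne => (h.isInt_transp hx ha).one_le_dist (h.isInt_transp hy ha) hne) hc hc'

/-- The components of `B` other than the first one are affine. -/
theorem dot_B_sub (h : Conjugates ψ B C) {c c' : Base ke kx} (hc : c ∈ Q '' ψ.target)
    (hc' : c' ∈ Q '' ψ.target) {a : Base ke kx} (ha : IsInt a) :
    dot a (B c) - dot a (B c') = dot (transp (jac ψ B c') a) (c - c') := by
  set r := transp (jac ψ B c') a
  let D : Base ke kx → ℝ := fun x => dot a (B x) - dot r x
  have hD : ∀ x ∈ Q '' ψ.target,
      HasFDerivWithinAt D (0 : Base ke kx →L[ℝ] ℝ) (Q '' ψ.target) x := by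
    intro x hx
    have h1 := ((dot a).toContinuousLinearMap.hasFDerivAt (x := B x)).comp_hasFDerivWithinAt x
      (h.hasFDerivWithinAt_B hx)
    have h2 := h1.sub
      ((dot r).toContinuousLinearMap.hasFDerivWithinAt (s := Q '' ψ.target) (x := x))
    refine h2.congr_fderiv (ContinuousLinearMap.ext fun v => ?_)
    have h3 : dot a (jac ψ B x v) = dot r v := by rw [← dot_transp, h.transp_eq hx hc' ha]
    simp [h3]
  have := h.relOpen_target.eq_of_fderivWithin_eq_zero h.isPreconnected_target (f := D)
    (fun x hx => (hD x hx).differentiableWithinAt)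
    (fun x hx => (hD x hx).fderivWithin (h.relOpen_target.uniqueDiffOn x hx)) hc hc'
  rw [map_sub]
  simp only [D] at this
  linarith

theorem eq_smul_of_dot_eq_zero {v : Base ke kx} (h : ∀ a, IsInt a → dot a v = 0) :
    v = v.1 • (1, 0, 0, 0) := by
  refine Prod.ext (by simp) (Prod.ext ?_ (Prod.ext (funext fun j => ?_) (funext fun l => ?_)))
  · simpa [dot_apply] using h _ isInt_e₂
  · simpa [dot_apply, ellVec, Pi.single_apply] using h _ (isInt_ellVec j)
  · simpa [dot_apply, trVec, Pi.single_apply] using h _ (isInt_trVec l)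

/-- The first column of the Jacobian vanishes below the diagonal. -/
theorem jac_e₁ (h : Conjugates ψ B C) {c : Base ke kx} (hc : c ∈ Q '' ψ.target) :
    jac ψ B c (1, 0, 0, 0) = (jac ψ B c (1, 0, 0, 0)).1 • (1, 0, 0, 0) := by
  refine eq_smul_of_dot_eq_zero fun a ha => ?_
  exact (h.isInt_transp hc ha).1

theorem jac_e₁_ne_zero (h : Conjugates ψ B C) {c : Base ke kx} (hc : c ∈ Q '' ψ.target) :
    (jac ψ B c (1, 0, 0, 0)).1 ≠ 0 := by
  intro h0
  have h1 := h.jac_C_jac hc (1, 0, 0, 0)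
  rw [h.jac_e₁ hc, h0, zero_smul, map_zero] at h1
  exact zero_ne_one (congrArg Prod.fst h1)

/-- The inverse transposed Jacobian. -/
def invTransp (ψ : OpenPartialHomeomorph (Model ke kx) (Model ke kx))
    (B C : Base ke kx → Base ke kx) (c a : Base ke kx) : Base ke kx :=
  transp (fderivWithin ℝ C (Q '' ψ.source) (B c)) a

theorem transp_invTransp (h : Conjugates ψ B C) {c : Base ke kx} (hc : c ∈ Q '' ψ.target)
    (a : Base ke kx) : transp (jac ψ B c) (invTransp ψ B C c a) = a := by
  rw [invTransp, transp_transp]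
  conv_rhs => rw [← transp_id a]
  congr 1
  exact ContinuousLinearMap.ext fun v => h.jac_C_jac hc v

theorem invTransp_transp (h : Conjugates ψ B C) {c : Base ke kx} (hc : c ∈ Q '' ψ.target)
    (a : Base ke kx) : invTransp ψ B C c (transp (jac ψ B c) a) = a := by
  rw [invTransp, transp_transp]
  conv_rhs => rw [← transp_id a]
  congr 1
  exact ContinuousLinearMap.ext fun v => h.jac_jac_C hc v

theorem exists_isRegular_source (h : Conjugates ψ B C) : ∃ p ∈ ψ.source, IsRegular p := by
  obtain ⟨p, hp⟩ := h.conn.nonempty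
  have h1 := h.relOpen_source.mem_closure (c := Q p) ⟨p, hp, rfl⟩
  obtain ⟨c, hc, hcU⟩ : (openQuadrant ke kx ∩ Q '' ψ.source).Nonempty :=
    closure_nonempty_iff.1 ⟨_, h1⟩
  obtain ⟨p, hp, -, hreg⟩ := exists_isRegular ψ.open_source hc hcU
  exact ⟨p, hp, hreg⟩

/-- As `ψ` is injective on a regular orbit of the torus, the transposed Jacobian is onto the period
lattice. -/
theorem isInt_invTransp (h : Conjugates ψ B C) {c : Base ke kx} (hc : c ∈ Q '' ψ.target)
    {a : Base ke kx} (ha : IsInt a) : IsInt (invTransp ψ B C c a) := by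
  have key : ∀ c' ∈ Q '' ψ.target, (invTransp ψ B C c' a).1 = 0 := by
    intro c' hc'
    have h1 := h.jac_C_jac hc' (1, 0, 0, 0)
    have h2 : fderivWithin ℝ C (Q '' ψ.source) (B c') (1, 0, 0, 0)
        = ((jac ψ B c' (1, 0, 0, 0)).1)⁻¹ • (1, 0, 0, 0) := by
      rw [h.jac_e₁ hc', map_smul] at h1
      rw [eq_inv_smul_iff₀ (h.jac_e₁_ne_zero hc')]
      exact h1
    change dot a (fderivWithin ℝ C (Q '' ψ.source) (B c') (1, 0, 0, 0)) = 0
    rw [h2, map_smul]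
    have : dot a ((1, 0, 0, 0) : Base ke kx) = a.1 := by simp [dot_apply]
    rw [this, ha.1, smul_zero]
  obtain ⟨p, hp, hreg⟩ := h.exists_isRegular_source
  have hp' := h.mem_target hp
  have hint : IsInt (invTransp ψ B C (Q (ψ p)) a) := by
    have h1 := h.psi_flow_of_fst_eq_zero (key _ hp') hp (2 * Real.pi)
    rw [h.transp_invTransp hp', flow_two_pi_of_isInt ha] at h1
    exact isInt_of_flow_two_pi hreg (ψ.injOn (h.flow_mem (key _ hp') _ hp) hp h1)
  have h2 := h.transp_eq hp' hc hint
  rw [h.transp_invTransp hp'] at h2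
  rwa [h2, h.invTransp_transp hc]

end Conjugates

/-! ### Critical points and the lower rows -/

/-- Points of the Williamson type of the model. -/
def IsCrit (p : Model ke kx) : Prop := p.1 = 0 ∧ p.2.1 = 0

theorem isCrit_iff_isStab {p : Model ke kx} :
    IsCrit p ↔ ∀ a : Base ke kx, a.2.2.2 = 0 → IsStab a p := by
  constructor
  · rintro ⟨h1, h2⟩ a ha
    exact ⟨by simp [h1], by simp [h1], fun j => Or.inr (by simp [h2]), ha⟩
  · intro h
    obtain ⟨h1, h2, -, -⟩ := h (1, 0, 0, 0) rfl
    have h3 : focus ((1, 0, 0, 0) : Base ke kx) ≠ 0 := fun h => by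
      have := congrArg Complex.re h; simp [focus] at this
    refine ⟨Prod.ext ((mul_eq_zero.1 h1).resolve_left h3) ((mul_eq_zero.1 h2).resolve_left h3),
      funext fun j => ?_⟩
    obtain ⟨-, -, h4, -⟩ := h (ellVec kx j) rfl
    exact (h4 j).resolve_left (by simp [ellVec])

theorem fst_eq_zero_iff_isStab {p : Model ke kx} (hp : ∀ j, p.2.1 j ≠ 0) :
    p.1 = 0 ↔ ∃ a : Base ke kx, a ≠ 0 ∧ IsStab a p := by
  constructor
  · intro h
    refine ⟨(1, 0, 0, 0), fun h => one_ne_zero (congrArg Prod.fst h), by simp [h], by simp [h],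
      fun j => Or.inl rfl, rfl⟩
  · rintro ⟨a, ha, h1, h2, h3, h4⟩
    have h5 : focus a ≠ 0 := by
      intro h
      apply ha
      exact Prod.ext (congrArg Complex.re h) (Prod.ext (congrArg Complex.im h)
        (Prod.ext (funext fun j => (h3 j).resolve_right (hp j)) h4))
    exact Prod.ext ((mul_eq_zero.1 h1).resolve_left h5) ((mul_eq_zero.1 h2).resolve_left h5)

theorem dot_add_left (a b v : Base ke kx) : dot (a + b) v = dot a v + dot b v := by
  rw [dot_comm, map_add, dot_comm v, dot_comm v]

theorem dot_smul_left (r : ℝ) (a v : Base ke kx) : dot (r • a) v = r * dot a v := by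
  rw [dot_comm, map_smul, dot_comm v, smul_eq_mul]

/-- The transpose as a linear map. -/
def transpLin (T : Base ke kx →L[ℝ] Base ke kx) : Base ke kx →ₗ[ℝ] Base ke kx where
  toFun := transp T
  map_add' a b := dot_ext fun v => by
    simp only [dot_transp, dot_add_left]
  map_smul' r a := dot_ext fun v => by
    simp only [dot_transp, dot_smul_left, RingHom.id_apply]

/-- An injective endomorphism of the base preserving the subspace without transverse components maps
it onto itself. -/
theorem exists_eq_of_injective {L : Base ke kx →ₗ[ℝ] Base ke kx} (hL : Function.Injective L)
    (hK : ∀ a : Base ke kx, a.2.2.2 = 0 → (L a).2.2.2 = 0) {b : Base ke kx} (hb : b.2.2.2 = 0) :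
    ∃ a : Base ke kx, a.2.2.2 = 0 ∧ L a = b := by
  let K : Submodule ℝ (Base ke kx) := LinearMap.ker
    ((LinearMap.snd ℝ (Fin ke → ℝ) (Fin kx → ℝ)).comp
      ((LinearMap.snd ℝ ℝ _).comp (LinearMap.snd ℝ ℝ _)))
  have hmem : ∀ a : Base ke kx, a ∈ K ↔ a.2.2.2 = 0 := fun a => Iff.rfl
  let L' := L.restrict (p := K) (q := K) (fun a ha => hK a ha)
  have hinj : Function.Injective L' := fun x y hxy =>
    Subtype.ext (hL (congrArg Subtype.val hxy))
  obtain ⟨a, ha⟩ := (LinearMap.injective_iff_surjective.1 hinj) ⟨b, hb⟩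
  exact ⟨a, a.2, congrArg Subtype.val ha⟩

/-- A nonnegative integer matrix with a nonnegative integer inverse is a permutation matrix. -/
theorem exists_perm_of_nonneg {n : ℕ} {E E' : Matrix (Fin n) (Fin n) ℤ} (hE : ∀ i j, 0 ≤ E i j)
    (hE' : ∀ i j, 0 ≤ E' i j) (h : E * E' = 1) :
    ∃ σ : Equiv.Perm (Fin n), ∀ i j, E i j = if j = σ i then 1 else 0 := by
  have h' : E' * E = 1 := mul_eq_one_comm.1 h
  have hsum : ∀ i k, ∑ j, E i j * E' j k = if i = k then 1 else 0 := fun i k => by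
    rw [← Matrix.mul_apply, h, Matrix.one_apply]
  have hsum' : ∀ i k, ∑ j, E' i j * E j k = if i = k then 1 else 0 := fun i k => by
    rw [← Matrix.mul_apply, h', Matrix.one_apply]
  have hex : ∀ i, ∃ j, 0 < E i j ∧ 0 < E' j i := by
    intro i
    by_contra! hc
    have h0 : ∑ j, E i j * E' j i = 0 := by
      refine Finset.sum_eq_zero fun j _ => ?_
      rcases (hE i j).eq_or_lt with h1 | h1
      · rw [← h1, zero_mul]
      · rw [le_antisymm (hc j h1) (hE' j i), mul_zero]
    rw [hsum, if_pos rfl] at h0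
    exact one_ne_zero h0
  choose s hs hs' using hex
  have hz : ∀ i k, k ≠ i → E' (s i) k = 0 := by
    intro i k hki
    have h1 := hsum i k
    rw [if_neg hki.symm] at h1
    have h2 := (Finset.sum_eq_zero_iff_of_nonneg
      (fun j _ => mul_nonneg (hE i j) (hE' j k))).1 h1 (s i) (Finset.mem_univ _)
    exact (mul_eq_zero.1 h2).resolve_left (hs i).ne'
  have hrow : ∀ i j, E' (s i) i * E i j = if s i = j then 1 else 0 := by
    intro i j
    rw [← hsum', Finset.sum_eq_single i]
    · intro k _ hk; rw [hz i k hk, zero_mul]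
    · simp
  have hinj : Function.Injective s := by
    intro i k hik
    by_contra hne
    have := hz i k (Ne.symm hne)
    rw [hik] at this
    exact (hs' k).ne' this
  refine ⟨Equiv.ofBijective s (Finite.injective_iff_bijective.1 hinj), fun i j => ?_⟩
  rw [Equiv.ofBijective_apply]
  have h1 := hrow i j
  split_ifs with hj
  · subst hj
    rw [if_pos rfl] at h1
    rcases Int.mul_eq_one_iff_eq_one_or_neg_one.1 h1 with h2 | h2
    · exact h2.2
    · have := hs i; omega
  · rw [if_neg (Ne.symm hj)] at h1
    exact (mul_eq_zero.1 h1).resolve_left (hs' i).ne'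

theorem IsRelOpen.dot_nonneg {T : Set (Base ke kx)} (hT : IsRelOpen T) {c₀ r : Base ke kx}
    (hc₀ : c₀ ∈ T) (hr : ∀ c ∈ T, 0 ≤ dot r (c - c₀)) {v : Base ke kx}
    (hv : v ∈ quadrant ke kx) : 0 ≤ dot r v := by
  obtain ⟨ρ, hρ, hsub⟩ := hT.exists_ball hc₀
  have h1 := tendsto_add_smul c₀ v
  obtain ⟨t, ht, ht0⟩ := ((h1.eventually_mem (Metric.ball_mem_nhds c₀ hρ)).and
    self_mem_nhdsWithin).exists
  have ht0 : 0 < t := ht0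
  have h2 := hr _ (hsub ⟨fun j => ?_, ht⟩)
  · rw [add_sub_cancel_left, map_smul, smul_eq_mul] at h2
    exact nonneg_of_mul_nonneg_right h2 ht0
  · have h3 := hT.subset hc₀ j
    have h4 := hv j
    simp only [Prod.snd_add, Prod.fst_add, Prod.smul_snd, Prod.smul_fst, Pi.add_apply,
      Pi.smul_apply, smul_eq_mul]
    positivity

/-- A linear form which is minimal over a relatively open subset of the quadrant at a point of it
only involves the elliptic coordinates, with nonnegative coefficients. -/
theorem IsRelOpen.of_dot_nonneg {T : Set (Base ke kx)} (hT : IsRelOpen T) {c₀ r : Base ke kx}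
    (hc₀ : c₀ ∈ T) (hr : ∀ c ∈ T, 0 ≤ dot r (c - c₀)) :
    r.1 = 0 ∧ r.2.1 = 0 ∧ r.2.2.2 = 0 ∧ ∀ j, 0 ≤ r.2.2.1 j := by
  have key := fun v hv => hT.dot_nonneg hc₀ hr (v := v) hv
  have hz : ∀ v : Base ke kx, v.2.2.1 = 0 → dot r v = 0 := by
    intro v hv
    refine le_antisymm ?_ (key v fun j => by simp [hv])
    have := key (-v) fun j => by simp [hv]
    rw [map_neg] at this
    linarith
  refine ⟨?_, ?_, funext fun l => ?_, fun j => ?_⟩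
  · simpa [dot_apply] using hz (1, 0, 0, 0) rfl
  · simpa [dot_apply] using hz (0, 1, 0, 0) rfl
  · simpa [dot_apply, trVec, Pi.single_apply] using hz (trVec ke l) rfl
  · have := key (ellVec kx j) fun i => by
      by_cases h : i = j <;> simp [ellVec, h]
    simpa [dot_apply, ellVec, Pi.single_apply] using this

theorem dot_ellVec (i : Fin ke) (v : Base ke kx) : dot (ellVec kx i) v = v.2.2.1 i := by
  simp [dot_apply, ellVec, Pi.single_apply]

theorem dot_trVec (l : Fin kx) (v : Base ke kx) : dot (trVec ke l) v = v.2.2.2 l := by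
  simp [dot_apply, trVec, Pi.single_apply]

theorem dot_e₂ (v : Base ke kx) : dot ((0, 1, 0, 0) : Base ke kx) v = v.2.1 := by
  simp [dot_apply]

namespace Conjugates

variable {ψ : OpenPartialHomeomorph (Model ke kx) (Model ke kx)} {B C : Base ke kx → Base ke kx}

/-- Critical points are those where all flows without transverse component are stationary, a space
of the same dimension at `p` and at `ψ p`. -/
theorem isCrit_iff (h : Conjugates ψ B C) {p : Model ke kx} (hp : p ∈ ψ.source) :
    IsCrit p ↔ IsCrit (ψ p) := by
  have hc := h.mem_target hp
  have hinj1 : Function.Injective (transpLin (jac ψ B (Q (ψ p)))) :=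
    Function.LeftInverse.injective (h.invTransp_transp hc)
  have hinj2 : Function.Injective (transpLin (fderivWithin ℝ C (Q '' ψ.source) (B (Q (ψ p))))) :=
    Function.LeftInverse.injective (h.transp_invTransp hc)
  constructor
  · intro hcr
    rw [isCrit_iff_isStab] at hcr ⊢
    intro b hb
    have hst : ∀ a : Base ke kx, a.2.2.2 = 0 → IsStab (transp (jac ψ B (Q (ψ p))) a) (ψ p) :=
      fun a ha => (h.isStab_iff hp a).1 (hcr a ha)
    obtain ⟨a, ha, rfl⟩ := exists_eq_of_injective hinj1 (fun a ha => (hst a ha).2.2.2) hb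
    exact hst a ha
  · intro hcr
    rw [isCrit_iff_isStab] at hcr ⊢
    intro b hb
    have hst : ∀ a : Base ke kx, a.2.2.2 = 0 → IsStab (invTransp ψ B C (Q (ψ p)) a) p := by
      intro a ha
      rw [h.isStab_iff hp, h.transp_invTransp hc]
      exact hcr a ha
    obtain ⟨a, ha, rfl⟩ := exists_eq_of_injective hinj2 (fun a ha => (hst a ha).2.2.2) hb
    exact hst a ha

/-- Where no elliptic block is singular, the focus-focus points are those with a nontrivial
stabiliser. -/
theorem fst_eq_zero_iff (h : Conjugates ψ B C) {p : Model ke kx} (hp : p ∈ ψ.source)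
    (h1 : ∀ j, p.2.1 j ≠ 0) (h2 : ∀ j, (ψ p).2.1 j ≠ 0) : p.1 = 0 ↔ (ψ p).1 = 0 := by
  have hc := h.mem_target hp
  have h0 : ∀ T : Base ke kx →L[ℝ] Base ke kx, transp T 0 = 0 := fun T => map_zero (transpLin T)
  rw [fst_eq_zero_iff_isStab h1, fst_eq_zero_iff_isStab h2]
  constructor
  · rintro ⟨a, ha, hst⟩
    refine ⟨_, fun h3 => ha ?_, (h.isStab_iff hp a).1 hst⟩
    rw [← h.invTransp_transp hc a, h3]
    exact h0 _
  · rintro ⟨b, hb, hst⟩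
    refine ⟨invTransp ψ B C (Q (ψ p)) b, fun h3 => hb ?_, ?_⟩
    · rw [← h.transp_invTransp hc b, h3]
      exact h0 _
    · rw [h.isStab_iff hp, h.transp_invTransp hc]
      exact hst

theorem dot_C_sub (h : Conjugates ψ B C) {c c' : Base ke kx} (hc : c ∈ Q '' ψ.target)
    (hc' : c' ∈ Q '' ψ.target) {a : Base ke kx} (ha : IsInt a) :
    dot a c - dot a c' = dot (invTransp ψ B C c' a) (B c - B c') := by
  have h1 := h.dot_B_sub hc hc' (h.isInt_invTransp hc' ha)
  rw [h.transp_invTransp hc', ← map_sub, map_sub (dot a)] at h1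
  exact h1.symm

/-- The elliptic rows of the Jacobians of `B` and of its inverse at a critical value are
nonnegative, as both maps preserve the quadrant; hence they are permutation matrices. -/
theorem exists_perm (h : Conjugates ψ B C) {p₀ : Model ke kx} (hp₀ : p₀ ∈ ψ.source)
    (hcr : IsCrit p₀) : ∃ σ : Equiv.Perm (Fin ke), ∀ c ∈ Q '' ψ.target, ∀ i,
      transp (jac ψ B c) (ellVec kx i) = ellVec kx (σ i) ∧ (B c).2.2.1 i = c.2.2.1 (σ i) := by
  have hcr' := (h.isCrit_iff hp₀).1 hcr
  set c₀ := Q (ψ p₀) with hc₀def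
  have hc₀ : c₀ ∈ Q '' ψ.target := h.mem_target hp₀
  have hy₀ : B c₀ = Q p₀ := h.eqB p₀ hp₀
  have hz : ∀ j, c₀.2.2.1 j = 0 := fun j => Q_eq_zero_of_eq_zero (by rw [hcr'.2]; rfl)
  have hz' : ∀ j, (B c₀).2.2.1 j = 0 := fun j => by
    rw [hy₀]; exact Q_eq_zero_of_eq_zero (by rw [hcr.2]; rfl)
  have hR : ∀ i, (transp (jac ψ B c₀) (ellVec kx i)).2.1 = 0 ∧
      (transp (jac ψ B c₀) (ellVec kx i)).2.2.2 = 0 ∧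
      ∀ j, 0 ≤ (transp (jac ψ B c₀) (ellVec kx i)).2.2.1 j := by
    intro i
    refine (h.relOpen_target.of_dot_nonneg hc₀ fun c hc => ?_).2
    rw [← h.dot_B_sub hc hc₀ (isInt_ellVec i), dot_ellVec, dot_ellVec, hz', sub_zero]
    exact h.relOpen_source.subset (h.mapsTo_B hc) i
  have hR' : ∀ i, (invTransp ψ B C c₀ (ellVec kx i)).2.1 = 0 ∧
      (invTransp ψ B C c₀ (ellVec kx i)).2.2.2 = 0 ∧
      ∀ j, 0 ≤ (invTransp ψ B C c₀ (ellVec kx i)).2.2.1 j := by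
    intro i
    refine (h.relOpen_source.of_dot_nonneg (h.mapsTo_B hc₀) fun y hy => ?_).2
    have h1 := h.mapsTo_C hy
    have h2 := h.dot_C_sub h1 hc₀ (isInt_ellVec i)
    rw [h.B_C y hy] at h2
    rw [← h2, dot_ellVec, dot_ellVec, hz, sub_zero]
    exact h.relOpen_target.subset h1 i
  choose E hE using fun i j => (h.isInt_transp hc₀ (isInt_ellVec i)).2.2.1 j
  choose E' hE' using fun i j => (h.isInt_invTransp hc₀ (isInt_ellVec i)).2.2.1 j
  have hRE : ∀ i, transp (jac ψ B c₀) (ellVec kx i) = ∑ j, (E i j : ℝ) • ellVec kx j := by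
    intro i
    have := sum_ellCoord_smul (transp (jac ψ B c₀) (ellVec kx i))
    simp only [← hE] at this
    rw [this]
    refine Prod.ext (h.isInt_transp hc₀ (isInt_ellVec i)).1 (Prod.ext (hR i).1
      (Prod.ext (funext fun j => hE i j ▸ rfl) (hR i).2.1))
  have hmul : Matrix.of E * Matrix.of E' = 1 := by
    ext i k
    have h1 := h.invTransp_transp hc₀ (ellVec kx i)
    rw [hRE] at h1
    change transpLin _ _ = _ at h1
    simp only [map_sum, map_smul] at h1
    have h2 := congrArg (fun v => dot v (ellVec kx k)) h1
    simp only [dot_comm _ (ellVec kx k), map_sum, map_smul, dot_ellVec, smul_eq_mul] at h2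
    have h3 : ∀ j, (transpLin (fderivWithin ℝ C (Q '' ψ.source) (B c₀)) (ellVec kx j)).2.2.1 k
        = (E' j k : ℝ) := fun j => (hE' j k).symm
    simp only [h3] at h2
    rw [Matrix.mul_apply, Matrix.one_apply]
    have h4 : ((∑ j, Matrix.of E i j * Matrix.of E' j k : ℤ) : ℝ)
        = ((if i = k then 1 else 0 : ℤ) : ℝ) := by
      push_cast
      simp only [Matrix.of_apply]
      rw [h2]
      simp [ellVec, Pi.single_apply, eq_comm]
    exact_mod_cast h4
  obtain ⟨σ, hσ⟩ := exists_perm_of_nonneg (E := Matrix.of E) (E' := Matrix.of E')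
    (fun i j => by have := (hR i).2.2 j; rw [← hE] at this; exact_mod_cast this)
    (fun i j => by have := (hR' i).2.2 j; rw [← hE'] at this; exact_mod_cast this) hmul
  have hrow : ∀ i, transp (jac ψ B c₀) (ellVec kx i) = ellVec kx (σ i) := by
    intro i
    have hσ' : ∀ j, E i j = if j = σ i then 1 else 0 := hσ i
    rw [hRE]
    simp [hσ']
  refine ⟨σ, fun c hc i => ⟨by rw [h.transp_eq hc hc₀ (isInt_ellVec i), hrow], ?_⟩⟩
  have h1 := h.dot_B_sub hc hc₀ (isInt_ellVec i)
  rw [hrow, dot_ellVec, dot_ellVec, dot_ellVec, hz', sub_zero] at h1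
  rw [h1]
  simp [hz]

end Conjugates

/-! ### The rows of the Jacobian below the first one -/

theorem focus_eq_zero_iff {c : Base ke kx} : focus c = 0 ↔ c.1 = 0 ∧ c.2.1 = 0 :=
  Complex.ext_iff

/-- The point of the cover with focus-focus coordinates `z`, with nonnegative real elliptic
coordinates and actions given by `y`, and with the angles of `X`. -/
def adapted (X : Cover ke kx) (z : ℂ × ℂ) (y : Base ke kx) : Cover ke kx :=
  (z, fun j => (√(2 * y.2.2.1 j) : ℂ), X.2.2.1, y.2.2.2)

theorem Q_proj_adapted (X : Cover ke kx) {z : ℂ × ℂ} {y : Base ke kx} (hy : y ∈ quadrant ke kx)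
    (hz : focus y = starRingEnd ℂ z.1 * z.2) : Q (proj (adapted X z y)) = y := by
  refine Q_eq_iff.2 ⟨by rw [hz]; rfl, fun j => ?_, rfl⟩
  have := hy j
  simp only [proj, adapted, Complex.ofReal_re, Complex.ofReal_im]
  rw [Real.sq_sqrt (by positivity)]
  ring

theorem proj_adapted_of_isCrit {X : Cover ke kx} (hX : IsCrit (proj X)) :
    proj (adapted X 0 (Q (proj X))) = proj X := by
  have hz : ∀ j, (Q (proj X)).2.2.1 j = 0 := fun j => Q_eq_zero_of_eq_zero (by rw [hX.2]; rfl)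
  refine Prod.ext hX.1.symm (Prod.ext ?_ (Prod.ext rfl rfl))
  rw [hX.2]
  funext j
  simp only [proj, adapted] at hz ⊢
  simp [hz]

theorem exists_adapted_mem {U : Set (Model ke kx)} (hU : IsOpen U) {X : Cover ke kx}
    (hX : IsCrit (proj X)) (hXU : proj X ∈ U) : ∃ δ > 0, ∃ ρ > 0,
      ∀ y ∈ Metric.ball (Q (proj X)) ρ, ∀ z : ℂ × ℂ, ‖z‖ ≤ δ → proj (adapted X z y) ∈ U := by
  have hc : Continuous (fun p : Base ke kx × (ℂ × ℂ) => proj (adapted X p.2 p.1)) := by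
    refine continuous_proj.comp ?_
    unfold adapted
    fun_prop
  obtain ⟨ρ, hρ, hball⟩ := Metric.isOpen_iff.1 (hU.preimage hc) (Q (proj X), 0) (by
    rw [mem_preimage, proj_adapted_of_isCrit hX]; exact hXU)
  refine ⟨ρ / 2, by positivity, ρ, hρ, fun y hy z hz => hball (a := (y, z)) ?_⟩
  rw [← ball_prod_same]
  exact ⟨hy, by rw [mem_ball_zero_iff]; linarith⟩

namespace Conjugates

variable {ψ : OpenPartialHomeomorph (Model ke kx) (Model ke kx)} {B C : Base ke kx → Base ke kx}

/-- Near a critical value, `B` preserves the set of focus-focus values. Off the boundary of the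
quadrant this follows from `fst_eq_zero_iff`, and it extends by continuity. -/
theorem exists_ball_focus (h : Conjugates ψ B C) {p₀ : Model ke kx} (hp₀ : p₀ ∈ ψ.source)
    (hcr : IsCrit p₀) : ∃ ρ > 0, ∀ c ∈ quadrant ke kx ∩ Metric.ball (Q (ψ p₀)) ρ, focus c = 0 →
      c ∈ Q '' ψ.target ∧ focus (B c) = 0 := by
  have hcr' := (h.isCrit_iff hp₀).1 hcr
  obtain ⟨σ, hσ⟩ := h.exists_perm hp₀ hcr
  obtain ⟨X, hX⟩ := proj_surjective (ψ p₀)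
  set c₀ := Q (ψ p₀) with hc₀
  let S : Base ke kx → Cover ke kx := adapted X 0
  have hS0 : proj (S c₀) = ψ p₀ := by
    simp only [S, hc₀]
    rw [← hX] at hcr' ⊢
    exact proj_adapted_of_isCrit hcr'
  have hQS : ∀ c ∈ quadrant ke kx, focus c = 0 → Q (proj (S c)) = c := fun c hc hf =>
    Q_proj_adapted X hc (by rw [hf]; simp)
  have hS : Continuous fun c => proj (S c) := by
    refine continuous_proj.comp ?_
    simp only [S]
    unfold adapted
    fun_prop
  obtain ⟨ρ, hρ, hball⟩ := Metric.isOpen_iff.1 (ψ.open_target.preimage hS) c₀ (by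
    rw [mem_preimage, hS0]; exact ψ.map_source hp₀)
  have hmem : ∀ c ∈ quadrant ke kx ∩ Metric.ball c₀ ρ, focus c = 0 → c ∈ Q '' ψ.target :=
    fun c hc hf => ⟨_, hball hc.2, hQS c hc.1 hf⟩
  have hint : ∀ c ∈ openQuadrant ke kx ∩ Metric.ball c₀ ρ, focus c = 0 → focus (B c) = 0 := by
    rintro c ⟨hcq, hcb⟩ hf
    have hV : proj (S c) ∈ ψ.target := hball hcb
    have hQc := hQS c (openQuadrant_subset hcq) hf
    have hp := ψ.map_target hV
    have hQp : Q (ψ.symm (proj (S c))) = B c := by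
      rw [← h.eqB _ hp, ψ.right_inv hV, hQc]
    have h1 := (h.fst_eq_zero_iff hp (fun j => ne_zero_of_Q_pos (by
        rw [hQp, (hσ c (hmem c ⟨openQuadrant_subset hcq, hcb⟩ hf) j).2]; exact hcq _))
      (fun j => ne_zero_of_Q_pos (by rw [ψ.right_inv hV, hQc]; exact hcq j))).2 (by
        rw [ψ.right_inv hV]; rfl)
    rw [← hQp, focus_Q, h1]
    simp
  refine ⟨ρ, hρ, fun c hc hf => ⟨hmem c hc hf, ?_⟩⟩
  have h1 := tendsto_add_smul c (diag ke kx)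
  have hft : ∀ t : ℝ, focus (c + t • diag ke kx) = 0 := by
    intro t
    rw [focus_eq_zero_iff] at hf ⊢
    simp [diag, hf.1, hf.2]
  have hev : ∀ᶠ t : ℝ in 𝓝[>] 0, c + t • diag ke kx ∈ openQuadrant ke kx ∩ Metric.ball c₀ ρ := by
    filter_upwards [h1.eventually_mem (Metric.isOpen_ball.mem_nhds hc.2), self_mem_nhdsWithin]
      with t h2 h3
    exact ⟨add_smul_diag_mem hc.1 h3, h2⟩
  have h2 : Tendsto (fun t : ℝ => focus (B (c + t • diag ke kx))) (𝓝[>] 0) (𝓝 (focus (B c))) := by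
    refine (contDiff_focus.continuous.tendsto _).comp ?_
    refine (h.smoothB.continuousOn c (hmem c hc hf)).tendsto.comp
      (tendsto_nhdsWithin_iff.2 ⟨h1, ?_⟩)
    filter_upwards [hev] with t ht
    exact hmem _ ⟨openQuadrant_subset ht.1, ht.2⟩ (hft t)
  refine tendsto_nhds_unique h2 (tendsto_const_nhds.congr' ?_)
  filter_upwards [hev] with t ht
  exact (hint _ ht (hft t)).symm

/-- The `q₂`-row of the Jacobian of `B` is `(0, ±1, 0, 0)`: this row is integral, and it vanishes on
the focus-focus directions because `B` preserves the focus-focus values. -/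
theorem exists_e₂_row (h : Conjugates ψ B C) {p₀ : Model ke kx} (hp₀ : p₀ ∈ ψ.source)
    (hcr : IsCrit p₀) : ∃ ε : ℤˣ, ∀ c ∈ Q '' ψ.target,
      transp (jac ψ B c) (0, 1, 0, 0) = ((ε : ℤ) : ℝ) • ((0, 1, 0, 0) : Base ke kx) ∧
        (B c).2.1 = ((ε : ℤ) : ℝ) * c.2.1 := by
  have hcr' := (h.isCrit_iff hp₀).1 hcr
  obtain ⟨ρ, hρ, hball⟩ := h.exists_ball_focus hp₀ hcr
  set c₀ := Q (ψ p₀) with hc₀def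
  have hc₀ : c₀ ∈ Q '' ψ.target := h.mem_target hp₀
  have hf₀ : focus c₀ = 0 := by rw [hc₀def, focus_Q, hcr'.1]; simp
  have hz : ∀ j, c₀.2.2.1 j = 0 := fun j => Q_eq_zero_of_eq_zero (by rw [hcr'.2]; rfl)
  set r := transp (jac ψ B c₀) ((0, 1, 0, 0) : Base ke kx) with hr
  have hB₀ := (hball c₀ ⟨Q_mem _, Metric.mem_ball_self hρ⟩ hf₀).2
  have key : ∀ v ∈ quadrant ke kx, focus v = 0 → dot r v = 0 := by
    intro v hv hfv
    have h1 := tendsto_add_smul c₀ v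
    obtain ⟨t, ht, ht0⟩ := ((h1.eventually_mem (Metric.ball_mem_nhds c₀ hρ)).and
      self_mem_nhdsWithin).exists
    have ht0 : 0 < t := ht0
    have hq : c₀ + t • v ∈ quadrant ke kx := fun j => by
      have h4 := hv j
      simp only [Prod.snd_add, Prod.fst_add, Prod.smul_snd, Prod.smul_fst, Pi.add_apply,
        Pi.smul_apply, smul_eq_mul, hz]
      positivity
    have hfc : focus (c₀ + t • v) = 0 := by
      rw [focus_eq_zero_iff] at hfv hf₀ ⊢
      simp [hfv.1, hfv.2, hf₀.1, hf₀.2]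
    obtain ⟨h2, h3⟩ := hball _ ⟨hq, ht⟩ hfc
    have h4 := h.dot_B_sub h2 hc₀ isInt_e₂
    rw [dot_e₂, dot_e₂, (focus_eq_zero_iff.1 h3).2, (focus_eq_zero_iff.1 hB₀).2, sub_zero,
      add_sub_cancel_left, map_smul, smul_eq_mul] at h4
    exact (mul_eq_zero.1 h4.symm).resolve_left ht0.ne'
  have hr1 : r = r.2.1 • (0, 1, 0, 0) := by
    refine Prod.ext ?_ (Prod.ext ?_ (Prod.ext (funext fun j => ?_) (funext fun l => ?_)))
    · simpa using (h.isInt_transp hc₀ isInt_e₂).1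
    · simp
    · have := key (ellVec kx j) (fun i => by by_cases hij : i = j <;> simp [ellVec, hij])
        (by simp [focus_eq_zero_iff, ellVec])
      rw [dot_comm, dot_ellVec] at this
      simpa using this
    · have := key (trVec ke l) (fun i => by simp [trVec]) (by simp [focus_eq_zero_iff, trVec])
      rw [dot_comm, dot_trVec] at this
      simpa using this
  obtain ⟨n, hn⟩ := (h.isInt_transp hc₀ isInt_e₂).2.1
  obtain ⟨m, hm⟩ := (h.isInt_invTransp hc₀ isInt_e₂).2.1
  have hmn : m * n = 1 := by
    have h1 := h.invTransp_transp hc₀ (0, 1, 0, 0)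
    rw [← hr, hr1] at h1
    change transpLin _ _ = _ at h1
    rw [map_smul] at h1
    have h2 : r.2.1 * (invTransp ψ B C c₀ (0, 1, 0, 0)).2.1 = 1 := congrArg (fun v => v.2.1) h1
    rw [← hm, ← hn] at h2
    have h3 : (n : ℝ) * m = 1 := h2
    rw [mul_comm]
    exact_mod_cast h3
  obtain ⟨ε, hε⟩ : ∃ ε : ℤˣ, (ε : ℤ) = n := Int.isUnit_iff.2 (by
    rcases Int.mul_eq_one_iff_eq_one_or_neg_one.1 hmn with h1 | h1
    · exact Or.inl h1.2
    · exact Or.inr h1.2)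
  have hrow : r = ((ε : ℤ) : ℝ) • ((0, 1, 0, 0) : Base ke kx) := by
    rw [hε, hn]; exact hr1
  refine ⟨ε, fun c hc => ⟨by rw [h.transp_eq hc hc₀ isInt_e₂, ← hr, hrow], ?_⟩⟩
  have h1 := h.dot_B_sub hc hc₀ isInt_e₂
  rw [← hr, hrow, dot_smul_left, dot_e₂, dot_e₂, dot_e₂, (focus_eq_zero_iff.1 hB₀).2,
    sub_zero] at h1
  rw [h1]
  simp [(focus_eq_zero_iff.1 hf₀).2]

/-- The transverse rows of the Jacobian of `B` are integral and constant. Their transverse block is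
invertible, since the rows of the inverse have the same triangular shape. -/
theorem exists_tr_rows (h : Conjugates ψ B C) {p₀ : Model ke kx} (hp₀ : p₀ ∈ ψ.source)
    (hcr : IsCrit p₀) : ∃ (Xf : Fin kx → ℤ) (Xe : Matrix (Fin kx) (Fin ke) ℤ)
      (Xx : Matrix.GeneralLinearGroup (Fin kx) ℤ), ∀ c ∈ Q '' ψ.target, ∀ l,
      transp (jac ψ B c) (trVec ke l) = (0, (Xf l : ℝ), fun j => (Xe l j : ℝ),
        fun m => ((Xx : Matrix (Fin kx) (Fin kx) ℤ) l m : ℝ)) := by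
  obtain ⟨σ, hσ⟩ := h.exists_perm hp₀ hcr
  obtain ⟨ε, hε⟩ := h.exists_e₂_row hp₀ hcr
  set c₀ := Q (ψ p₀) with hc₀def
  have hc₀ : c₀ ∈ Q '' ψ.target := h.mem_target hp₀
  choose Xf hXf using fun l => (h.isInt_transp hc₀ (isInt_trVec l)).2.1
  choose Xe hXe using fun l j => (h.isInt_transp hc₀ (isInt_trVec l)).2.2.1 j
  choose Xx hXx using fun l m => (h.isInt_transp hc₀ (isInt_trVec l)).2.2.2 m
  choose Y hY using fun l m => (h.isInt_invTransp hc₀ (isInt_trVec l)).2.2.2 m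
  have hmul : Matrix.of Y * Matrix.of Xx = 1 := by
    ext l k
    have h1 := h.transp_invTransp hc₀ (trVec ke l)
    rw [eq_sum_basis (invTransp ψ B C c₀ (trVec ke l)),
      (h.isInt_invTransp hc₀ (isInt_trVec l)).1] at h1
    change transpLin _ _ = _ at h1
    simp only [map_add, map_sum, map_smul] at h1
    have h2 := congrArg (fun v => dot v (trVec ke k)) h1
    simp only [dot_comm _ (trVec ke k), map_add, map_sum, map_smul, dot_trVec, smul_eq_mul] at h2
    have h3 : ∀ m, (transpLin (jac ψ B c₀) (trVec ke m)).2.2.2 k = (Xx m k : ℝ) :=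
      fun m => (hXx m k).symm
    have h4 : ∀ j, (transpLin (jac ψ B c₀) (ellVec kx j)).2.2.2 k = 0 := fun j =>
      (congrArg (fun v : Base ke kx => v.2.2.2 k) (hσ c₀ hc₀ j).1).trans rfl
    have h5 : (transpLin (jac ψ B c₀) (0, 1, 0, 0)).2.2.2 k = 0 :=
      (congrArg (fun v : Base ke kx => v.2.2.2 k) (hε c₀ hc₀).1).trans (by simp)
    simp only [h3, h4, h5, ← hY] at h2
    simp only [zero_mul, mul_zero, Finset.sum_const_zero, zero_add, add_zero] at h2
    rw [Matrix.mul_apply, Matrix.one_apply]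
    have h6 : ((∑ j, Matrix.of Y l j * Matrix.of Xx j k : ℤ) : ℝ)
        = ((if l = k then 1 else 0 : ℤ) : ℝ) := by
      push_cast
      simp only [Matrix.of_apply]
      rw [h2]
      simp [trVec, Pi.single_apply, eq_comm]
    exact_mod_cast h6
  refine ⟨Xf, Xe, ⟨Matrix.of Xx, Matrix.of Y, mul_eq_one_comm.1 hmul, hmul⟩, fun c hc l => ?_⟩
  rw [h.transp_eq hc hc₀ (isInt_trVec l)]
  refine Prod.ext (h.isInt_transp hc₀ (isInt_trVec l)).1 (Prod.ext (hXf l).symm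
    (Prod.ext (funext fun j => (hXe l j).symm) (funext fun m => (hXx l m).symm)))

/-- The lower rows of `B` are affine with integral linear part. -/
theorem exists_lowerRows (h : Conjugates ψ B C) {p₀ : Model ke kx} (hp₀ : p₀ ∈ ψ.source)
    (hcr : IsCrit p₀) : ∃ (ε₂ : ℤˣ) (σ : Equiv.Perm (Fin ke)) (Xf : Fin kx → ℤ)
      (Xe : Matrix (Fin kx) (Fin ke) ℤ) (Xx : Matrix.GeneralLinearGroup (Fin kx) ℤ)
      (κ : Fin kx → ℝ), ∀ c ∈ Q '' ψ.target,
        (B c).2 = lowerRows ε₂ (fun _ => 1) σ Xf Xe Xx c + (0, 0, κ) := by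
  obtain ⟨σ, hσ⟩ := h.exists_perm hp₀ hcr
  obtain ⟨ε, hε⟩ := h.exists_e₂_row hp₀ hcr
  obtain ⟨Xf, Xe, Xx, hX⟩ := h.exists_tr_rows hp₀ hcr
  have hc₀ : Q (ψ p₀) ∈ Q '' ψ.target := h.mem_target hp₀
  refine ⟨ε, σ, Xf, Xe, Xx, fun l => (B (Q (ψ p₀))).2.2.2 l
    - (lowerRows ε (fun _ => 1) σ Xf Xe Xx (Q (ψ p₀))).2.2 l, fun c hc => ?_⟩
  refine Prod.ext ?_ (Prod.ext (funext fun i => ?_) (funext fun l => ?_))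
  · simpa [lowerRows] using (hε c hc).2
  · simpa [lowerRows] using (hσ c hc i).2
  · have h1 := h.dot_B_sub hc hc₀ (isInt_trVec l)
    rw [hX _ hc₀ l, map_sub, dot_trVec, dot_trVec] at h1
    simp only [dot_apply, zero_mul, zero_add] at h1
    simp only [lowerRows, Prod.snd_add, Pi.add_apply]
    linarith

end Conjugates

/-! ### The first row of the Jacobian near a critical value -/

theorem flow_proj_adapted (X : Cover ke kx) (τ θ t : ℝ) (z : ℂ × ℂ) (y : Base ke kx) :
    flow (τ, θ, 0, 0) t (proj (adapted X z y)) = proj (adapted X (Complex.exp (t * ⟨τ, θ⟩) * z.1,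
      Complex.exp (t * -starRingEnd ℂ ⟨τ, θ⟩) * z.2) y) := by
  refine Prod.ext rfl (Prod.ext (funext fun j => ?_) (Prod.ext (funext fun l => ?_) rfl)) <;>
    simp [flow, proj, adapted]

namespace Conjugates

variable {ψ : OpenPartialHomeomorph (Model ke kx) (Model ke kx)} {B C : Base ke kx → Base ke kx}

/-- The derivatives of the first component of `B` in the directions of `q₁` and `q₂`, as the real
and imaginary parts of a complex number. -/
def firstRow (ψ : OpenPartialHomeomorph (Model ke kx) (Model ke kx)) (B : Base ke kx → Base ke kx)
    (c : Base ke kx) : ℂ := ⟨(jac ψ B c (1, 0, 0, 0)).1, (jac ψ B c (0, 1, 0, 0)).1⟩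

theorem contDiffOn_firstRow (h : Conjugates ψ B C) :
    ContDiffOn ℝ ∞ (firstRow ψ B) (Q '' ψ.target) := by
  have h1 : ContDiffOn ℝ ∞ (jac ψ B) (Q '' ψ.target) :=
    h.smoothB.fderivWithin h.relOpen_target.uniqueDiffOn (by simp)
  have h2 : ∀ v : Base ke kx, ContDiffOn ℝ ∞ (fun c => (jac ψ B c v).1) (Q '' ψ.target) :=
    fun v => contDiff_fst.comp_contDiffOn (h1.clm_apply contDiffOn_const)
  exact Complex.equivRealProdCLM.symm.contDiff.comp_contDiffOn
    ((h2 (1, 0, 0, 0)).prodMk (h2 (0, 1, 0, 0)))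

theorem focus_transp {c : Base ke kx} {ε : ℝ}
    (hε : transp (jac ψ B c) (0, 1, 0, 0) = ε • ((0, 1, 0, 0) : Base ke kx)) (τ θ : ℝ) :
    focus (transp (jac ψ B c) (τ, θ, 0, 0)) = τ * firstRow ψ B c + ε * θ * Complex.I := by
  have h1 : ((τ, θ, 0, 0) : Base ke kx) = τ • (1, 0, 0, 0) + θ • (0, 1, 0, 0) := by simp
  have h2 : transp (jac ψ B c) (τ, θ, 0, 0) = τ • transp (jac ψ B c) (1, 0, 0, 0)
      + θ • transp (jac ψ B c) (0, 1, 0, 0) := by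
    rw [h1]
    change transpLin _ _ = _
    rw [map_add, map_smul, map_smul]
    rfl
  have h3 : ∀ v : Base ke kx, dot (1, 0, 0, 0) v = v.1 := fun v => by simp [dot_apply]
  rw [h2, hε]
  apply Complex.ext
  · simp [focus, transp, h3, firstRow]
  · simp [focus, transp, h3, firstRow]
    ring

theorem fst_eq_zero_iff_of_isCrit (h : Conjugates ψ B C) {p₀ : Model ke kx} (hp₀ : p₀ ∈ ψ.source)
    (hcr : IsCrit p₀) {p : Model ke kx} (hp : p ∈ ψ.source) (hpe : ∀ j, p.2.1 j ≠ 0) :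
    p.1 = 0 ↔ (ψ p).1 = 0 := by
  obtain ⟨σ, hσ⟩ := h.exists_perm hp₀ hcr
  refine h.fst_eq_zero_iff hp hpe fun j => ne_zero_of_Q_pos ?_
  have h1 := (hσ _ (h.mem_target hp) (σ.symm j)).2
  rw [h.eqB p hp, Equiv.apply_symm_apply] at h1
  rw [← h1]
  exact Q_pos_of_ne_zero (hpe _)

/-- Along a ray issued from a focus-focus value with regular elliptic part, the first row of the
Jacobian of `B` has a flat deviation from `(±1, 0)`. Two points of the fibre over `r e`, close to
the two sheets of the singular fibre, are joined by a flow whose time is logarithmic in `r`; so are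
their images, which forces the power of `r` in this relation to be `±1`. -/
theorem exists_ball_flat_ray (h : Conjugates ψ B C) {p₀ : Model ke kx} (hp₀ : p₀ ∈ ψ.source)
    (hcr : IsCrit p₀) {ε₁ : ℤˣ}
    (hε₁ : ∀ c ∈ Q '' ψ.target, 0 < ((ε₁ : ℤ) : ℝ) * (firstRow ψ B c).re) :
    ∃ ρ > 0, ∀ y ∈ openQuadrant ke kx ∩ Metric.ball (Q p₀) ρ, focus y = 0 → ∀ e : ℂ, e.im ≠ 0 →
      ∀ N : ℕ, ∃ K : ℝ, ∀ᶠ r : ℝ in 𝓝[>] 0,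
        ‖firstRow ψ B (C (y + r • (e.re, e.im, 0, 0))) - ((ε₁ : ℤ) : ℂ)‖ ≤ K * r ^ N := by
  obtain ⟨ε₂, hε₂⟩ := h.exists_e₂_row hp₀ hcr
  obtain ⟨X, rfl⟩ := proj_surjective p₀
  obtain ⟨δ, hδ, ρ, hρ, hmem⟩ := exists_adapted_mem ψ.open_source hcr hp₀
  refine ⟨ρ, hρ, fun y ⟨hyq, hyρ⟩ hfy e he => ?_⟩
  have he0 : e ≠ 0 := fun h => he (by rw [h, Complex.zero_im])
  have hδc : (δ : ℂ) ≠ 0 := Complex.ofReal_ne_zero.2 hδ.ne'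
  have hyell : ∀ (z : ℂ × ℂ) j, (proj (adapted X z y)).2.1 j ≠ 0 := fun z j => by
    have := hyq j
    simp only [proj, adapted, ne_eq, Complex.ofReal_eq_zero]
    positivity
  let v : Base ke kx := (e.re, e.im, 0, 0)
  -- the time-one flow of `log r + l` joins the two points of the fibre over `r e` chosen below
  let l : ℂ := Complex.log (starRingEnd ℂ e / δ ^ 2)
  have hl : Complex.exp l = starRingEnd ℂ e / δ ^ 2 :=
    Complex.exp_log (div_ne_zero ((map_ne_zero _).2 he0) (pow_ne_zero 2 hδc))
  let O : Set ℝ := {r | ‖(r : ℂ) * e‖ < δ ^ 2}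
  have hO : IsOpen O := isOpen_lt (by fun_prop) continuous_const
  have h0O : (0 : ℝ) ∈ O := by simp only [O, mem_ofPred_eq]; simpa using by positivity
  -- one point of the fibre near each of the two sheets of the singular fibre
  let Z : ℝ → ℂ × ℂ := fun r => (δ, r * e / δ)
  let Z' : ℝ → ℂ × ℂ := fun r => (r * starRingEnd ℂ e / δ, δ)
  have hsmall : ∀ r ∈ O, ‖(r : ℂ) * e / δ‖ ≤ δ := fun r hr => by
    have hr : ‖(r : ℂ) * e‖ < δ ^ 2 := hr
    rw [norm_div, Complex.norm_real, Real.norm_of_nonneg hδ.le, div_le_iff₀ hδ]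
    nlinarith
  have hδn : ‖(δ : ℂ)‖ ≤ δ := by rw [Complex.norm_real, Real.norm_of_nonneg hδ.le]
  have hZU : ∀ r ∈ O, proj (adapted X (Z r) y) ∈ ψ.source := fun r hr =>
    hmem y hyρ _ (max_le hδn (hsmall r hr))
  have hZ'U : ∀ r ∈ O, proj (adapted X (Z' r) y) ∈ ψ.source := fun r hr =>
    hmem y hyρ _ (max_le (by
      have := hsmall r hr
      rw [norm_div, norm_mul] at this
      rwa [norm_div, norm_mul, RCLike.norm_conj]) hδn)
  have hvq : ∀ r : ℝ, y + r • v ∈ quadrant ke kx := fun r j => by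
    simpa [v] using (hyq j).le
  have hfv : ∀ r : ℝ, focus (y + r • v) = r * e := fun r => by
    rw [focus_eq_zero_iff] at hfy
    apply Complex.ext <;> simp [focus, v, hfy]
  have hrad : ∀ (r : ℝ) z, adapted X z (y + r • v) = adapted X z y := fun r z => by
    simp [adapted, v]
  have hQZ : ∀ r : ℝ, Q (proj (adapted X (Z r) y)) = y + r • v := fun r => by
    rw [← hrad r]
    refine Q_proj_adapted X (hvq r) ?_
    rw [hfv, Complex.conj_ofReal, mul_div_cancel₀ _ hδc]
  have hQZ' : ∀ r : ℝ, Q (proj (adapted X (Z' r) y)) = y + r • v := fun r => by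
    rw [← hrad r]
    refine Q_proj_adapted X (hvq r) ?_
    simp only [Z', map_div₀, map_mul, Complex.conj_ofReal, Complex.conj_conj]
    rw [hfv, div_mul_cancel₀ _ hδc]
  have hCmem : ∀ r ∈ O, y + r • v ∈ Q '' ψ.source := fun r hr => ⟨_, hZU r hr, hQZ r⟩
  have hZs : ContDiff ℝ ∞ (fun r => adapted X (Z r) y) := by
    refine ContDiff.prodMk (ContDiff.prodMk contDiff_const ?_) contDiff_const
    exact (Complex.ofRealCLM.contDiff.mul contDiff_const).div_const _
  have hZ's : ContDiff ℝ ∞ (fun r => adapted X (Z' r) y) := by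
    refine ContDiff.prodMk (ContDiff.prodMk ?_ contDiff_const) contDiff_const
    exact (Complex.ofRealCLM.contDiff.mul contDiff_const).div_const _
  have hs1 : ContDiffOn ℝ ∞ (fun x => (ψ (proj x)).1.1) (proj ⁻¹' ψ.source) :=
    contDiffOn_comp_proj (g := fun p => p.1.1) h.symp.1 (contDiff_fst.comp contDiff_fst)
  have hs2 : ContDiffOn ℝ ∞ (fun x => (ψ (proj x)).1.2) (proj ⁻¹' ψ.source) :=
    contDiffOn_comp_proj (g := fun p => p.1.2) h.symp.1 (contDiff_snd.comp contDiff_fst)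
  have hCs : ContDiffOn ℝ ∞ (fun r : ℝ => C (y + r • v)) O :=
    h.smoothC.comp (contDiff_const.add (contDiff_id.smul contDiff_const)).contDiffOn hCmem
  have hgs : ContDiffOn ℝ ∞ (fun r : ℝ => firstRow ψ B (C (y + r • v))) O :=
    h.contDiffOn_firstRow.comp hCs fun r hr => h.mapsTo_C (hCmem r hr)
  have hF0 : focus (C (y + (0 : ℝ) • v)) = 0 := by
    have h1 := hmem y hyρ 0 (by simpa using hδ.le)
    have h2 := (h.fst_eq_zero_iff_of_isCrit hp₀ hcr h1 (hyell 0)).1 rfl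
    have h3 : Q (proj (adapted X 0 y)) = y := Q_proj_adapted X (openQuadrant_subset hyq) (by
      rw [hfy]; simp)
    rw [zero_smul, add_zero]
    conv_lhs => rw [← h3]
    rw [h.eqC _ h1, focus_Q, h2]
    simp
  have hne : ∀ {z : ℂ × ℂ}, proj (adapted X z y) ∈ ψ.source → z ≠ 0 →
      (ψ (proj (adapted X z y))).1.1 ≠ 0 ∨ (ψ (proj (adapted X z y))).1.2 ≠ 0 := by
    intro z hz hz0
    by_contra! hc
    exact hz0 ((h.fst_eq_zero_iff_of_isCrit hp₀ hcr hz (hyell z)).2 (Prod.ext hc.1 hc.2))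
  have him : ∀ r ∈ O, (focus (C (y + r • v))).im = r * (((ε₂ : ℤ) : ℝ) * e.im) := fun r hr => by
    have h1 := (hε₂ _ (h.mapsTo_C (hCmem r hr))).2
    rw [h.B_C _ (hCmem r hr)] at h1
    have h2 : (y + r • v).2.1 = r * e.im := by
      rw [focus_eq_zero_iff] at hfy
      simp [v, hfy.2]
    have h3 : ((ε₂ : ℤ) : ℝ) * ((ε₂ : ℤ) : ℝ) = 1 := by
      rcases Int.units_eq_one_or ε₂ with h | h <;> simp [h]
    rw [h2] at h1
    change (C (y + r • v)).2.1 = _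
    linear_combination (-((ε₂ : ℤ) : ℝ)) * h1 - (C (y + r • v)).2.1 * h3
  have hε₂0 : ((ε₂ : ℤ) : ℝ) ≠ 0 := Int.cast_ne_zero.2 ε₂.ne_zero
  have hg0 : firstRow ψ B (C (y + (0 : ℝ) • v)) ≠ 0 := fun h0 =>
    h.jac_e₁_ne_zero (h.mapsTo_C (hCmem 0 h0O)) (congrArg Complex.re h0)
  obtain ⟨ε, hε, hflat⟩ := exists_unit_flat_sub hO h0O
    (a := fun r => (ψ (proj (adapted X (Z r) y))).1.1)
    (a' := fun r => (ψ (proj (adapted X (Z r) y))).1.2)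
    (b := fun r => (ψ (proj (adapted X (Z' r) y))).1.1)
    (b' := fun r => (ψ (proj (adapted X (Z' r) y))).1.2)
    (F := fun r => focus (C (y + r • v)))
    (g := fun r => firstRow ψ B (C (y + r • v)))
    (E := fun r => Complex.exp
      (l.re * firstRow ψ B (C (y + r • v)) + ((ε₂ : ℤ) : ℝ) * l.im * Complex.I))
    (hs1.comp hZs.contDiffOn hZU) (hs2.comp hZs.contDiffOn hZU)
    (hs1.comp hZ's.contDiffOn hZ'U) (hs2.comp hZ's.contDiffOn hZ'U)
    (contDiff_focus.comp_contDiffOn hCs) hgs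
    ((contDiffOn_const.mul hgs).add contDiffOn_const).cexp
    (fun r hr => by rw [← focus_Q, ← h.eqC _ (hZU r hr), hQZ])
    (fun r hr => by rw [← focus_Q, ← h.eqC _ (hZ'U r hr), hQZ'])
    (hne (hZU 0 h0O) fun h => hδc (congrArg Prod.fst h))
    (hne (hZ'U 0 h0O) fun h => hδc (congrArg Prod.snd h)) hF0
    (mul_ne_zero hε₂0 he) him (Complex.exp_ne_zero _) hg0 (by
      filter_upwards [(hO.eventually_mem h0O).filter_mono nhdsWithin_le_nhds, self_mem_nhdsWithin]
        with r hr (hr0 : 0 < r)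
      have hfoc : (⟨Real.log r + l.re, l.im⟩ : ℂ) = Real.log r + l := by
        apply Complex.ext <;> simp
      have hexp : Complex.exp ⟨Real.log r + l.re, l.im⟩ = r * starRingEnd ℂ e / δ ^ 2 := by
        rw [hfoc, Complex.exp_add, hl, ← Complex.ofReal_exp, Real.exp_log hr0, mul_div_assoc]
      -- along the flow, both coordinates keep a modulus at most `δ`
      have hnexp : Real.exp (Real.log r + l.re) = ‖(r : ℂ) * e‖ / δ ^ 2 := by
        have h1 := congrArg norm hexp
        rw [Complex.norm_exp] at h1
        rw [h1, norm_div, norm_mul, norm_mul, RCLike.norm_conj, norm_pow, Complex.norm_real δ,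
          Real.norm_of_nonneg hδ.le]
      have hneg : Real.log r + l.re ≤ 0 := by
        rw [← Real.exp_le_one_iff, hnexp, div_le_one (by positivity)]
        exact le_of_lt hr
      have hpath : ∀ t ∈ Icc (0 : ℝ) 1,
          flow (Real.log r + l.re, l.im, 0, 0) t (proj (adapted X (Z r) y)) ∈ ψ.source := by
        intro t ht
        rw [flow_proj_adapted]
        refine hmem y hyρ _ (max_le ?_ ?_)
        · rw [norm_mul, Complex.norm_exp, Complex.re_ofReal_mul, Complex.norm_real,
            Real.norm_of_nonneg hδ.le]
          exact mul_le_of_le_one_left hδ.le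
            (Real.exp_le_one_iff.2 (mul_nonpos_of_nonneg_of_nonpos ht.1 hneg))
        · rw [norm_mul, Complex.norm_exp, Complex.re_ofReal_mul, Complex.neg_re, Complex.conj_re]
          have h1 : Real.exp (t * -(Real.log r + l.re)) ≤ Real.exp (-(Real.log r + l.re)) :=
            Real.exp_le_exp.2 (by nlinarith [ht.2])
          have h2 : ‖(r : ℂ) * e / δ‖ = Real.exp (Real.log r + l.re) * δ := by
            rw [hnexp, norm_div, Complex.norm_real δ, Real.norm_of_nonneg hδ.le]
            field_simp
          change _ * ‖(r : ℂ) * e / δ‖ ≤ _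
          rw [h2]
          calc _ ≤ Real.exp (-(Real.log r + l.re)) * (Real.exp (Real.log r + l.re) * δ) := by gcongr
            _ = δ := by rw [← mul_assoc, ← Real.exp_add, neg_add_cancel, Real.exp_zero, one_mul]
      have hend := h.psi_flow _ isPreconnected_Icc (left_mem_Icc.2 zero_le_one) hpath
        (right_mem_Icc.2 zero_le_one)
      have hZZ' : flow (Real.log r + l.re, l.im, 0, 0) 1 (proj (adapted X (Z r) y))
          = proj (adapted X (Z' r) y) := by
        rw [flow_proj_adapted]
        congr 2
        rw [Complex.ofReal_one, one_mul, one_mul, Complex.exp_neg, Complex.exp_conj, hexp]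
        have hrc : (r : ℂ) ≠ 0 := Complex.ofReal_ne_zero.2 hr0.ne'
        refine Prod.ext ?_ ?_
        · simp only [Z, Z']
          field_simp
        · simp only [Z, Z', map_div₀, map_mul, map_pow, Complex.conj_ofReal, Complex.conj_conj]
          field_simp
      rw [hZZ', ← h.eqC _ (hZU r hr), hQZ] at hend
      have hrow := (hε₂ _ (h.mapsTo_C (hCmem r hr))).1
      have h1 := congrArg (fun p => p.1.1) hend
      simp only [flow, focus_transp hrow, Complex.ofReal_one, one_mul] at h1
      rw [h1, ← Complex.exp_add]
      congr 2
      push_cast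
      ring)
  have hεε : ε = ε₁ := by
    have h1 := hε₁ _ (h.mapsTo_C (hCmem 0 h0O))
    have h2 : (firstRow ψ B (C (y + (0 : ℝ) • v))).re = ((ε : ℤ) : ℝ) := by
      have := congrArg Complex.re hε
      rwa [Complex.intCast_re] at this
    rw [h2] at h1
    rcases Int.units_eq_one_or ε with h3 | h3 <;> rcases Int.units_eq_one_or ε₁ with h4 | h4 <;>
      rw [h3, h4] at h1 <;> rw [h3, h4] <;> norm_num at h1
  rw [← hεε]
  exact hflat

end Conjugates

theorem norm_focus_le (c : Base ke kx) : ‖focus c‖ ≤ 2 * ‖c‖ := by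
  have h1 : ‖c.1‖ ≤ ‖c‖ := le_max_left _ _
  have h2 : ‖c.2.1‖ ≤ ‖c‖ := (le_max_left _ _).trans (le_max_right _ _)
  have h3 := Complex.norm_le_abs_re_add_abs_im (focus c)
  rw [Real.norm_eq_abs] at h1 h2
  exact h3.trans (by simp only [focus]; linarith)

theorem focus_sub (c c' : Base ke kx) : focus (c - c') = focus c - focus c' := by
  apply Complex.ext <;> simp [focus]

/-- If `c₀` is focus-focus, scaling the focus-focus coordinates of a point down does not increase
its distance to `c₀`. -/
theorem norm_scale_sub_le {c c₀ : Base ke kx} (h₀ : focus c₀ = 0) {t : ℝ} (ht : t ∈ Icc (0 : ℝ) 1) :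
    ‖((t * c.1, t * c.2.1, c.2.2) : Base ke kx) - c₀‖ ≤ ‖c - c₀‖ := by
  obtain ⟨h1, h2⟩ := focus_eq_zero_iff.1 h₀
  have h3 : ∀ x : ℝ, ‖t * x - 0‖ ≤ ‖x - 0‖ := fun x => by
    rw [sub_zero, sub_zero, norm_mul, Real.norm_of_nonneg ht.1]
    exact mul_le_of_le_one_left (norm_nonneg _) ht.2
  refine max_le ?_ (max_le ?_ ?_)
  · exact (by simpa [h1] using h3 c.1 : ‖t * c.1 - c₀.1‖ ≤ ‖c.1 - c₀.1‖).trans (le_max_left _ _)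
  · exact (by simpa [h2] using h3 c.2.1 : ‖t * c.2.1 - c₀.2.1‖ ≤ ‖c.2.1 - c₀.2.1‖).trans
      ((le_max_left _ _).trans (le_max_right _ _))
  · exact (le_max_right ‖(c - c₀).2.1‖ ‖(c - c₀).2.2‖).trans (le_max_right _ _)

namespace Conjugates

variable {ψ : OpenPartialHomeomorph (Model ke kx) (Model ke kx)} {B C : Base ke kx → Base ke kx}

/-- The partial derivative of the first component of `B` with respect to `q₁` has constant sign. -/
theorem exists_sign (h : Conjugates ψ B C) : ∃ ε₁ : ℤˣ, ∀ c ∈ Q '' ψ.target,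
    0 < ((ε₁ : ℤ) : ℝ) * (firstRow ψ B c).re := by
  have hc : ContinuousOn (fun c => (firstRow ψ B c).re) (Q '' ψ.target) :=
    Complex.continuous_re.comp_continuousOn h.contDiffOn_firstRow.continuousOn
  have hne : ∀ c ∈ Q '' ψ.target, (firstRow ψ B c).re ≠ 0 := fun c hc => h.jac_e₁_ne_zero hc
  have himg := h.isPreconnected_target.image _ hc
  by_cases hpos : ∃ c ∈ Q '' ψ.target, 0 < (firstRow ψ B c).re
  · obtain ⟨c, hcm, hcp⟩ := hpos
    refine ⟨1, fun c' hc' => ?_⟩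
    by_contra! hneg
    simp only [Units.val_one, Int.cast_one, one_mul] at hneg
    obtain ⟨d, hd, hd0⟩ := himg.ordConnected.out ⟨c', hc', rfl⟩ ⟨c, hcm, rfl⟩ ⟨hneg, hcp.le⟩
    exact hne d hd hd0
  · push Not at hpos
    refine ⟨-1, fun c hc => ?_⟩
    have := lt_of_le_of_ne (hpos c hc) (hne c hc)
    simpa using this

/-- Near a critical value, the deviation of the first row of the Jacobian of `B` is bounded by the
powers of the distance to the focus-focus values. For generic points this is the uniform bound of
`exists_forall_ray_norm_le` along the rays of `exists_ball_flat_ray`. -/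
theorem exists_norm_firstRow_le (h : Conjugates ψ B C) {p₀ : Model ke kx} (hp₀ : p₀ ∈ ψ.source)
    (hcr : IsCrit p₀) {ε₁ : ℤˣ}
    (hε₁ : ∀ c ∈ Q '' ψ.target, 0 < ((ε₁ : ℤ) : ℝ) * (firstRow ψ B c).re) (N : ℕ) :
    ∃ K, ∃ ρ > 0, ∀ y ∈ Q '' ψ.source ∩ Metric.ball (Q p₀) ρ,
      ‖firstRow ψ B (C y) - ((ε₁ : ℤ) : ℂ)‖ ≤ K * ‖focus y‖ ^ (N + 1) := by
  set y₀ := Q p₀ with hy₀def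
  have hy₀ : y₀ ∈ Q '' ψ.source := ⟨p₀, hp₀, rfl⟩
  have hf₀ : focus y₀ = 0 := by rw [hy₀def, focus_Q, hcr.1]; simp
  obtain ⟨ρ₁, hρ₁, hray⟩ := h.exists_ball_flat_ray hp₀ hcr hε₁
  have hFs : ContDiffOn ℝ ∞ (fun y => firstRow ψ B (C y) - ((ε₁ : ℤ) : ℂ)) (Q '' ψ.source) :=
    (h.contDiffOn_firstRow.comp h.smoothC h.mapsTo_C).sub contDiffOn_const
  obtain ⟨K, ρ₂, hρ₂, hK⟩ := exists_forall_ray_norm_le h.relOpen_source.uniqueDiffOn hFs hy₀ N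
  obtain ⟨ρ₃, hρ₃, hsub⟩ := h.relOpen_source.exists_ball hy₀
  have hgen : ∀ y ∈ openQuadrant ke kx ∩ Metric.ball y₀ (min ρ₁ (min ρ₂ ρ₃)), y.2.1 ≠ 0 →
      ‖firstRow ψ B (C y) - ((ε₁ : ℤ) : ℂ)‖ ≤ K * ‖focus y‖ ^ (N + 1) := by
    rintro y ⟨hyq, hyb⟩ hy2
    have hf : focus y ≠ 0 := fun h => hy2 (focus_eq_zero_iff.1 h).2
    have hb : 0 < ‖focus y‖ := norm_pos_iff.2 hf
    set e : ℂ := focus y / ‖focus y‖ with he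
    have heim : e.im ≠ 0 := by
      rw [he, Complex.div_ofReal_im]
      exact div_ne_zero hy2 hb.ne'
    have hen : ‖e‖ = 1 := by
      rw [he, norm_div, Complex.norm_real, Real.norm_of_nonneg hb.le, div_self hb.ne']
    let y₁ : Base ke kx := (0, 0, y.2.2)
    have hy₁f : focus y₁ = 0 := focus_eq_zero_iff.2 ⟨rfl, rfl⟩
    have hpt : ∀ r : ℝ, y₁ + r • (e.re, e.im, 0, 0)
        = (r / ‖focus y‖ * y.1, r / ‖focus y‖ * y.2.1, y.2.2) := by
      intro r
      have h1 : e.re = y.1 / ‖focus y‖ := by rw [he, Complex.div_ofReal_re]; rfl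
      have h2 : e.im = y.2.1 / ‖focus y‖ := by rw [he, Complex.div_ofReal_im]; rfl
      rw [h1, h2]
      refine Prod.ext ?_ (Prod.ext ?_ (Prod.ext ?_ ?_)) <;> simp [y₁] <;> ring
    have hdist : ∀ r ∈ Icc 0 ‖focus y‖, y₁ + r • (e.re, e.im, 0, 0) ∈
        Metric.ball y₀ (min ρ₁ (min ρ₂ ρ₃)) := by
      intro r hr
      rw [hpt, mem_ball_iff_norm]
      rw [mem_ball_iff_norm] at hyb
      exact (norm_scale_sub_le hf₀
        ⟨div_nonneg hr.1 hb.le, (div_le_one hb).2 hr.2⟩).trans_lt hyb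
    have hy₁b : y₁ ∈ Metric.ball y₀ (min ρ₁ (min ρ₂ ρ₃)) := by
      simpa using hdist 0 ⟨le_rfl, hb.le⟩
    have hfin := hK y₁ (e.re, e.im, 0, 0) ‖focus y‖ (by
        have h1 := Complex.abs_re_le_norm e
        have h2 := Complex.abs_im_le_norm e
        rw [hen] at h1 h2
        exact max_le h1 (max_le h2 (max_le (by simp) (by simp)))) hb (fun r hr => by
      refine ⟨hsub ⟨fun j => ?_, Metric.ball_subset_ball ((min_le_right _ _).trans
        (min_le_right _ _)) (hdist r hr)⟩, Metric.ball_subset_ball ((min_le_right _ _).trans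
        (min_le_left _ _)) (hdist r hr)⟩
      rw [hpt]
      exact (hyq j).le) (hray y₁ ⟨hyq, Metric.ball_subset_ball (min_le_left _ _) hy₁b⟩ hy₁f e heim)
    rw [hpt, div_self hb.ne', one_mul, one_mul] at hfin
    exact hfin
  refine ⟨K, min ρ₁ (min ρ₂ ρ₃), lt_min hρ₁ (lt_min hρ₂ hρ₃), fun y ⟨hyT, hyb⟩ => ?_⟩
  -- a general point is a limit of points off the hyperplanes `q₂ = 0` and `qᵉⱼ = 0`
  let w : Base ke kx := (0, 1, 1, 0)
  have h1 := tendsto_add_smul y w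
  have hq : ∀ t : ℝ, 0 < t → y + t • w ∈ openQuadrant ke kx := fun t ht j => by
    have := h.relOpen_source.subset hyT j
    simp only [w, Prod.snd_add, Prod.fst_add, Prod.smul_snd, Prod.smul_fst, Pi.add_apply,
      Pi.smul_apply, Pi.one_apply, smul_eq_mul, mul_one]
    linarith
  have hbt : ∀ᶠ t : ℝ in 𝓝[>] 0, y + t • w ∈ Metric.ball y₀ (min ρ₁ (min ρ₂ ρ₃)) :=
    h1.eventually_mem (Metric.isOpen_ball.mem_nhds hyb)
  have hne : ∀ᶠ t : ℝ in 𝓝[>] 0, (y + t • w).2.1 ≠ 0 := by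
    by_cases h0 : y.2.1 = 0
    · filter_upwards [self_mem_nhdsWithin] with t (ht : 0 < t)
      simpa [w, h0] using ht.ne'
    · exact ((continuous_fst.comp continuous_snd).tendsto y).comp h1 |>.eventually_ne h0
  have hT : ∀ᶠ t : ℝ in 𝓝[>] 0, y + t • w ∈ Q '' ψ.source := by
    filter_upwards [hbt, self_mem_nhdsWithin] with t h2 h3
    exact hsub ⟨openQuadrant_subset (hq t h3), Metric.ball_subset_ball ((min_le_right _ _).trans
      (min_le_right _ _)) h2⟩
  have h2 := ((hFs.continuousOn y hyT).norm).tendsto.comp (tendsto_nhdsWithin_iff.2 ⟨h1, hT⟩)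
  have h3 : Tendsto (fun t : ℝ => K * ‖focus (y + t • w)‖ ^ (N + 1)) (𝓝[>] 0)
      (𝓝 (K * ‖focus y‖ ^ (N + 1))) :=
    ((((contDiff_focus.continuous.tendsto y).comp h1).norm).pow (N + 1)).const_mul K
  refine le_of_tendsto_of_tendsto h2 h3 ?_
  filter_upwards [hbt, hne, self_mem_nhdsWithin] with t h4 h5 h6
  exact hgen _ ⟨hq t h6, h4⟩ h5

/-- The deviation of the first component of `B` from `± q₁` is flat at every critical value: it
vanishes at the focus-focus values, and its derivatives in the directions of `q₁` and `q₂` are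
flat. -/
theorem flatAt_fst_sub (h : Conjugates ψ B C) {p₀ : Model ke kx} (hp₀ : p₀ ∈ ψ.source)
    (hcr : IsCrit p₀) {ε₁ : ℤˣ}
    (hε₁ : ∀ c ∈ Q '' ψ.target, 0 < ((ε₁ : ℤ) : ℝ) * (firstRow ψ B c).re) :
    FlatAt (fun c => (B c).1 - ((ε₁ : ℤ) : ℝ) * c.1) (Q '' ψ.target) (Q (ψ p₀)) := by
  have hcr' := (h.isCrit_iff hp₀).1 hcr
  set c₀ := Q (ψ p₀) with hc₀def
  set T := Q '' ψ.target with hTdef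
  have hc₀ : c₀ ∈ T := h.mem_target hp₀
  have hB₀ : B c₀ = Q p₀ := h.eqB p₀ hp₀
  have hf₀ : focus c₀ = 0 := by rw [hc₀def, focus_Q, hcr'.1]; simp
  have hfB₀ : focus (B c₀) = 0 := by rw [hB₀, focus_Q, hcr.1]; simp
  obtain ⟨ρ₁, hρ₁, hfoc⟩ := h.exists_ball_focus hp₀ hcr
  obtain ⟨ρ₂, hρ₂, hsub⟩ := h.relOpen_target.exists_ball hc₀
  intro N
  obtain ⟨K, ρ, hρ, hK⟩ := h.exists_norm_firstRow_le hp₀ hcr hε₁ N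
  obtain ⟨L, hL⟩ := (h.hasFDerivWithinAt_B hc₀).isBigO_sub.bound
  have hBb : ∀ᶠ c in 𝓝[T] c₀, B c ∈ Metric.ball (Q p₀) ρ := by
    rw [← hB₀]
    exact (h.smoothB.continuousOn c₀ hc₀).eventually_mem (Metric.ball_mem_nhds _ hρ)
  obtain ⟨ρ₃, hρ₃, hev⟩ := Metric.mem_nhdsWithin_iff.1 (hL.and hBb)
  have hrow : ∀ c ∈ T, ‖c - c₀‖ < ρ₃ → ‖firstRow ψ B c - ((ε₁ : ℤ) : ℂ)‖
      ≤ |K| * (2 * (|L| * ‖c - c₀‖)) ^ (N + 1) := by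
    intro c hc hcn
    obtain ⟨h1, h2⟩ := hev ⟨mem_ball_iff_norm.2 hcn, hc⟩
    have h3 := hK (B c) ⟨h.mapsTo_B hc, h2⟩
    rw [h.C_B c hc] at h3
    have h4 : ‖focus (B c)‖ ≤ 2 * (|L| * ‖c - c₀‖) := by
      have h5 := norm_focus_le (B c - B c₀)
      rw [focus_sub, hfB₀, sub_zero] at h5
      have h6 : ‖B c - B c₀‖ ≤ |L| * ‖c - c₀‖ :=
        h1.trans (mul_le_mul_of_nonneg_right (le_abs_self L) (norm_nonneg _))
      linarith
    calc _ ≤ K * ‖focus (B c)‖ ^ (N + 1) := h3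
      _ ≤ |K| * ‖focus (B c)‖ ^ (N + 1) := by gcongr; exact le_abs_self K
      _ ≤ _ := by gcongr
  refine ⟨|K| * (2 * |L|) ^ (N + 1) * 2, min 1 (min ρ₁ (min ρ₂ ρ₃)),
    lt_min one_pos (lt_min hρ₁ (lt_min hρ₂ hρ₃)), fun s ⟨hs0, hs⟩ c hc hcs => ?_⟩
  have hs1 : s < 1 := hs.trans_le (min_le_left _ _)
  have hsρ₁ : s < ρ₁ := hs.trans_le ((min_le_right _ _).trans (min_le_left _ _))
  have hsρ₂ : s < ρ₂ := hs.trans_le ((min_le_right _ _).trans ((min_le_right _ _).trans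
    (min_le_left _ _)))
  have hsρ₃ : s < ρ₃ := hs.trans_le ((min_le_right _ _).trans ((min_le_right _ _).trans
    (min_le_right _ _)))
  -- the segment from the focus-focus value with the same elliptic and transverse coordinates
  let γ : ℝ → Base ke kx := fun t => (t * c.1, t * c.2.1, c.2.2)
  have hγs : ∀ t ∈ Icc (0 : ℝ) 1, ‖γ t - c₀‖ ≤ s := fun t ht =>
    (norm_scale_sub_le hf₀ ht).trans hcs
  have hγq : ∀ t, γ t ∈ quadrant ke kx := fun t j => h.relOpen_target.subset hc j
  have hγT : ∀ t ∈ Icc (0 : ℝ) 1, γ t ∈ T := fun t ht =>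
    hsub ⟨hγq t, mem_ball_iff_norm.2 ((hγs t ht).trans_lt hsρ₂)⟩
  have hγ' : ∀ t : ℝ, HasDerivAt γ (c.1, c.2.1, 0, 0) t := fun t =>
    (HasDerivAt.prodMk (by simpa using (hasDerivAt_id t).mul_const c.1)
      (HasDerivAt.prodMk (by simpa using (hasDerivAt_id t).mul_const c.2.1)
        (hasDerivAt_const t c.2.2)))
  have hd : ∀ t ∈ Icc (0 : ℝ) 1, HasDerivWithinAt (fun t => (B (γ t)).1 - ((ε₁ : ℤ) : ℝ) * (γ t).1)
      (((firstRow ψ B (γ t) - ((ε₁ : ℤ) : ℂ)).re) * c.1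
        + (firstRow ψ B (γ t) - ((ε₁ : ℤ) : ℂ)).im * c.2.1) (Icc 0 1) t := by
    intro t ht
    have h1 := (h.hasFDerivWithinAt_B (hγT t ht)).comp_hasDerivWithinAt t
      ((hγ' t).hasDerivWithinAt (s := Icc 0 1)) hγT
    have h2 := (ContinuousLinearMap.fst ℝ ℝ _).hasFDerivAt.comp_hasDerivWithinAt t h1
    have h3 := ((ContinuousLinearMap.fst ℝ ℝ _).hasFDerivAt.comp_hasDerivWithinAt t
      ((hγ' t).hasDerivWithinAt (s := Icc 0 1))).const_mul ((ε₁ : ℤ) : ℝ)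
    refine (h2.sub h3).congr_deriv ?_
    have h4 : ((c.1, c.2.1, 0, 0) : Base ke kx) = c.1 • (1, 0, 0, 0) + c.2.1 • (0, 1, 0, 0) := by
      simp
    rw [h4, map_add, map_smul, map_smul]
    simp [firstRow]
    ring
  have hcoord : |c.1| ≤ s ∧ |c.2.1| ≤ s := by
    obtain ⟨h1, h2⟩ := focus_eq_zero_iff.1 hf₀
    have h3 : ‖c.1 - c₀.1‖ ≤ ‖c - c₀‖ := le_max_left _ _
    have h4 : ‖c.2.1 - c₀.2.1‖ ≤ ‖c - c₀‖ := (le_max_left _ _).trans (le_max_right _ _)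
    rw [h1, sub_zero, Real.norm_eq_abs] at h3
    rw [h2, sub_zero, Real.norm_eq_abs] at h4
    exact ⟨h3.trans hcs, h4.trans hcs⟩
  have hM := norm_image_sub_le_of_norm_deriv_le_segment_01' hd
    (C := |K| * (2 * |L|) ^ (N + 1) * 2 * s ^ N) (fun t ht => by
      have ht := Ico_subset_Icc_self ht
      set z := firstRow ψ B (γ t) - ((ε₁ : ℤ) : ℂ)
      have h1 : ‖z‖ ≤ |K| * (2 * |L|) ^ (N + 1) * s ^ (N + 1) := by
        refine (hrow _ (hγT t ht) ((hγs t ht).trans_lt hsρ₃)).trans ?_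
        rw [mul_assoc |K|, ← mul_pow, ← mul_assoc 2]
        have := hγs t ht
        gcongr
      have h2 := (Complex.abs_re_le_norm z).trans h1
      have h3 := (Complex.abs_im_le_norm z).trans h1
      have h0 := (norm_nonneg z).trans h1
      have hsN : s ^ (N + 1) * s ≤ s ^ N := by
        rw [← pow_succ]
        exact pow_le_pow_of_le_one hs0.le hs1.le (by omega)
      calc ‖z.re * c.1 + z.im * c.2.1‖ ≤ |z.re| * |c.1| + |z.im| * |c.2.1| := by
            rw [Real.norm_eq_abs, ← abs_mul, ← abs_mul]; exact abs_add_le _ _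
        _ ≤ |K| * (2 * |L|) ^ (N + 1) * s ^ (N + 1) * s
            + |K| * (2 * |L|) ^ (N + 1) * s ^ (N + 1) * s :=
          add_le_add (mul_le_mul h2 hcoord.1 (abs_nonneg _) h0)
            (mul_le_mul h3 hcoord.2 (abs_nonneg _) h0)
        _ = |K| * (2 * |L|) ^ (N + 1) * 2 * (s ^ (N + 1) * s) := by ring
        _ ≤ _ := by gcongr)
  have hγ0 : (B (γ 0)).1 = 0 := (focus_eq_zero_iff.1 (hfoc (γ 0) ⟨hγq 0, mem_ball_iff_norm.2
    ((hγs 0 ⟨le_rfl, zero_le_one⟩).trans_lt hsρ₁)⟩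
    (focus_eq_zero_iff.2 ⟨zero_mul _, zero_mul _⟩)).2).1
  have hγ1 : γ 1 = c := by simp [γ]
  rw [hγ1, hγ0] at hM
  simpa [γ] using hM

end Conjugates

/-! ### The map of the base associated with a symplectomorphism -/

section
variable {ψ : OpenPartialHomeomorph (Model ke kx) (Model ke kx)}

/-- As leaves are fibres of `Q`, a map preserving the foliation descends to the base. -/
theorem PreservesFoliation.Q_psi_eq (hfol : PreservesFoliation ψ) {p p' : Model ke kx}
    (hp : p ∈ ψ.source) (hp' : p' ∈ ψ.source) (h : Q p = Q p') : Q (ψ p) = Q (ψ p') := by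
  have h1 : ψ p' ∈ leaf (ψ p) ∩ ψ.target := by
    rw [← hfol p hp]
    refine ⟨p', ⟨?_, hp'⟩, rfl⟩
    rw [leaf_eq]
    exact h.symm
  have h2 := h1.1
  rw [leaf_eq] at h2
  exact Eq.symm h2

theorem PreservesFoliation.Q_symm_eq (hfol : PreservesFoliation ψ) {p p' : Model ke kx}
    (hp : p ∈ ψ.target) (hp' : p' ∈ ψ.target) (h : Q p = Q p') :
    Q (ψ.symm p) = Q (ψ.symm p') := by
  have h1 : p' ∈ ψ '' (leaf (ψ.symm p) ∩ ψ.source) := by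
    rw [hfol _ (ψ.map_target hp), ψ.right_inv hp, leaf_eq]
    exact ⟨h.symm, hp'⟩
  obtain ⟨x, ⟨hx, hxs⟩, rfl⟩ := h1
  rw [leaf_eq] at hx
  rw [ψ.left_inv hxs]
  exact Eq.symm hx

theorem exists_isAssociated (hsymp : IsSymplectomorphism ψ) (hfol : PreservesFoliation ψ) :
    ∃ B, IsAssociated ψ B := by
  obtain ⟨B, hB, hBQ⟩ := exists_contDiffOn_comp_Q ψ.open_target (f := fun p => Q (ψ.symm p))
    (contDiffOn_comp_proj hsymp.2 contDiff_Q_proj) (fun p hp p' hp' h => hfol.Q_symm_eq hp hp' h)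
  obtain ⟨C, hC, hCQ⟩ := exists_contDiffOn_comp_Q ψ.open_source (f := fun p => Q (ψ p))
    (contDiffOn_comp_proj hsymp.1 contDiff_Q_proj) (fun p hp p' hp' h => hfol.Q_psi_eq hp hp' h)
  refine ⟨B, hBQ, hB, C, hC, ?_, ?_, ?_, ?_⟩
  · rintro _ ⟨p, hp, rfl⟩
    exact ⟨_, ψ.map_target hp, hBQ p hp⟩
  · rintro _ ⟨p, hp, rfl⟩
    exact ⟨_, ψ.map_source hp, hCQ p hp⟩
  · rintro _ ⟨p, hp, rfl⟩
    rw [← hBQ p hp, ← hCQ _ (ψ.map_target hp), ψ.right_inv hp]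
  · rintro _ ⟨p, hp, rfl⟩
    rw [← hCQ p hp, ← hBQ _ (ψ.map_source hp), ψ.left_inv hp]

/-- The results on `Conjugates` apply to every map of the base associated with `ψ`. -/
theorem IsAssociated.exists_conjugates {B : Base ke kx → Base ke kx} (hB : IsAssociated ψ B)
    (hconn : IsConnected ψ.source) (hsat : IsSaturated ψ.source) (hsymp : IsSymplectomorphism ψ) :
    ∃ C, Conjugates ψ B C := by
  obtain ⟨hBQ, hBs, C, hCs, -, -, hCB, -⟩ := hB
  have h1 : ∀ p ∈ ψ.source, B (Q (ψ p)) = Q p := fun p hp => by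
    rw [← hBQ _ (ψ.map_source hp), ψ.left_inv hp]
  exact ⟨C, hconn, hsat, hsymp, h1, fun p hp => by
    rw [← h1 p hp, hCB ⟨_, ψ.map_source hp, rfl⟩], hBs, hCs⟩

end

theorem FlatAt.apply_iteratedFDerivWithin {T : Set (Base ke kx)} (hT : IsRelOpen T)
    {f : Base ke kx → ℝ} {c : Base ke kx} (h : FlatAt f T c) (hc : c ∈ T)
    (hf : ContDiffOn ℝ ∞ f T) (k : ℕ) (v : Base ke kx) :
    iteratedFDerivWithin ℝ k f T c (fun _ => v) = 0 := by
  rw [h.iteratedFDerivWithin_eq_zero hT.uniqueDiffOn (hT.isCornerAt hc) hc k hf]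
  rfl

/-- A function which is flat at every point of `S` is in the class `Flat`, and so are its first
derivatives. -/
theorem mem_Flat_of_flatAt {T S : Set (Base ke kx)} (hT : IsRelOpen T) (hS : S ⊆ T)
    {f : Base ke kx → ℝ} (hf : ContDiffOn ℝ ∞ f T) (h : ∀ c ∈ S, FlatAt f T c) :
    f ∈ Flat (S ×ˢ univ) T ∧
      ∀ v, (fun c => fderivWithin ℝ f T c v) ∈ Flat (S ×ˢ univ) T := by
  refine ⟨⟨hf, fun cv hcv k => (h _ hcv.1).apply_iteratedFDerivWithin hT (hS hcv.1) hf k _⟩,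
    fun v => ?_⟩
  have hf' : ContDiffOn ℝ ∞ (fun c => fderivWithin ℝ f T c v) T :=
    (hf.fderivWithin hT.uniqueDiffOn (by simp)).clm_apply contDiffOn_const
  refine ⟨hf', fun cv hcv k => FlatAt.apply_iteratedFDerivWithin hT ?_ (hS hcv.1) hf' k _⟩
  intro N
  obtain ⟨K, ρ, hρ, hK⟩ :=
    (h _ hcv.1).fderivWithin hT.uniqueDiffOn (hT.isCornerAt (hS hcv.1)) (hS hcv.1) hf N
  refine ⟨K * ‖v‖, ρ, hρ, fun s hs c hc hcs => ?_⟩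
  calc _ ≤ ‖fderivWithin ℝ f T c‖ * ‖v‖ := ContinuousLinearMap.le_opNorm _ _
    _ ≤ K * s ^ N * ‖v‖ := by gcongr; exact hK s hs c hc hcs
    _ = _ := by ring

/-- `lowerRows` as a linear map. -/
def lowerRowsLin (ε₂ : ℤˣ) (εe : Fin ke → ℤˣ) (σ : Equiv.Perm (Fin ke)) (Xf : Fin kx → ℤ)
    (Xe : Matrix (Fin kx) (Fin ke) ℤ) (Xx : Matrix.GeneralLinearGroup (Fin kx) ℤ) :
    Base ke kx →ₗ[ℝ] ℝ × (Fin ke → ℝ) × (Fin kx → ℝ) where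
  toFun := lowerRows ε₂ εe σ Xf Xe Xx
  map_add' c c' := by
    refine Prod.ext ?_ (Prod.ext (funext fun i => ?_) (funext fun l => ?_))
    · simp [lowerRows, mul_add]
    · simp [lowerRows, mul_add]
    · simp only [lowerRows, Prod.snd_add, Prod.fst_add, Pi.add_apply, mul_add,
        Finset.sum_add_distrib]
      ring
  map_smul' r c := by
    refine Prod.ext ?_ (Prod.ext (funext fun i => ?_) (funext fun l => ?_))
    · simp [lowerRows, mul_left_comm]
    · simp [lowerRows, mul_left_comm]
    · simp only [lowerRows, Prod.smul_snd, Prod.smul_fst, Pi.smul_apply, smul_eq_mul,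
        RingHom.id_apply, mul_add, Finset.mul_sum, mul_left_comm]

/-- Near a critical point there are points at which exactly one elliptic coordinate vanishes. -/
theorem exists_mem_elliptic_eq_zero {U : Set (Model ke kx)} (hU : IsOpen U) {p₀ : Model ke kx}
    (hp₀ : p₀ ∈ U) (hcr : IsCrit p₀) (i : Fin ke) :
    ∃ p ∈ U, ∀ j, p.2.1 j = 0 ↔ j = i := by
  let S : ℝ → Model ke kx := fun t => (p₀.1, fun j => if j = i then 0 else (t : ℂ), p₀.2.2)
  have hS : Continuous S := by
    refine continuous_const.prodMk (Continuous.prodMk (continuous_pi fun j => ?_) continuous_const)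
    split_ifs <;> fun_prop
  have hS0 : S 0 = p₀ := by
    refine Prod.ext rfl (Prod.ext ?_ rfl)
    rw [hcr.2]
    funext j
    simp [S]
  have h1 : ∀ᶠ t : ℝ in 𝓝[>] 0, S t ∈ U :=
    (hS.continuousAt.eventually_mem (by rw [hS0]; exact hU.mem_nhds hp₀)).filter_mono
      nhdsWithin_le_nhds
  obtain ⟨t, ht, ht0 : 0 < t⟩ := (h1.and self_mem_nhdsWithin).exists
  refine ⟨S t, ht, fun j => ?_⟩
  by_cases hj : j = i <;> simp [S, hj, ht0.ne']

end SemiToric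

end

end

theorem mainTheorem4 (ke kx : ℕ)
    (ψ : OpenPartialHomeomorph (SemiToric.Model ke kx) (SemiToric.Model ke kx))
    (hconn : IsConnected ψ.source) (hsat : SemiToric.IsSaturated ψ.source)
    (hcrit : (SemiToric.critPoints ψ.source).Nonempty)
    (hsymp : SemiToric.IsSymplectomorphism ψ) (hfol : SemiToric.PreservesFoliation ψ) :
    (∃ B, SemiToric.IsAssociated ψ B) ∧
    ∀ B, SemiToric.IsAssociated ψ B →
      ∃ (ε₁ ε₂ : ℤˣ) (εe : Fin ke → ℤˣ) (σ : Equiv.Perm (Fin ke)) (Xf : Fin kx → ℤ)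
        (Xe : Matrix (Fin kx) (Fin ke) ℤ) (Xx : Matrix.GeneralLinearGroup (Fin kx) ℤ)
        (κ : Fin kx → ℝ) (u : SemiToric.Base ke kx → ℝ),
        u ∈ SemiToric.Flat (SemiToric.critValues ψ.target ×ˢ Set.univ) (SemiToric.Q '' ψ.target) ∧
        (∀ c ∈ SemiToric.Q '' ψ.target,
          B c = (((ε₁ : ℤ) : ℝ) * c.1 + u c,
            SemiToric.lowerRows ε₂ εe σ Xf Xe Xx c + (0, 0, κ))) ∧
        (∀ c ∈ SemiToric.Q '' ψ.target, ∀ v : SemiToric.Base ke kx,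
          fderivWithin ℝ B (SemiToric.Q '' ψ.target) c v =
            (((ε₁ : ℤ) : ℝ) * v.1 + fderivWithin ℝ u (SemiToric.Q '' ψ.target) c v,
              SemiToric.lowerRows ε₂ εe σ Xf Xe Xx v)) ∧
        (∀ v : SemiToric.Base ke kx,
          (fun c => fderivWithin ℝ u (SemiToric.Q '' ψ.target) c v) ∈
            SemiToric.Flat (SemiToric.critValues ψ.target ×ˢ Set.univ)
              (SemiToric.Q '' ψ.target)) ∧
        ((∀ p ∈ ψ.source, ∀ i, p.2.1 i = 0 → (ψ p).2.1 i = 0) → σ = 1) ∧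
        ((∃ p ∈ SemiToric.zeroTorus, p ∈ ψ.source ∧ ψ p ∈ SemiToric.zeroTorus) → κ = 0) := by
  refine ⟨SemiToric.exists_isAssociated hsymp hfol, fun B hB => ?_⟩
  obtain ⟨C, h⟩ := hB.exists_conjugates hconn hsat hsymp
  obtain ⟨p₀, hp₀, hcr⟩ := hcrit
  obtain ⟨ε₁, hε₁⟩ := h.exists_sign
  obtain ⟨ε₂, σ, Xf, Xe, Xx, κ, hlow⟩ := h.exists_lowerRows hp₀ hcr
  have hT := h.relOpen_target
  set T := SemiToric.Q '' ψ.target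
  let u : SemiToric.Base ke kx → ℝ := fun c => (B c).1 - ((ε₁ : ℤ) : ℝ) * c.1
  have hu : ContDiffOn ℝ ∞ u T :=
    (contDiff_fst.comp_contDiffOn h.smoothB).sub (contDiffOn_const.mul contDiff_fst.contDiffOn)
  have hBu : ∀ c ∈ T, B c = (((ε₁ : ℤ) : ℝ) * c.1 + u c,
      SemiToric.lowerRows ε₂ (fun _ => 1) σ Xf Xe Xx c + (0, 0, κ)) := fun c hc =>
    Prod.ext (by simp [u]) (hlow c hc)
  have hflat : ∀ c ∈ SemiToric.critValues ψ.target, SemiToric.FlatAt u T c := by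
    rintro _ ⟨P, ⟨hP, hPc⟩, rfl⟩
    have h1 := ψ.map_target hP
    have h2 := h.flatAt_fst_sub h1 ((h.isCrit_iff h1).2 (by rw [ψ.right_inv hP]; exact hPc)) hε₁
    rwa [ψ.right_inv hP] at h2
  obtain ⟨hF, hF'⟩ := SemiToric.mem_Flat_of_flatAt hT
    (Set.image_mono fun _ hP => hP.1) hu hflat
  -- `B` preserves the quadrant, so that no elliptic row changes sign
  refine ⟨ε₁, ε₂, fun _ => 1, σ, Xf, Xe, Xx, κ, u, hF, hBu, fun c hc v => ?_, hF', fun hell => ?_,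
    fun ⟨p, hp0, hps, hψp⟩ => ?_⟩
  · have h1 : HasFDerivWithinAt (fun c : SemiToric.Base ke kx => (((ε₁ : ℤ) : ℝ) * c.1 + u c,
        SemiToric.lowerRows ε₂ (fun _ => 1) σ Xf Xe Xx c + (0, 0, κ)))
        ((((ε₁ : ℤ) : ℝ) • ContinuousLinearMap.fst ℝ ℝ _ + fderivWithin ℝ u T c).prod
          (SemiToric.lowerRowsLin ε₂ (fun _ => 1) σ Xf Xe Xx).toContinuousLinearMap) T c :=
      ((hasFDerivWithinAt_fst.const_mul _).add
        (hu.differentiableOn (by simp) c hc).hasFDerivWithinAt).prodMk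
        ((SemiToric.lowerRowsLin ε₂ (fun _ => 1) σ Xf Xe
          Xx).toContinuousLinearMap.hasFDerivWithinAt.add_const _)
    rw [(h1.congr hBu (hBu c hc)).fderivWithin (hT.uniqueDiffOn c hc)]
    rfl
  · refine Equiv.ext fun i => ?_
    obtain ⟨p, hp, hpi⟩ := SemiToric.exists_mem_elliptic_eq_zero ψ.open_source hp₀ hcr i
    have h1 := congrArg (fun x => x.2.1 (σ.symm i)) (hlow _ (h.mem_target hp))
    rw [h.eqB p hp] at h1
    simp only [SemiToric.lowerRows, Prod.snd_add, Prod.fst_add, Pi.add_apply, Pi.zero_apply,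
      Equiv.apply_symm_apply, Units.val_one, Int.cast_one, one_mul, add_zero,
      SemiToric.Q_eq_zero_of_eq_zero (hell p hp i ((hpi i).2 rfl))] at h1
    have h2 := (hpi _).1 (by_contra fun hne => (SemiToric.Q_pos_of_ne_zero hne).ne' h1)
    exact (σ.symm_apply_eq.1 h2).symm
  · have hQ0 : ∀ {q : SemiToric.Model ke kx}, q ∈ SemiToric.zeroTorus → SemiToric.Q q = 0 := by
      rintro q ⟨h1, h2, h3⟩
      refine Prod.ext ?_ (Prod.ext ?_ (Prod.ext (funext fun j => ?_) h3)) <;>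
        simp [SemiToric.Q, h1, h2]
    have h1 := hlow _ (h.mem_target hps)
    rw [h.eqB p hps, hQ0 hp0, hQ0 hψp] at h1
    have h2 := congrArg (fun x => x.2.2) h1
    funext l
    simpa [SemiToric.lowerRows] using (congrFun h2 l).symm
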